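/- Let $k$ be a field of characteristic $0$, and let $\mathbf{Sm}_k$ be the category of smooth quasi-projective $k$-schemes. Conventions. A pseudo-divisor on $X$ is $D=(\mathcal L,s)$ with $\mathcal L=O_X(D)$ a line bundle and $s$ a global section; $\operatorname{div}D$ is the subscheme $s=0$ and $|D|$ its support, with reduced structure. SNC divisors are effective, may be $0$, and are regarded as pseudo-divisors. The faces of an SNC divisor $E=\sum_{i=1}^m n_iE_i$ ($E_i$ irreducible) are $E^J=\bigcap_{i\in J}E_i$, $\emptyset\ne J\subseteq\{1,\dots,m\}$. Let $D_*=(D_1,\dots,D_r)$ be pseudo-divisors on $X$. A morphism $g:Y\to X$ with $Y\in\mathbf{Sm}_k$ irreducible is admissible with respect to $D_*$ if for each $s$ the scheme $\bigcap_{i\le s}\operatorname{div}g^*D_i$ is $Y$, is empty, or is an SNC divisor on $Y$; for general $Y$, if this holds on every irreducible component. An SNC divisor $E$ on $Y\in\mathbf{Sm}_k$ (with a given $Y\to X$) is admissible with respect to $D_*$ if $E^J\to Y\to X$ is so for every face. On irreducible $Y$, with $g$ admissible, an SNC divisor $Z$ is in good position with respect to $D_*$ if all $g^*D_i$ have support $Y$,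 or if $Z+\operatorname{div}g^*D_{i_0}$ is SNC for the smallest $i_0$ with $|g^*D_{i_0}|\neq Y$. Let $(F_{\mathbb L},\mathbb L)$ be the universal formal group law. For $X$ of finite type over $k$, $\Omega_*(X)_{D_*}$ is the $\mathbb L$-module generated by isomorphism classes of cobordism cycles $(g:Y\to X,L_1,\dots,L_m)$ ($Y\in\mathbf{Sm}_k$ irreducible, $g$ projective and admissible with respect to $D_*$, $L_i$ line bundles on $Y$, unordered), modulo the relations: (Dim) $(g,\pi^*L_1,\dots,\pi^*L_m,M_1,\dots,M_s)=0$ for $\pi:Y\to Z$ smooth quasi-projective, $Z\in\mathbf{Sm}_k$, $m>\dim Z$; (Sect) $(g,L_1,\dots,L_m)=(g\circ i:Z\to X,i^*L_1,\dots,i^*L_{m-1})$ for $i:Z\to Y$ the zero scheme of a section of $L_m$ transverse to the zero section, $Z$ in good position with respect to $D_*$ (a disconnected $Z$ stands for the sum over its components); (FGL) $F_{\mathbb L}(\tilde c_1(L),\tilde c_1(M))=\tilde c_1(L\otimes M)$ on each cycle with source $Y$, for line bundles $L,M$ on $Y$, where $\tilde c_1(L)$ adds $L$ to the list of line bundles.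 Pseudo-divisors are pulled back tacitly, so $\Omega_*(X')_{D_*}$ makes sense for $X'\to X$; push-forward $g_*$ along projective $g$ is composition with $g$. If $E=\sum n_iE_i$ is an SNC divisor on $Y$, admissible with respect to $D_*$, its class is $$[E\to|E|]_{D_*}=\sum_{J\neq\emptyset}\iota^J_*\Bigl(F_J\bigl(\tilde c_1(O_Y(E_1)),\dots,\tilde c_1(O_Y(E_m))\bigr)(1_{E^J})\Bigr)\in\Omega_*(|E|)_{D_*},$$ where $\iota^J:E^J\to|E|$ is the inclusion, $1_{E^J}=(\mathrm{Id}_{E^J})$, and $n_1\cdot_Fu_1+_F\dots+_Fn_m\cdot_Fu_m=\sum_Ju^JF_J$ with $F_J$ involving only the $u_i$, $i\in J$. For pseudo-divisors $D,E_1,\dots,E_r$, the intersection map $D(-)_{E_*}$ is the $\mathbb L$-linear map sending a cobordism cycle $(g:Y\to X,L_1,\dots,L_m)$, admissible with respect to $D,E_*$, to the class in $\Omega_*(|D|)_{E_*}$ of $(Y\to|D|,L_1,\dots,L_m,g^*O_X(D))$ if $g(Y)\subseteq|D|$, and to $g^D_*\bigl(\tilde c_1(L_1)\cdots\tilde c_1(L_m)[\operatorname{div}g^*D\to|g^*D|]_{E_*}\bigr)$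 otherwise, where $g^D:|g^*D|\to|D|$ is the restriction of $g$. Applied to a divisor class $[B\to|B|]_{D,E_*}$, it is applied to the combination of cobordism cycles that defines the class. Proposition. Let $W\in\mathbf{Sm}_k$, let $E_1,\dots,E_r$ be pseudo-divisors on $W$, let $f:T\to W$ be a morphism in $\mathbf{Sm}_k$, and let $D_0,D_1,B$ be SNC divisors on $T$. Suppose that $\mathrm{Id}_T$ is admissible with respect to $D_0,f^*E_*$ and with respect to $B,f^*E_*$, that $D_0+B$ is an SNC divisor, and that $O_T(D_0)\cong O_T(D_1)$. Suppose moreover that there is an open subscheme $V\subseteq T$ with $|D_1|\subseteq V$ such that (a) $f_V:=f|_V:V\to W$ is smooth of relative dimension one with geometrically irreducible fibres; (b) there is an SNC divisor $\bar B$ on $W$, admissible with respect to $E_*$, with $B\cap V=f_V^*(\bar B)$; (c) $f_V$ has a section $s:W\to V$ and $D_1$ is the reduced divisor $s(W)$. Let $i_j:|D_j|\cap|B|\to|B|$ be the inclusions, $j=0,1$. Then $B$ is admissible with respect to $D_0,E_*$, the divisor $B\cap D_1$ on $D_1$ is admissible with respect to $E_*$, and $$i_{0*}\bigl(D_0([B\to|B|]_{D_0,E_*})_{E_*}\bigr)=i_{1*}\bigl([B\cap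 D_1\to|D_1|\cap|B|]_{E_*}\bigr)\quad\text{in }\Omega_*(|B|)_{E_*}.$$ -/

import Mathlib

open AlgebraicGeometry CategoryTheory CategoryTheory.Limits TopologicalSpace

universe u

noncomputable section

namespace RefinedCobordism

section Schemes

variable {k : Type u} [Field k]

attribute [local instance] MvPolynomial.gradedAlgebra

variable (k) in
/-- Projective `n`-space over `k`. -/
def projSpace (n : ℕ) : Scheme.{u} :=
  Proj (MvPolynomial.homogeneousSubmodule (Fin (n + 1)) k)

variable (k) in
/-- The structure morphism of projective `n`-space over `k`. -/
def projSpaceHom (n : ℕ) : projSpace k n ⟶ Spec (CommRingCat.of k) :=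
  Proj.toSpecZero (MvPolynomial.homogeneousSubmodule (Fin (n + 1)) k) ≫
    Spec.map (CommRingCat.ofHom
      (algebraMap k (MvPolynomial.homogeneousSubmodule (Fin (n + 1)) k 0)))

instance isProper_projSpaceHom (n : ℕ) : IsProper (projSpaceHom k n) := by
  have h1 : Function.Surjective
      (algebraMap k (MvPolynomial.homogeneousSubmodule (Fin (n + 1)) k 0)) := by
    rintro ⟨x, hx⟩
    have h0 : x.totalDegree = 0 := by
      simpa using ((MvPolynomial.mem_homogeneousSubmodule _ _).1 hx).totalDegree_le
    exact ⟨_, Subtype.ext (MvPolynomial.totalDegree_eq_zero_iff_eq_C.1 h0).symm⟩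
  have : IsScalarTower k (MvPolynomial.homogeneousSubmodule (Fin (n + 1)) k 0)
      (MvPolynomial (Fin (n + 1)) k) :=
    ⟨fun a b c => smul_mul_assoc a (b : MvPolynomial (Fin (n + 1)) k) c⟩
  have : Algebra.FiniteType (MvPolynomial.homogeneousSubmodule (Fin (n + 1)) k 0)
      (MvPolynomial (Fin (n + 1)) k) := .of_restrictScalars_finiteType k _ _
  have : IsClosedImmersion (Spec.map (CommRingCat.ofHom
      (algebraMap k (MvPolynomial.homogeneousSubmodule (Fin (n + 1)) k 0)))) :=
    IsClosedImmersion.spec_of_surjective _ h1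
  exact inferInstanceAs (IsProper (Proj.toSpecZero _ ≫ Spec.map _))

variable {P X Y Z : Scheme.{u}}

/-- `f : Y ⟶ X` is projective: it factors as a closed immersion into `ℙⁿ × X` followed by the
projection. -/
def IsProjective (f : Y ⟶ X) (p : X ⟶ Spec (CommRingCat.of k)) : Prop :=
  ∃ (n : ℕ) (i : Y ⟶ pullback p (projSpaceHom k n)),
    IsClosedImmersion i ∧ i ≫ pullback.fst _ _ = f

/-- `f : Y ⟶ X` is quasi-projective: it factors as an immersion into `ℙⁿ × X` followed by the
projection. -/
def IsQuasiProjective (f : Y ⟶ X) (p : X ⟶ Spec (CommRingCat.of k)) : Prop :=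
  ∃ (n : ℕ) (i : Y ⟶ pullback p (projSpaceHom k n)),
    IsImmersion i ∧ i ≫ pullback.fst _ _ = f

/-- `Y` with structure morphism `q` is in `Sm_k`: smooth and quasi-projective over `k`. -/
structure IsSm (q : Y ⟶ Spec (CommRingCat.of k)) : Prop where
  smooth : Smooth q
  quasiProjective : ∃ (n : ℕ) (i : Y ⟶ projSpace k n), IsImmersion i ∧ i ≫ projSpaceHom k n = q

theorem IsProjective.isProper {f : Y ⟶ X} {p : X ⟶ Spec (CommRingCat.of k)}
    (h : IsProjective f p) : IsProper f := by
  obtain ⟨n, i, hi, rfl⟩ := h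
  infer_instance

theorem IsProjective.of_isProper (f : Y ⟶ X) {p : X ⟶ Spec (CommRingCat.of k)}
    (hY : IsSm (f ≫ p)) [IsProper f] : IsProjective f p := by
  obtain ⟨n, i, hi, hw⟩ := hY.quasiProjective
  let j := pullback.lift f i hw.symm
  have h1 : j ≫ pullback.fst p (projSpaceHom k n) = f := pullback.lift_fst ..
  have h2 : j ≫ pullback.snd p (projSpaceHom k n) = i := pullback.lift_snd ..
  refine ⟨n, j, ?_, h1⟩
  have : IsImmersion (j ≫ pullback.snd p (projSpaceHom k n)) := h2 ▸ hi
  have := IsImmersion.of_comp j (pullback.snd p (projSpaceHom k n))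
  have : IsProper (j ≫ pullback.fst p (projSpaceHom k n)) := h1 ▸ ‹_›
  have : IsProper j := MorphismProperty.of_postcomp (W := @IsProper) (W' := @IsSeparated) j
    (pullback.fst p (projSpaceHom k n)) inferInstance ‹_›
  exact IsClosedImmersion.of_isPreimmersion _ j.isClosedMap.isClosed_range

theorem IsSm.noetherianSpace {q : Y ⟶ Spec (CommRingCat.of k)} (hY : IsSm q) :
    NoetherianSpace Y := by
  obtain ⟨n, i, hi, -⟩ := hY.quasiProjective
  have : IsLocallyNoetherian (projSpace k n) :=
    LocallyOfFiniteType.isLocallyNoetherian (projSpaceHom k n)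
  have : CompactSpace (projSpace k n) :=
    QuasiCompact.compactSpace_of_compactSpace (projSpaceHom k n)
  have : IsNoetherian (projSpace k n) := {}
  exact i.isEmbedding.isInducing.noetherianSpace

/-- The closed subset `Z` of `X` with its reduced subscheme structure. -/
abbrev red (Z : Closeds X) : Scheme.{u} := (Scheme.IdealSheafData.vanishingIdeal Z).subscheme

/-- The inclusion of a closed subset with its reduced subscheme structure. -/
abbrev redι (Z : Closeds X) : red Z ⟶ X := (Scheme.IdealSheafData.vanishingIdeal Z).subschemeι

theorem range_redι (Z : Closeds X) : Set.range (redι Z) = Z := by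
  have := (Scheme.IdealSheafData.vanishingIdeal Z).range_subschemeι
  rwa [Scheme.IdealSheafData.coe_support_vanishingIdeal] at this

theorem ker_redι_le [IsReduced Y] (f : Y ⟶ X) (Z : Closeds X)
    (h : Set.range f ⊆ Z) : (redι Z).ker ≤ f.ker := by
  rw [Scheme.IdealSheafData.ker_subschemeι,
    ← Scheme.IdealSheafData.map_bot, ← Scheme.nilradical_eq_bot,
    ← Scheme.IdealSheafData.vanishingIdeal_top, Scheme.IdealSheafData.map_vanishingIdeal]
  apply Scheme.IdealSheafData.vanishingIdeal_antimono
  rw [Closeds.closure_le]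
  simpa using h

instance isReduced_red (Z : Closeds X) : IsReduced (red Z) := by
  have : ∀ U, IsReduced
      ((Scheme.IdealSheafData.vanishingIdeal Z).subschemeCover.openCover.X U) := by
    intro (U : X.affineOpens)
    have : _root_.IsReduced
        (Γ(X, U) ⧸ (Scheme.IdealSheafData.vanishingIdeal Z).ideal U) := by
      rw [← Ideal.isRadical_iff_quotient_reduced, Scheme.IdealSheafData.vanishingIdeal_ideal]
      exact PrimeSpectrum.isRadical_vanishingIdeal _
    exact inferInstanceAs (IsReduced (Spec (.of (Γ(X, U) ⧸
      (Scheme.IdealSheafData.vanishingIdeal Z).ideal U))))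
  exact IsReduced.of_openCover _
    ((Scheme.IdealSheafData.vanishingIdeal Z).subschemeCover.openCover)

theorem isIntegral_red (F : Closeds X) (hF : IsIrreducible (F : Set X)) : IsIntegral (red F) := by
  have h : IsIrreducible ((Scheme.IdealSheafData.vanishingIdeal F).support : Set X) := by
    rwa [Scheme.IdealSheafData.coe_support_vanishingIdeal]
  have : IrreducibleSpace (red F) := Subtype.irreducibleSpace h
  exact isIntegral_of_irreducibleSpace_of_isReduced _

/-- A morphism from a reduced scheme with set-theoretic image in `Z` factors through `red Z`. -/
def redLift [IsReduced Y] (f : Y ⟶ X) (Z : Closeds X) (h : Set.range f ⊆ Z) : Y ⟶ red Z :=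
  IsClosedImmersion.lift (redι Z) f (ker_redι_le f Z h)

theorem redLift_redι [IsReduced Y] (f : Y ⟶ X) (Z : Closeds X) (h : Set.range f ⊆ Z) :
    redLift f Z h ≫ redι Z = f :=
  IsClosedImmersion.lift_fac _ _ _

/-- The irreducible components of a closed subset. -/
def components (Z : Closeds X) : Set (Closeds X) :=
  {F | Maximal (fun F' : Closeds X => IsIrreducible (F' : Set X) ∧ F' ≤ Z) F}

theorem finite_components [NoetherianSpace X] (Z : Closeds X) : (components Z).Finite := by
  obtain ⟨S, hSf, hSc, hS, hZ⟩ :=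
    NoetherianSpace.exists_finite_set_isClosed_irreducible Z.isClosed
  refine (hSf.preimage (f := fun c : Closeds X => (c : Set X))
    SetLike.coe_injective.injOn).subset fun F hF => ?_
  obtain ⟨⟨hF1, hF2⟩, hF3⟩ := hF
  obtain ⟨t, ht, hFt⟩ := isIrreducible_iff_sUnion_isClosed.1 hF1 hSf.toFinset
    (by simpa using hSc) (by simpa [← hZ] using hF2)
  have ht' : t ∈ S := by simpa using ht
  have hle : t ⊆ Z := hZ ▸ Set.subset_sUnion_of_mem ht'
  have := hF3 (y := ⟨t, hSc t ht'⟩) ⟨hS t ht', hle⟩ hFt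
  have : (F : Set X) = t := Set.Subset.antisymm hFt this
  simpa [this] using ht'

end Schemes

section Lazard

/-- The generic unital power series `u + v + ∑_{i, j ≥ 1} a_{ij} uⁱ vʲ`; the polynomial variable
indexed by `(i, j)` stands for `a_{i+1, j+1}`. -/
def genericSeries : MvPowerSeries (Fin 2) (MvPolynomial (ℕ × ℕ) ℤ) := fun e =>
  match e 0, e 1 with
  | 1, 0 => 1
  | 0, 1 => 1
  | i + 1, j + 1 => MvPolynomial.X (i, j)
  | _, _ => 0

/-- The relations expressing associativity and commutativity of the generic series. -/
def lazardIdeal : Ideal (MvPolynomial (ℕ × ℕ) ℤ) :=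
  Ideal.span
    (Set.range (fun e : Fin 3 →₀ ℕ => MvPowerSeries.coeff e
      (genericSeries.subst ![genericSeries.subst
          ![MvPowerSeries.X (0 : Fin 3), MvPowerSeries.X (1 : Fin 3)], MvPowerSeries.X (2 : Fin 3)]
        - genericSeries.subst ![MvPowerSeries.X (0 : Fin 3), genericSeries.subst
          ![MvPowerSeries.X (1 : Fin 3), MvPowerSeries.X (2 : Fin 3)]] :
            MvPowerSeries (Fin 3) (MvPolynomial (ℕ × ℕ) ℤ)))
    ∪ Set.range (fun q : ℕ × ℕ => MvPolynomial.X q - MvPolynomial.X q.swap))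

/-- The Lazard ring. -/
abbrev Lazard : Type := MvPolynomial (ℕ × ℕ) ℤ ⧸ lazardIdeal

theorem genericSeries_constantCoeff : genericSeries.constantCoeff = 0 := rfl

open MvPowerSeries in
/-- The universal commutative formal group law `F_𝕃`. -/
def universalFGL : FormalGroup Lazard where
  toPowerSeries := genericSeries.map (Ideal.Quotient.mk lazardIdeal)
  zero_constantCoeff := by
    simp [genericSeries_constantCoeff]
  lin_coeff_X := by
    rw [MvPowerSeries.coeff_map]
    have : genericSeries.coeff (Finsupp.single 0 1) = 1 := by
      simp [MvPowerSeries.coeff_apply, genericSeries]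
    rw [this, map_one]
  lin_coeff_Y := by
    rw [MvPowerSeries.coeff_map]
    have : genericSeries.coeff (Finsupp.single 1 1) = 1 := by
      simp [MvPowerSeries.coeff_apply, genericSeries]
    rw [this, map_one]
  assoc := by
    set f := Ideal.Quotient.mk lazardIdeal
    have (g₁ g₂ : MvPowerSeries (Fin 3) (MvPolynomial (ℕ × ℕ) ℤ)) : ![g₁.map f, g₂.map f] =
      fun i => (![g₁, g₂] i).map f := by ext1 i; fin_cases i <;> simp
    simp_rw [(map_X f _).symm, this, ← map_subst .X_X, this]
    rw [← map_subst
      (HasSubst.cons_subst_zero_left (0 : Fin 3) 1 2 genericSeries_constantCoeff),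
      ← map_subst (HasSubst.cons_subst_zero_right (0 : Fin 3) 1 2 genericSeries_constantCoeff)]
    ext e
    rw [coeff_map, coeff_map, ← sub_eq_zero, ← map_sub, ← map_sub, Ideal.Quotient.eq_zero_iff_mem]
    exact Ideal.subset_span (Or.inl ⟨e, rfl⟩)

/-- The formal sum `a +_F b`. -/
def fglAdd {m : ℕ} (a b : MvPowerSeries (Fin m) Lazard) : MvPowerSeries (Fin m) Lazard :=
  universalFGL.toPowerSeries.subst ![a, b]

/-- The formal multiple `n ·_F a`. -/
def fglMul {m : ℕ} (n : ℕ) (a : MvPowerSeries (Fin m) Lazard) : MvPowerSeries (Fin m) Lazard :=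
  (fglAdd a)^[n] 0

/-- `F^{n₁,…,n_m}(u₁,…,u_m) = n₁ ·_F u₁ +_F … +_F n_m ·_F u_m`. -/
def fglSum {m : ℕ} (n : Fin m → ℕ) : MvPowerSeries (Fin m) Lazard :=
  (List.finRange m).foldr (fun i r => fglAdd (fglMul (n i) (MvPowerSeries.X i)) r) 0

/-- The power series `F_J^{n₁,…,n_m}`, involving only the `u_i` with `i ∈ J`, in the decomposition
`F^{n₁,…,n_m} = ∑_J u^J F_J^{n₁,…,n_m}`. -/
def fglFace {m : ℕ} (n : Fin m → ℕ) (J : Finset (Fin m)) : MvPowerSeries (Fin m) Lazard :=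
  fun e => if e.support ⊆ J then
    MvPowerSeries.coeff (e + ∑ i ∈ J, Finsupp.single i 1) (fglSum n) else 0

end Lazard

section LineBundles

variable {X Y Z : Scheme.{u}}

/-- A line bundle on `X`, given by transition functions: a trivializing neighbourhood `U x` of each
point `x` and units `g x y` on the overlaps satisfying the cocycle condition. A section of the
bundle is a family of functions `s x` on `U x` with `s x = g x y * s y`. -/
structure LineBundle (X : Scheme.{u}) where
  U : X → X.Opens
  mem : ∀ x, x ∈ U x
  g : ∀ x y, Γ(X, U x ⊓ U y)ˣ
  cocycle : ∀ (x y z p : X) (hxy : p ∈ U x ⊓ U y) (hyz : p ∈ U y ⊓ U z) (hxz : p ∈ U x ⊓ U z),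
    X.presheaf.germ (U x ⊓ U y) p hxy (g x y : Γ(X, U x ⊓ U y)) *
      X.presheaf.germ (U y ⊓ U z) p hyz (g y z : Γ(X, U y ⊓ U z)) =
      X.presheaf.germ (U x ⊓ U z) p hxz (g x z : Γ(X, U x ⊓ U z))

theorem germ_app (f : Y ⟶ X) (V : X.Opens) (p : Y) (hp : f p ∈ V) (a : Γ(X, V)) :
    Y.presheaf.germ (f ⁻¹ᵁ V) p hp (f.app V a) = f.stalkMap p (X.presheaf.germ V (f p) hp a) :=
  (Scheme.Hom.germ_stalkMap_apply f V p hp a).symm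

namespace LineBundle

/-- The pull-back of a line bundle. -/
def pullback (L : LineBundle X) (f : Y ⟶ X) : LineBundle Y where
  U y := f ⁻¹ᵁ L.U (f y)
  mem y := L.mem (f y)
  g y z := Units.map (f.app (L.U (f y) ⊓ L.U (f z))).hom.toMonoidHom (L.g (f y) (f z))
  cocycle x y z p hxy hyz hxz := by
    exact (congrArg₂ (· * ·) (germ_app f _ p _ _) (germ_app f _ p _ _)).trans
      (((map_mul (f.stalkMap p).hom _ _).symm.trans
        (congrArg (f.stalkMap p) (L.cocycle (f x) (f y) (f z) (f p) hxy hyz hxz))).trans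
          (germ_app f _ p _ _).symm)

/-- The restriction of a unit to a smaller open subset. -/
def resUnit {V W : X.Opens} (h : W ≤ V) (a : Γ(X, V)ˣ) : Γ(X, W)ˣ :=
  Units.map (X.presheaf.map (homOfLE h).op).hom.toMonoidHom a

theorem germ_resUnit {V W : X.Opens} (h : W ≤ V) (a : Γ(X, V)ˣ) (p : X) (hp : p ∈ W) :
    X.presheaf.germ W p hp (resUnit h a : Γ(X, W)) =
      X.presheaf.germ V p (h hp) (a : Γ(X, V)) :=
  TopCat.Presheaf.germ_res_apply X.presheaf (homOfLE h) p hp (a : Γ(X, V))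

theorem germ_mul_resUnit {V V' W : X.Opens} (h : W ≤ V) (h' : W ≤ V') (a : Γ(X, V)ˣ)
    (a' : Γ(X, V')ˣ) (p : X) (hp : p ∈ W) :
    X.presheaf.germ W p hp ((resUnit h a * resUnit h' a' : Γ(X, W)ˣ) : Γ(X, W)) =
      X.presheaf.germ V p (h hp) (a : Γ(X, V)) * X.presheaf.germ V' p (h' hp) (a' : Γ(X, V')) :=
  (map_mul (X.presheaf.germ W p hp).hom _ _).trans
    (congrArg₂ (· * ·) (germ_resUnit h a p hp) (germ_resUnit h' a' p hp))

/-- The tensor product of line bundles. -/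
def tensor (L M : LineBundle X) : LineBundle X where
  U x := L.U x ⊓ M.U x
  mem x := ⟨L.mem x, M.mem x⟩
  g x y := resUnit (inf_le_inf inf_le_left inf_le_left) (L.g x y) *
    resUnit (inf_le_inf inf_le_right inf_le_right) (M.g x y)
  cocycle x y z p hxy hyz hxz := by
    refine (congrArg₂ (· * ·) (germ_mul_resUnit _ _ _ _ p hxy)
      (germ_mul_resUnit _ _ _ _ p hyz)).trans
        (Eq.trans ?_ (germ_mul_resUnit _ _ _ _ p hxz).symm)
    rw [← L.cocycle x y z p ⟨hxy.1.1, hxy.2.1⟩ ⟨hyz.1.1, hyz.2.1⟩ ⟨hxz.1.1, hxz.2.1⟩,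
      ← M.cocycle x y z p ⟨hxy.1.2, hxy.2.2⟩ ⟨hyz.1.2, hyz.2.2⟩ ⟨hxz.1.2, hxz.2.2⟩]
    ring

/-- Two line bundles are isomorphic: local units identify their transition functions. -/
def Iso (L M : LineBundle X) : Prop :=
  ∃ h : ∀ x, Γ(X, L.U x ⊓ M.U x)ˣ, ∀ (x y p : X) (hx : p ∈ L.U x ⊓ M.U x)
    (hy : p ∈ L.U y ⊓ M.U y) (hL : p ∈ L.U x ⊓ L.U y) (hM : p ∈ M.U x ⊓ M.U y),
    X.presheaf.germ (L.U x ⊓ M.U x) p hx (h x : Γ(X, L.U x ⊓ M.U x)) *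
      X.presheaf.germ (M.U x ⊓ M.U y) p hM (M.g x y : Γ(X, M.U x ⊓ M.U y)) =
    X.presheaf.germ (L.U x ⊓ L.U y) p hL (L.g x y : Γ(X, L.U x ⊓ L.U y)) *
      X.presheaf.germ (L.U y ⊓ M.U y) p hy (h y : Γ(X, L.U y ⊓ M.U y))

end LineBundle

/-- A pseudo-divisor on `X`: a line bundle together with a global section. Its support is the zero
locus of the section. -/
structure PseudoDivisor (X : Scheme.{u}) where
  bundle : LineBundle X
  s : ∀ x, Γ(X, bundle.U x)
  compat : ∀ (x y p : X) (hx : p ∈ bundle.U x) (hy : p ∈ bundle.U y)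
    (hxy : p ∈ bundle.U x ⊓ bundle.U y),
    X.presheaf.germ (bundle.U x) p hx (s x) =
      X.presheaf.germ (bundle.U x ⊓ bundle.U y) p hxy
        (bundle.g x y : Γ(X, bundle.U x ⊓ bundle.U y)) *
      X.presheaf.germ (bundle.U y) p hy (s y)

namespace PseudoDivisor

/-- The pull-back `f^*(Z, L, s) = (f⁻¹ Z, f^* L, f^* s)`. -/
def pullback (D : PseudoDivisor X) (f : Y ⟶ X) : PseudoDivisor Y where
  bundle := D.bundle.pullback f
  s y := f.app (D.bundle.U (f y)) (D.s (f y))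
  compat x y p hx hy hxy := by
    exact (germ_app f _ p _ _).trans
      (((congrArg (f.stalkMap p) (D.compat (f x) (f y) (f p) hx hy hxy)).trans
        (map_mul (f.stalkMap p).hom _ _)).trans
          (congrArg₂ (· * ·) (germ_app f _ p _ _) (germ_app f _ p _ _)).symm)

theorem germ_mul_res {V V' W : X.Opens} (h : W ≤ V) (h' : W ≤ V') (a : Γ(X, V))
    (a' : Γ(X, V')) (p : X) (hp : p ∈ W) :
    X.presheaf.germ W p hp (X.presheaf.map (homOfLE h).op a * X.presheaf.map (homOfLE h').op a') =
      X.presheaf.germ V p (h hp) a * X.presheaf.germ V' p (h' hp) a' :=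
  (map_mul (X.presheaf.germ W p hp).hom _ _).trans
    (congrArg₂ (· * ·) (TopCat.Presheaf.germ_res_apply X.presheaf (homOfLE h) p hp a)
      (TopCat.Presheaf.germ_res_apply X.presheaf (homOfLE h') p hp a'))

/-- The sum of pseudo-divisors `(L, s) + (L', s') = (L ⊗ L', s ⊗ s')`. -/
def add (D D' : PseudoDivisor X) : PseudoDivisor X where
  bundle := D.bundle.tensor D'.bundle
  s x := X.presheaf.map (homOfLE (inf_le_left : D.bundle.U x ⊓ D'.bundle.U x ≤ _)).op (D.s x) *
    X.presheaf.map (homOfLE (inf_le_right : D.bundle.U x ⊓ D'.bundle.U x ≤ _)).op (D'.s x)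
  compat x y p hx hy hxy := by
    have h1 := D.compat x y p hx.1 hy.1 ⟨hx.1, hy.1⟩
    have h2 := D'.compat x y p hx.2 hy.2 ⟨hx.2, hy.2⟩
    have h3 := LineBundle.germ_mul_resUnit (inf_le_inf inf_le_left inf_le_left)
      (inf_le_inf inf_le_right inf_le_right) (D.bundle.g x y) (D'.bundle.g x y) p hxy
    refine (germ_mul_res _ _ _ _ p hx).trans (Eq.trans ?_
      (congrArg₂ (· * ·) h3 (germ_mul_res _ _ _ _ p hy)).symm)
    rw [h1, h2]
    ring

instance : Add (PseudoDivisor X) := ⟨add⟩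

/-- The germ at `x` of the section in the given trivialization around `x`: a local equation. -/
def eqn (D : PseudoDivisor X) (x : X) : X.presheaf.stalk x :=
  X.presheaf.germ (D.bundle.U x) x (D.bundle.mem x) (D.s x)

/-- The stalk at `x` of the ideal sheaf of the subscheme `div D`. -/
def idealAt (D : PseudoDivisor X) (x : X) : Ideal (X.presheaf.stalk x) := Ideal.span {D.eqn x}

/-- The support of a pseudo-divisor: the zero locus of its section. -/
def support (D : PseudoDivisor X) : Closeds X where
  carrier := {x | D.eqn x ∈ IsLocalRing.maximalIdeal (X.presheaf.stalk x)}
  isClosed' := by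
    rw [← isOpen_compl_iff, isOpen_iff_mem_nhds]
    intro x hx
    replace hx : IsUnit (D.eqn x) := by simpa using hx
    filter_upwards [(X.basicOpen (D.s x)).isOpen.mem_nhds
      ((X.mem_basicOpen (D.s x) x (D.bundle.mem x)).2 hx)] with y hy
    have hy' : y ∈ D.bundle.U x := X.basicOpen_le _ hy
    have h := (X.mem_basicOpen (D.s x) y hy').1 hy
    rw [D.compat x y y hy' (D.bundle.mem y) ⟨hy', D.bundle.mem y⟩] at h
    simpa [eqn] using isUnit_of_mul_isUnit_right h

theorem eqn_pullback (D : PseudoDivisor X) (f : Y ⟶ X) (y : Y) :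
    (D.pullback f).eqn y = f.stalkMap y (D.eqn (f y)) :=
  germ_app f _ y _ _

theorem mem_support_pullback (D : PseudoDivisor X) (f : Y ⟶ X) (y : Y) :
    y ∈ (D.pullback f).support ↔ f y ∈ D.support := by
  change (D.pullback f).eqn y ∈ IsLocalRing.maximalIdeal _ ↔
    D.eqn (f y) ∈ IsLocalRing.maximalIdeal _
  rw [eqn_pullback]
  simp

theorem idealAt_pullback_comp (D : PseudoDivisor X) (f : Y ⟶ X) (g : Z ⟶ Y) (z : Z) :
    ((D.pullback f).pullback g).idealAt z = (D.pullback (g ≫ f)).idealAt z := by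
  rw [idealAt, idealAt, eqn_pullback, eqn_pullback, eqn_pullback, Scheme.Hom.stalkMap_comp]
  rfl

/-- Two pseudo-divisors define the same closed subscheme. For effective Cartier divisors this is
equality of divisors. -/
def SameDiv (D D' : PseudoDivisor X) : Prop := ∀ x, D.idealAt x = D'.idealAt x

end PseudoDivisor
end LineBundles
section Admissible

variable {k : Type u} [Field k] {P X Y : Scheme.{u}}

/-- A presentation of `E` as an effective simple normal crossing divisor `∑ nᵢ Eᵢ` on `Y` (with
structure morphism `q` to `Spec k`): the `Eᵢ` are irreducible, at each point the local equations of
the `Eᵢ` passing through it are part of a regular system of parameters, and the faces are smooth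
over `k`. The case `E = 0` is included. -/
structure SNCDecomposition (q : Y ⟶ Spec (CommRingCat.of k)) (E : PseudoDivisor Y) where
  m : ℕ
  comp : Fin m → PseudoDivisor Y
  mult : Fin m → ℕ
  mult_pos : ∀ i, 0 < mult i
  irreducible : ∀ i, IsIrreducible ((comp i).support : Set Y)
  ideal_eq : ∀ y, E.idealAt y = ∏ i, (comp i).idealAt y ^ mult i
  transversal : ∀ y, LinearIndependent (IsLocalRing.ResidueField (Y.presheaf.stalk y))
    (fun i : {i // y ∈ (comp i).support} =>
      ((IsLocalRing.maximalIdeal (Y.presheaf.stalk y)).toCotangent ⟨(comp i).eqn y, i.2⟩ :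
        IsLocalRing.CotangentSpace (Y.presheaf.stalk y)))
  smooth_face : ∀ J : Finset (Fin m), J.Nonempty →
    ∀ F ∈ components (⨅ i ∈ J, (comp i).support), Smooth (redι F ≫ q)

/-- The face `E^J = ⋂_{i ∈ J} Eᵢ`. -/
def SNCDecomposition.face {q : Y ⟶ Spec (CommRingCat.of k)} {E : PseudoDivisor Y}
    (σ : SNCDecomposition q E) (J : Finset (Fin σ.m)) : Closeds Y :=
  ⨅ i ∈ J, (σ.comp i).support

theorem SNCDecomposition.face_le {q : Y ⟶ Spec (CommRingCat.of k)} {E : PseudoDivisor Y}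
    (σ : SNCDecomposition q E) {J : Finset (Fin σ.m)} (hJ : J.Nonempty) :
    σ.face J ≤ E.support := by
  obtain ⟨i, hi⟩ := hJ
  refine (iInf₂_le i hi).trans fun y hy => ?_
  have h1 : (σ.comp i).idealAt y ≤ IsLocalRing.maximalIdeal _ :=
    (Ideal.span_singleton_le_iff_mem _).2 hy
  have h2 : E.idealAt y ≤ IsLocalRing.maximalIdeal _ := by
    rw [σ.ideal_eq y]
    exact (Ideal.prod_le_inf.trans (Finset.inf_le (Finset.mem_univ i))).trans
      ((Ideal.pow_le_self (σ.mult_pos i).ne').trans h1)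
  exact h2 (Ideal.mem_span_singleton_self _)

/-- `E` is an effective simple normal crossing divisor on `Y`. -/
def IsSNC (q : Y ⟶ Spec (CommRingCat.of k)) (E : PseudoDivisor Y) : Prop :=
  Nonempty (SNCDecomposition q E)

/-- The stalk at `y` of the ideal sheaf of the scheme-theoretic intersection `⋂_{d ∈ D} div f^* d`;
for empty `D` this intersection is `Y`. -/
def interIdealAt (D : List (PseudoDivisor P)) (f : Y ⟶ P) (y : Y) : Ideal (Y.presheaf.stalk y) :=
  ⨆ d ∈ D, (d.pullback f).idealAt y

/-- Admissibility of `f : Y ⟶ P` with respect to the sequence `D` for irreducible `Y`: for each `s`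
the scheme-theoretic intersection of the first `s` divisors `div f^* d` is `Y`, or a simple normal
crossing divisor (possibly zero, that is, the intersection is empty). -/
def IsAdmissibleIrr (q : Y ⟶ Spec (CommRingCat.of k)) (f : Y ⟶ P) (D : List (PseudoDivisor P)) :
    Prop :=
  ∀ s : ℕ, (∀ y, interIdealAt (D.take s) f y = ⊥) ∨
    ∃ C : PseudoDivisor Y, IsSNC q C ∧ ∀ y, interIdealAt (D.take s) f y = C.idealAt y

/-- Admissibility of `f : Y ⟶ P` with respect to the sequence `D`: the restriction of `f` to each
irreducible component of `Y` is admissible. -/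
def IsAdmissible (q : Y ⟶ Spec (CommRingCat.of k)) (f : Y ⟶ P) (D : List (PseudoDivisor P)) :
    Prop :=
  ∀ Z ∈ components (⊤ : Closeds Y), IsAdmissibleIrr (redι Z ≫ q) (redι Z ≫ f) D

/-- The divisor `E` on `Y ∈ Sm_k` is admissible with respect to the sequence `D` of
pseudo-divisors on `P`, where `f : Y ⟶ P`: it is a simple normal crossing divisor and the
irreducible components of its faces are admissible over `P`. -/
structure IsAdmissibleDivisor (q : Y ⟶ Spec (CommRingCat.of k)) (f : Y ⟶ P) (E : PseudoDivisor Y)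
    (D : List (PseudoDivisor P)) : Prop where
  sm : IsSm q
  snc : IsSNC q E
  admissible : ∀ (σ : SNCDecomposition q E) (J : Finset (Fin σ.m)), J.Nonempty →
    ∀ F ∈ components (σ.face J), IsAdmissibleIrr (redι F ≫ q) (redι F ≫ f) D

/-- Good position of the divisor `E` on the irreducible `Y` with respect to `D`, for `f : Y ⟶ P`:
`E` is a simple normal crossing divisor, and so is `E + div f^* d` if `d` is the leading
pseudo-divisor, that is, the first member of `D` whose pull-back is not supported on all of `Y`. -/
def GoodPosition (q : Y ⟶ Spec (CommRingCat.of k)) (f : Y ⟶ P) (E : PseudoDivisor Y)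
    (D : List (PseudoDivisor P)) : Prop :=
  IsSNC q E ∧ ∀ (D₁ : List (PseudoDivisor P)) (d : PseudoDivisor P) (D₂ : List (PseudoDivisor P)),
    D = D₁ ++ d :: D₂ → (∀ d' ∈ D₁, (d'.pullback f).support = ⊤) → (d.pullback f).support ≠ ⊤ →
      IsSNC q (E + d.pullback f)

theorem PseudoDivisor.idealAt_eq_bot [IsReduced Y] (E : PseudoDivisor Y) (h : E.support = ⊤)
    (y : Y) : E.idealAt y = ⊥ := by
  have h1 : Y.basicOpen (E.s y) = ⊥ := by
    rw [eq_bot_iff]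
    intro z hz
    have hz' : z ∈ E.bundle.U y := Y.basicOpen_le _ hz
    have hu := (Y.mem_basicOpen (E.s y) z hz').1 hz
    rw [E.compat y z z hz' (E.bundle.mem z) ⟨hz', E.bundle.mem z⟩] at hu
    have hm : z ∈ E.support := h ▸ trivial
    exact absurd (isUnit_of_mul_isUnit_right hu) ((IsLocalRing.mem_maximalIdeal _).1 hm)
  have h2 : E.s y = 0 := (basicOpen_eq_bot_iff _).1 h1
  rw [PseudoDivisor.idealAt, Ideal.span_singleton_eq_bot, PseudoDivisor.eqn, h2, map_zero]

theorem IsAdmissibleIrr.tail [IsReduced Y] {q : Y ⟶ Spec (CommRingCat.of k)} {f : Y ⟶ P}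
    {d : PseudoDivisor P} {D : List (PseudoDivisor P)} (h : IsAdmissibleIrr q f (d :: D))
    (hd : (d.pullback f).support = ⊤) : IsAdmissibleIrr q f D := by
  intro s
  have e : ∀ y, interIdealAt ((d :: D).take (s + 1)) f y = interIdealAt (D.take s) f y := by
    intro y
    simp [interIdealAt, iSup_or, iSup_sup_eq, (d.pullback f).idealAt_eq_bot hd y]
  simpa only [e] using h (s + 1)

end Admissible

section Cobordism

variable {k : Type u} [Field k] {P X X' X'' Y : Scheme.{u}}

theorem IsSm.of_isClosedImmersion {q : Y ⟶ Spec (CommRingCat.of k)} (hY : IsSm q) (i : X ⟶ Y)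
    [IsClosedImmersion i] (hs : Smooth (i ≫ q)) : IsSm (i ≫ q) := by
  obtain ⟨n, j, hj, rfl⟩ := hY.quasiProjective
  exact ⟨hs, n, i ≫ j, inferInstance, Category.assoc ..⟩

/-- A cobordism cycle `(f : Y ⟶ X, L₁, …, L_m)` over the `P`-scheme `p : X ⟶ P`, with `f`
admissible with respect to the pull-backs to `X` of the sequence `D` of pseudo-divisors on `P`.
Here `b : P ⟶ Spec k` is the structure morphism. -/
structure Cycle (b : P ⟶ Spec (CommRingCat.of k)) (p : X ⟶ P) (D : List (PseudoDivisor P)) where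
  Y : Scheme.{u}
  f : Y ⟶ X
  integral : IsIntegral Y
  sm : IsSm (f ≫ p ≫ b)
  projective : IsProjective f (p ≫ b)
  admissible : IsAdmissibleIrr (f ≫ p ≫ b) (f ≫ p) D
  bundles : List (LineBundle Y)

attribute [instance] Cycle.integral

variable {b : P ⟶ Spec (CommRingCat.of k)} {p : X ⟶ P} {p' : X' ⟶ P} {D : List (PseudoDivisor P)}

namespace Cycle

/-- The same morphism with other line bundles. -/
def withBundles (c : Cycle b p D) (Ls : List (LineBundle c.Y)) : Cycle b p D :=
  { c with bundles := Ls }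

/-- Isomorphism of cobordism cycles. -/
def Iso (c d : Cycle b p D) : Prop :=
  ∃ φ : c.Y ≅ d.Y, φ.hom ≫ d.f = c.f ∧
    ∃ Ls : List (LineBundle c.Y), Ls.Perm c.bundles ∧
      List.Forall₂ (fun L M => LineBundle.Iso L (M.pullback φ.hom)) Ls d.bundles

/-- Push-forward of cobordism cycles along a proper morphism over `P`. -/
def push (g : X' ⟶ X) [IsProper g] (hg : g ≫ p = p') (c : Cycle b p' D) : Cycle b p D where
  Y := c.Y
  f := c.f ≫ g
  integral := c.integral
  sm := by
    subst hg
    simpa using c.sm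
  projective := by
    subst hg
    have := c.projective.isProper
    exact IsProjective.of_isProper _ (by simpa using c.sm)
  admissible := by
    subst hg
    simpa using c.admissible
  bundles := c.bundles

/-- The integral closed subset `F` of the source of `c` is smooth over `k` and admissible. -/
structure CanRestrict (c : Cycle b p D) (F : Closeds c.Y) : Prop where
  irreducible : IsIrreducible (F : Set c.Y)
  smooth : Smooth (redι F ≫ c.f ≫ p ≫ b)
  admissible : IsAdmissibleIrr (redι F ≫ c.f ≫ p ≫ b) (redι F ≫ c.f ≫ p) D

/-- The cobordism cycle `(F ⟶ Y ⟶ X, Ls|_F)`. -/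
def restrict (c : Cycle b p D) (F : Closeds c.Y) (hF : c.CanRestrict F)
    (Ls : List (LineBundle c.Y)) : Cycle b p D where
  Y := red F
  f := redι F ≫ c.f
  integral := isIntegral_red F hF.irreducible
  sm := by
    rw [Category.assoc]
    exact c.sm.of_isClosedImmersion _ hF.smooth
  projective := by
    have := c.projective.isProper
    refine IsProjective.of_isProper _ ?_
    rw [Category.assoc]
    exact c.sm.of_isClosedImmersion _ hF.smooth
  admissible := by
    rw [Category.assoc, Category.assoc]
    exact hF.admissible
  bundles := Ls.map fun L => L.pullback (redι F)

end Cycle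

/-- The free `𝕃`-module on the cobordism cycles. -/
abbrev Free (b : P ⟶ Spec (CommRingCat.of k)) (p : X ⟶ P) (D : List (PseudoDivisor P)) :
    Type (u + 1) :=
  Cycle b p D →₀ Lazard

/-- `φ(c̃₁(L₁), …, c̃₁(L_m))` applied to the cobordism cycle `c = (f : Y ⟶ X, …)`, for line bundles
`Lᵢ` on `Y` and a power series `φ`. Only the monomials whose exponents are all at most `dim Y` are
written; the others give cycles with more than `dim Y` line bundles, which are zero by the
dimension relations. -/
def Cycle.chernSeries (c : Cycle b p D) {m : ℕ} (φ : MvPowerSeries (Fin m) Lazard)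
    (Ls : Fin m → LineBundle c.Y) : Free b p D :=
  ∑ e : Fin m → Fin (((topologicalKrullDim c.Y).unbotD 0).toNat + 1),
    Finsupp.single
      (c.withBundles (c.bundles ++
        (List.finRange m).flatMap fun i => List.replicate (e i) (Ls i)))
      (MvPowerSeries.coeff (Finsupp.equivFunOnFinite.symm fun i => (e i : ℕ)) φ)

/-- The relations defining refined algebraic cobordism. -/
inductive Rel (b : P ⟶ Spec (CommRingCat.of k)) (p : X ⟶ P) (D : List (PseudoDivisor P)) :
    Free b p D → Prop
  /-- Isomorphic cobordism cycles are identified. -/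
  | iso (c d : Cycle b p D) (h : c.Iso d) : Rel b p D (Finsupp.single c 1 - Finsupp.single d 1)
  /-- The dimension relations: `(f, π^* L₁, …, π^* L_m, M₁, …, M_s) = 0` for `π : Y ⟶ Z` smooth
  and quasi-projective with `Z ∈ Sm_k` and `m > dim Z`. -/
  | dim (c : Cycle b p D) (Z : Scheme.{u}) (z : Z ⟶ Spec (CommRingCat.of k)) (hZ : IsSm z)
      (π : c.Y ⟶ Z) (hπz : π ≫ z = c.f ≫ p ≫ b) (hπ : Smooth π) (hqp : IsQuasiProjective π z)
      (Ls : List (LineBundle Z)) (Ms : List (LineBundle c.Y))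
      (hb : c.bundles = Ls.map (fun L => L.pullback π) ++ Ms)
      (hdim : topologicalKrullDim Z < (Ls.length : WithBot ℕ∞)) :
      Rel b p D (Finsupp.single c 1)
  /-- The section relations: `(f, L₁, …, L_m) = (f ∘ i : Z ⟶ X, i^* L₁, …, i^* L_{m-1})` for the
  zero scheme `Z` of a section of `L_m` transverse to the zero section, if `Z` is in good
  position. -/
  | sect (c : Cycle b p D) (Ls : List (LineBundle c.Y)) (Z : PseudoDivisor c.Y)
      (hb : c.bundles = Ls ++ [Z.bundle])
      (htr : ∀ y ∈ Z.support, Z.eqn y ∉ IsLocalRing.maximalIdeal (c.Y.presheaf.stalk y) ^ 2)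
      (hgp : GoodPosition (c.f ≫ p ≫ b) (c.f ≫ p) Z D)
      (S : Finset (Closeds c.Y)) (hS : ∀ F, F ∈ S ↔ F ∈ components Z.support)
      (hF : ∀ F : S, c.CanRestrict F.1) :
      Rel b p D (Finsupp.single c 1 - ∑ F : S, Finsupp.single (c.restrict F.1 (hF F) Ls) 1)
  /-- The formal group law: `F_𝕃(c̃₁(L), c̃₁(M)) = c̃₁(L ⊗ M)`. -/
  | fgl (c : Cycle b p D) (L M : LineBundle c.Y) :
      Rel b p D (c.chernSeries universalFGL.toPowerSeries ![L, M] -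
        Finsupp.single (c.withBundles (c.bundles ++ [L.tensor M])) 1)

/-- The submodule generated by the relations. -/
def relations (b : P ⟶ Spec (CommRingCat.of k)) (p : X ⟶ P) (D : List (PseudoDivisor P)) :
    Submodule Lazard (Free b p D) :=
  Submodule.span Lazard {x | Rel b p D x}

/-- Refined algebraic cobordism `Ω_*(X)_{D_*}` of `p : X ⟶ P`. -/
abbrev Omega (b : P ⟶ Spec (CommRingCat.of k)) (p : X ⟶ P) (D : List (PseudoDivisor P)) :
    Type (u + 1) :=
  Free b p D ⧸ relations b p D

/-- Push-forward along a proper morphism over `P`, on free modules. -/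
def pushFree (g : X' ⟶ X) [IsProper g] (hg : g ≫ p = p') : Free b p' D →ₗ[Lazard] Free b p D :=
  Finsupp.lmapDomain Lazard Lazard (Cycle.push g hg)

theorem pushFree_single (g : X' ⟶ X) [IsProper g] (hg : g ≫ p = p') (c : Cycle b p' D)
    (a : Lazard) : pushFree g hg (Finsupp.single c a) = Finsupp.single (c.push g hg) a :=
  Finsupp.mapDomain_single

theorem pushFree_chernSeries (g : X' ⟶ X) [IsProper g] (hg : g ≫ p = p') (c : Cycle b p' D)
    {m : ℕ} (φ : MvPowerSeries (Fin m) Lazard) (Ls : Fin m → LineBundle c.Y) :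
    pushFree g hg (c.chernSeries φ Ls) = (c.push g hg).chernSeries φ Ls := by
  rw [Cycle.chernSeries, map_sum]
  exact Finset.sum_congr rfl fun e _ => pushFree_single ..

theorem Rel.push (g : X' ⟶ X) [IsProper g] (hg : g ≫ p = p') {x : Free b p' D}
    (h : Rel b p' D x) : Rel b p D (pushFree g hg x) := by
  subst hg
  cases h with
  | iso c d h =>
    obtain ⟨φ, hφ, h⟩ := h
    rw [map_sub, pushFree_single, pushFree_single]
    exact .iso _ _ ⟨φ, by simp [Cycle.push, ← hφ], h⟩
  | dim c Z z hZ π hπz hπ hqp Ls Ms hb hdim =>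
    rw [pushFree_single]
    exact .dim _ Z z hZ π (by simpa [Cycle.push] using hπz) hπ hqp Ls Ms hb hdim
  | sect c Ls Z hb htr hgp S hS hF =>
    have hF' : ∀ F : S, (c.push g rfl).CanRestrict F.1 := fun F =>
      ⟨(hF F).irreducible, by simpa [Cycle.push] using (hF F).smooth,
        by simpa [Cycle.push] using (hF F).admissible⟩
    rw [map_sub, pushFree_single, map_sum]
    have e : ∀ F : S, pushFree g rfl (Finsupp.single (c.restrict F.1 (hF F) Ls) (1 : Lazard)) =
        Finsupp.single ((c.push g rfl).restrict F.1 (hF' F) Ls) 1 := by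
      intro F
      rw [pushFree_single]
      congr 1
    rw [Finset.sum_congr rfl fun F _ => e F]
    exact .sect (c.push g rfl) Ls Z hb htr (by simpa [Cycle.push] using hgp) S hS hF'
  | fgl c L M =>
    rw [map_sub, pushFree_single, pushFree_chernSeries]
    exact .fgl (c.push g rfl) L M

/-- Push-forward `g_* : Ω_*(X')_{D_*} → Ω_*(X)_{D_*}` along a proper morphism over `P`. -/
def Omega.push (g : X' ⟶ X) [IsProper g] (hg : g ≫ p = p') :
    Omega b p' D →ₗ[Lazard] Omega b p D :=
  Submodule.mapQ _ _ (pushFree g hg) (Submodule.span_le.2 fun _ hx =>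
    Submodule.subset_span (Rel.push g hg hx))

/-- The first Chern class operator `c̃₁(L)` of a line bundle on `X`, on free modules. -/
def chernFree (L : LineBundle X) : Free b p D →ₗ[Lazard] Free b p D :=
  Finsupp.lmapDomain Lazard Lazard fun c => c.withBundles (c.bundles ++ [L.pullback c.f])

section DivisorClass

variable {q : Y ⟶ Spec (CommRingCat.of k)} {r : Y ⟶ P} {E : PseudoDivisor Y}

theorem isProper_redLift (Z : Closeds Y) (g : X ⟶ Y) [IsReduced X] [IsProper g]
    (h : Set.range g ⊆ Z) : IsProper (redLift g Z h) := by
  have : IsProper (redLift g Z h ≫ redι Z) := by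
    rw [redLift_redι]
    infer_instance
  exact MorphismProperty.of_postcomp (W := @IsProper) (W' := @IsSeparated) _ (redι Z)
    inferInstance this

/-- The cobordism cycle `F ⟶ |E|` of an irreducible component `F` of a face of `E`. -/
def faceCycle (hq : r ≫ b = q) {p : red E.support ⟶ P} (hp : redι E.support ≫ r = p)
    (h : IsAdmissibleDivisor q r E D) (σ : SNCDecomposition q E) (J : Finset (Fin σ.m))
    (hJ : J.Nonempty) (F : Closeds Y) (hF : F ∈ components (σ.face J)) : Cycle b p D :=
  have := isIntegral_red F hF.1.1
  have hle : Set.range (redι F) ⊆ E.support := by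
    rw [range_redι]
    exact hF.1.2.trans (σ.face_le hJ)
  have h1 : redLift (redι F) E.support hle ≫ p = redι F ≫ r := by
    rw [← hp, ← Category.assoc, redLift_redι]
  have h2 : redLift (redι F) E.support hle ≫ p ≫ b = redι F ≫ q := by
    rw [← Category.assoc, h1, Category.assoc, hq]
  have hsm : IsSm (redLift (redι F) E.support hle ≫ p ≫ b) := by
    rw [h2]
    exact h.sm.of_isClosedImmersion _ (σ.smooth_face J hJ F hF)
  { Y := red F
    f := redLift (redι F) E.support hle
    integral := this
    sm := hsm
    projective :=
      have := isProper_redLift E.support (redι F) hle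
      IsProjective.of_isProper _ hsm
    admissible := by
      rw [h2, h1]
      exact h.admissible σ J hJ F hF
    bundles := [] }

open Classical in
/-- The divisor class `[E ⟶ |E|]_{D_*} = ∑_J ι^J_* [E^J; F_J(O(E₁), …, O(E_m))]_{D_*}` as an element
of the free module on cobordism cycles over `p : |E| ⟶ P`. -/
def divisorCycle (hq : r ≫ b = q) {p : red E.support ⟶ P} (hp : redι E.support ≫ r = p)
    (h : IsAdmissibleDivisor q r E D) : Free b p D :=
  let σ := Classical.choice h.snc
  have := h.sm.noetherianSpace
  ∑ J : {J : Finset (Fin σ.m) // J.Nonempty},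
    ∑ F : (finite_components (σ.face J.1)).toFinset,
      (faceCycle hq hp h σ J.1 J.2 F.1 ((Set.Finite.mem_toFinset _).1 F.2)).chernSeries
        (fglFace σ.mult J.1) fun i => (σ.comp i).bundle.pullback (redι F.1)

/-- The divisor class `[E ⟶ |E|]_{D_*}` in `Ω_*(|E|)_{D_*}`. -/
def divisorClass (hq : r ≫ b = q) {p : red E.support ⟶ P} (hp : redι E.support ≫ r = p)
    (h : IsAdmissibleDivisor q r E D) : Omega b p D :=
  (relations b p D).mkQ (divisorCycle hq hp h)

end DivisorClass

section Intersection

variable {d : PseudoDivisor P}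

/-- The cobordism cycle over `|d| ∩ X` obtained from a cycle `c = (f : Y ⟶ X, L₁, …, L_m)` with
`f(Y) ⊆ |d|`: it is `(Y ⟶ |d| ∩ X, L₁, …, L_m, f^* O(d))`. -/
def Cycle.intersectInside (c : Cycle b p (d :: D))
    (h : Set.range c.f ⊆ (d.pullback p).support) :
    Cycle b (redι (d.pullback p).support ≫ p) D :=
  have h1 : redLift c.f (d.pullback p).support h ≫ redι (d.pullback p).support ≫ p =
      c.f ≫ p := by
    rw [← Category.assoc, redLift_redι]
  have h2 : redLift c.f (d.pullback p).support h ≫ (redι (d.pullback p).support ≫ p) ≫ b =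
      c.f ≫ p ≫ b := by
    rw [← Category.assoc, h1, Category.assoc]
  have hsm : IsSm (redLift c.f (d.pullback p).support h ≫
      (redι (d.pullback p).support ≫ p) ≫ b) := h2.symm ▸ c.sm
  { Y := c.Y
    f := redLift c.f (d.pullback p).support h
    integral := c.integral
    sm := hsm
    projective :=
      have := c.projective.isProper
      have := isProper_redLift (d.pullback p).support c.f h
      IsProjective.of_isProper _ hsm
    admissible := by
      rw [h2, h1]
      refine c.admissible.tail ?_
      rw [eq_top_iff]
      intro y _
      rw [PseudoDivisor.mem_support_pullback, Scheme.Hom.comp_apply]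
      exact (PseudoDivisor.mem_support_pullback d p (c.f y)).1 (h ⟨y, rfl⟩)
    bundles := c.bundles ++ [(d.bundle.pullback p).pullback c.f] }

theorem range_comp_subset_support (d : PseudoDivisor X) (f : Y ⟶ X) :
    Set.range (redι (d.pullback f).support ≫ f) ⊆ d.support := by
  rintro _ ⟨y, rfl⟩
  have hy : redι (d.pullback f).support y ∈ (d.pullback f).support := by
    have := Set.mem_range_self (f := redι (d.pullback f).support) y
    rwa [range_redι] at this
  rw [PseudoDivisor.mem_support_pullback] at hy
  exact hy

/-- The restriction `|f^* d| ⟶ |d|` of `f : Y ⟶ X`, for a pseudo-divisor `d` on `X`. -/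
def restrictSupport (d : PseudoDivisor X) (f : Y ⟶ X) :
    red (d.pullback f).support ⟶ red d.support :=
  redLift (redι (d.pullback f).support ≫ f) d.support (range_comp_subset_support d f)

theorem restrictSupport_redι (d : PseudoDivisor X) (f : Y ⟶ X) :
    restrictSupport d f ≫ redι d.support = redι (d.pullback f).support ≫ f :=
  redLift_redι _ _ _

theorem restrictSupport_comp (d : PseudoDivisor X) (f : Y ⟶ X) (p : X ⟶ P) :
    restrictSupport d f ≫ redι d.support ≫ p = redι (d.pullback f).support ≫ f ≫ p := by
  rw [← Category.assoc, restrictSupport_redι, Category.assoc]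

instance isProper_restrictSupport (d : PseudoDivisor X) (f : Y ⟶ X) [IsProper f] :
    IsProper (restrictSupport d f) :=
  isProper_redLift _ _ _

open Classical in
/-- The intersection of the pseudo-divisor `d` with a cobordism cycle `c = (f : Y ⟶ X, L₁, …, L_m)`
that is admissible for `d, D_*`. If `f(Y) ⊆ |d|`, it is `c̃₁(f^* O(d))` applied to `c`, over
`|d| ∩ X`. Otherwise `div f^* d` is a simple normal crossing divisor, automatically admissible with
respect to `D_*`, and the intersection is `f^d_* (c̃₁(L₁) ∘ ⋯ ∘ c̃₁(L_m) [f^* d ⟶ |f^* d|]_{D_*})`. -/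
def Cycle.intersect (c : Cycle b p (d :: D)) : Free b (redι (d.pullback p).support ≫ p) D :=
  if h : Set.range c.f ⊆ (d.pullback p).support then
    Finsupp.single (c.intersectInside h) 1
  else if h : IsAdmissibleDivisor (c.f ≫ p ≫ b) (c.f ≫ p) ((d.pullback p).pullback c.f) D then
    have := c.projective.isProper
    pushFree (restrictSupport (d.pullback p) c.f) (restrictSupport_comp (d.pullback p) c.f p)
      (c.bundles.foldr
        (fun L => chernFree (L.pullback (redι ((d.pullback p).pullback c.f).support)))
        (divisorCycle (Category.assoc ..) rfl h))
  else 0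

/-- The intersection map `x ↦ d(x)_{D_*}` with the pseudo-divisor `d`, from the free `𝕃`-module on
the cobordism cycles over `X` that are admissible for `d, D_*` to `Ω_*(|d| ∩ X)_{D_*}`. -/
def intersection (b : P ⟶ Spec (CommRingCat.of k)) (p : X ⟶ P) (d : PseudoDivisor P)
    (D : List (PseudoDivisor P)) :
    Free b p (d :: D) →ₗ[Lazard] Omega b (redι (d.pullback p).support ≫ p) D :=
  (relations b (redι (d.pullback p).support ≫ p) D).mkQ ∘ₗ
    Finsupp.linearCombination Lazard fun c : Cycle b p (d :: D) => c.intersect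

end Intersection

end Cobordism

end RefinedCobordism

end

/-! Both sides are sums, over the faces of `B`, of the same polynomials in first Chern classes, and
they are compared face by face in the cobordism of `|B|` relative to `E`.

First, after push-forward to the target of a cycle, intersecting the cycle with a pseudo-divisor `D`
is the operator c̃₁(O(D)). If the cycle lies inside `|D|`, this is the definition. Otherwise the
formal group law expresses c̃₁(O(D)) as the formal sum of the c̃₁(O(Dᵢ)) with multiplicities
(`Cycle.chern_bundle_eq`). This series splits as ∑ u^J F_J, and the section relation replaces the
product of the c̃₁(O(Dⱼ)), j ∈ J, by the face D^J (`sum_subClass_prod`). What remains is the divisor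
class of `D` (`Cycle.mkQ_pushFree_divisorCycle`, `Cycle.push_mkQ_intersect`). So the left side is
the sum of F_J · c̃₁(O(D₀)) applied to the faces B^J.

Second, O(D₀) ≅ O(D₁), so D₁ may replace D₀, and D₁ crosses the faces of `B` transversally. Near D₁
the divisor `B` comes from `W` along an open map with irreducible fibres. Each component of `B` that
meets D₁ is therefore, over `V`, the preimage of one component of `Bbar`, and restricts to that
component along the section (`exists_idealAt_pullback_section_eq`). Hence D₁ and the components of
`B` form a normal crossing family (`SNCFamily.option`), and the section relation turns c̃₁(O(D₁)) on
B^J into B^J ∩ D₁ (`sum_subClass_facePoly`).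

Third, the components of B ∩ D₁ are the nonempty Bᵢ ∩ D₁, with the multiplicities of `B`. The face
series of a subfamily is the face series of the whole family (`nilEval_fglFace_map`), so the sum
obtained is the class of B ∩ D₁ (`push_divisorClass_restriction`).

Admissibility and good position are controlled by one notion, `IsMonomial`: the intersections of the
initial segments of the sequence are zero ideals or monomials in a fixed normal crossing family.
Since D₀, respectively `B`, heads its admissible sequence, all later intersections are supported in
it, so they are monomials in the components of D₀ + B, respectively of `B`. Monomiality passes to
faces and yields both conditions.

By the dimension relations the Chern operators of a cycle are nilpotent. Power series identities are
therefore checked in a commutative ring, `Cycle.ChernRing`, where truncation is harmless. -/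

noncomputable section

namespace RefinedCobordism

section

/-! ### Regular local rings and parts of regular systems of parameters -/

section RegularLocalRings

open IsLocalRing

variable {R : Type*} [CommRing R] [IsLocalRing R] {ι : Type*}

/-- A family of elements of a local ring is part of a minimal system of generators of the maximal
ideal: its members lie in the maximal ideal and are linearly independent modulo its square. -/
structure IndepModSq [Fintype ι] (x : ι → R) : Prop where
  mem : ∀ i, x i ∈ maximalIdeal R
  indep : ∀ a : ι → R, ∑ i, a i * x i ∈ maximalIdeal R ^ 2 → ∀ i, a i ∈ maximalIdeal R

theorem indepModSq_iff [Fintype ι] (x : ι → R) (hx : ∀ i, x i ∈ maximalIdeal R) :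
    IndepModSq x ↔ LinearIndependent (ResidueField R)
      (fun i => ((maximalIdeal R).toCotangent ⟨x i, hx i⟩ : CotangentSpace R)) := by
  have key : ∀ a : ι → R, ∑ i, residue R (a i) • ((maximalIdeal R).toCotangent ⟨x i, hx i⟩ :
      CotangentSpace R) = 0 ↔ ∑ i, a i * x i ∈ maximalIdeal R ^ 2 := by
    intro a
    have : ∑ i, residue R (a i) • ((maximalIdeal R).toCotangent ⟨x i, hx i⟩ : CotangentSpace R) =
        (maximalIdeal R).toCotangent (∑ i, a i • ⟨x i, hx i⟩) := by
      rw [map_sum]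
      refine Finset.sum_congr rfl fun i _ => ?_
      rw [map_smul]
      exact algebraMap_smul (ResidueField R) (a i) _
    rw [this, Ideal.toCotangent_eq_zero]
    simp
  rw [Fintype.linearIndependent_iff]
  constructor
  · intro h g hg i
    choose a ha using fun i => residue_surjective (g i)
    have := h.indep a ((key a).1 (by simpa [ha] using hg)) i
    rw [← ha, residue_eq_zero_iff]
    exact this
  · intro h
    refine ⟨hx, fun a ha i => ?_⟩
    rw [← residue_eq_zero_iff]
    exact h (fun i => residue R (a i)) ((key a).2 ha) i

theorem IndepModSq.comp [Fintype ι] {κ : Type*} [Fintype κ] {x : ι → R} (h : IndepModSq x)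
    (f : κ → ι) (hf : Function.Injective f) : IndepModSq (x ∘ f) := by
  rw [indepModSq_iff (x ∘ f) fun i => h.mem (f i)]
  exact ((indepModSq_iff _ h.mem).1 h).comp f hf

/-- Local equations of a divisor are determined only up to units, and rescaling by units changes no
linear independence. -/
theorem IndepModSq.of_associated [Fintype ι] {x x' : ι → R} (h : IndepModSq x)
    (hx : ∀ i, Associated (x i) (x' i)) : IndepModSq x' := by
  choose u hu using hx
  refine ⟨fun i => hu i ▸ Ideal.mul_mem_right _ _ (h.mem i), fun a ha i => ?_⟩
  have := h.indep (fun i => a i * u i) (by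
    convert ha using 2 with i
    rw [← hu i]
    ring) i
  exact ((maximalIdeal.isMaximal R).isPrime.mem_or_mem this).resolve_right
    fun hm => (mem_maximalIdeal _).1 hm (u i).isUnit

theorem IndepModSq.notMem_sq [Fintype ι] {x : ι → R} (h : IndepModSq x) (i : ι) :
    x i ∉ maximalIdeal R ^ 2 := by
  classical
  intro hi
  have := h.indep (Pi.single i 1) (by simpa [Pi.single_apply] using hi) i
  simp at this

theorem indepModSq_singleton {x : R} (hx : x ∈ maximalIdeal R) (hx2 : x ∉ maximalIdeal R ^ 2) :
    IndepModSq (fun _ : Unit => x) := by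
  refine ⟨fun _ => hx, fun a ha _ => ?_⟩
  by_contra hu
  replace hu : IsUnit (a ()) := by simpa using hu
  simp only [Finset.univ_unique, Finset.sum_singleton] at ha
  exact hx2 ((Ideal.unit_mul_mem_iff_mem _ hu).1 ha)

/-- The images of the remaining members of an independent family in a surjective local quotient
whose kernel is generated by some of the members. -/
theorem IndepModSq.map_of_ker {S : Type*} [CommRing S] [IsLocalRing S] {κ : Type*} [Fintype ι]
    [Fintype κ] {x : ι → R} {z : κ → R} (h : IndepModSq (Sum.elim x z)) (f : R →+* S)
    (hf : Function.Surjective f) (hker : RingHom.ker f = Ideal.span (Set.range x)) :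
    IndepModSq (f ∘ z) := by
  have hloc : IsLocalHom f := .of_surjective f hf
  refine ⟨fun j => ?_, fun a ha j => ?_⟩
  · have := h.mem (Sum.inr j)
    exact map_nonunit f _ this
  · choose b hb using fun j => hf (a j)
    have hm : maximalIdeal S ^ 2 = (maximalIdeal R ^ 2).map f := by
      rw [Ideal.map_pow, map_maximalIdeal_of_surjective f hf]
    have h1 : f (∑ j, b j * z j) ∈ (maximalIdeal R ^ 2).map f := by
      rw [← hm]
      simpa [hb] using ha
    -- Lifted to `w` in the square of the maximal ideal of `R`, the relation holds up to the kernel,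
    -- that is, up to a combination of the `x`; this gives a relation among the whole family.
    obtain ⟨w, hw, hwe⟩ := (Ideal.mem_map_iff_of_surjective f hf).1 h1
    have h2 : w - ∑ j, b j * z j ∈ RingHom.ker f := by
      rw [RingHom.mem_ker, map_sub, hwe, sub_self]
    rw [hker] at h2
    obtain ⟨c, hc⟩ := (Ideal.mem_span_range_iff_exists_fun).1 h2
    have h3 := h.indep (Sum.elim c b) (by
      have : ∑ i, Sum.elim c b i * Sum.elim x z i = w := by
        simp [Fintype.sum_sum_type, hc]
      rw [this]
      exact hw) (Sum.inr j)
    rw [← hb j]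
    exact map_nonunit f _ h3

theorem exists_extend_span_eq_top {K V : Type*} [Field K] [AddCommGroup V] [Module K V]
    [FiniteDimensional K V] [Fintype ι] {v : ι → V} (hv : LinearIndependent K v) :
    ∃ (n : ℕ) (w : Fin n → V), Submodule.span K (Set.range (Sum.elim v w)) = ⊤ ∧
      n + Fintype.card ι = Module.finrank K V := by
  let S := Submodule.span K (Set.range v)
  let c := Module.finBasis K (V ⧸ S)
  choose w hw using fun j => S.mkQ_surjective (c j)
  refine ⟨_, w, ?_, ?_⟩
  · rw [Set.Sum.elim_range, Submodule.span_union, ← Submodule.map_mkQ_eq_top, Submodule.map_span,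
      ← Set.range_comp, ← c.span_eq]
    congr 2
    exact funext hw
  · rw [← finrank_span_eq_card hv]
    exact S.finrank_quotient_add_finrank

/-- Extend the cotangent classes to a spanning set by lifting a basis of the quotient space;
Nakayama's lemma turns it into generators of the maximal ideal. -/
theorem exists_generators_maximalIdeal [IsNoetherianRing R] [Fintype ι] {x : ι → R}
    (h : IndepModSq x) : ∃ (n : ℕ) (y : Fin n → R),
      maximalIdeal R = Ideal.span (Set.range x) ⊔ Ideal.span (Set.range y) ∧
      n + Fintype.card ι = (maximalIdeal R).spanFinrank := by
  obtain ⟨n, w, hw, hn⟩ := exists_extend_span_eq_top ((indepModSq_iff _ h.mem).1 h)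
  choose y hy using fun j => (maximalIdeal R).toCotangent_surjective (w j)
  refine ⟨n, fun j => (y j : R), ?_, ?_⟩
  · have hspan : Submodule.span R (Set.range (Sum.elim (fun i => ⟨x i, h.mem i⟩) y)) = ⊤ := by
      rw [← CotangentSpace.span_image_eq_top_iff, ← hw, ← Set.range_comp]
      congr 2
      ext1 i
      cases i with
      | inl i => rfl
      | inr j => exact hy j
    have := congrArg (Submodule.map (Submodule.subtype (maximalIdeal R))) hspan
    rw [Submodule.map_span, Submodule.map_top, Submodule.range_subtype, Set.Sum.elim_range,
      Set.image_union, ← Set.range_comp, ← Set.range_comp, Submodule.span_union] at this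
    exact this.symm
  · rw [spanFinrank_maximalIdeal_eq_finrank_cotangentSpace, ← hn]

/-- In the quotient only the added generators survive, so the embedding dimension drops by at least
the number of elements divided out. -/
theorem exists_generators_quotient [IsNoetherianRing R] [Fintype ι] {x : ι → R}
    (h : IndepModSq x) : ∃ _ : IsLocalRing (R ⧸ Ideal.span (Set.range x)),
      (maximalIdeal (R ⧸ Ideal.span (Set.range x))).spanFinrank + Fintype.card ι ≤
        (maximalIdeal R).spanFinrank := by
  have hle : Ideal.span (Set.range x) ≤ maximalIdeal R := by
    rw [Ideal.span_le]
    rintro _ ⟨i, rfl⟩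
    exact h.mem i
  have : Nontrivial (R ⧸ Ideal.span (Set.range x)) :=
    Ideal.Quotient.nontrivial_iff.2 (ne_top_of_le_ne_top (maximalIdeal.isMaximal R).ne_top hle)
  have : IsLocalRing (R ⧸ Ideal.span (Set.range x)) :=
    .of_surjective' _ Ideal.Quotient.mk_surjective
  refine ⟨this, ?_⟩
  obtain ⟨n, y, hm, hn⟩ := exists_generators_maximalIdeal h
  have hm' : maximalIdeal (R ⧸ Ideal.span (Set.range x)) =
      Ideal.span (Ideal.Quotient.mk (Ideal.span (Set.range x)) '' Set.range y) := by
    rw [← map_maximalIdeal_of_surjective _ Ideal.Quotient.mk_surjective, hm, Ideal.map_sup,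
      Ideal.map_quotient_self, bot_sup_eq, Ideal.map_span]
  have h1 : (maximalIdeal (R ⧸ Ideal.span (Set.range x))).spanFinrank ≤ n := by
    rw [hm']
    refine (Submodule.spanFinrank_span_le_ncard_of_finite ((Set.finite_range _).image _)).trans ?_
    refine (Set.ncard_image_le (Set.finite_range _)).trans ?_
    rw [← Set.image_univ]
    refine (Set.ncard_image_le Set.finite_univ).trans ?_
    simp
  omega

end RegularLocalRings

section RegularLocalRings

open IsLocalRing

variable {R : Type*} [CommRing R] [IsRegularLocalRing R] {ι : Type*}

/-- The embedding dimension drops by at least the number of elements, the Krull dimension by at most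
that number; starting from equality, the dimension is still at least the embedding dimension. -/
theorem isRegularLocalRing_quotient [Fintype ι] {x : ι → R}
    (h : IndepModSq x) : IsRegularLocalRing (R ⧸ Ideal.span (Set.range x)) := by
  classical
  obtain ⟨_, h1⟩ := exists_generators_quotient h
  apply IsRegularLocalRing.of_spanFinrank_maximalIdeal_le
  have h2 : ringKrullDim R ≤ ringKrullDim (R ⧸ Ideal.span (Set.range x)) + Fintype.card ι := by
    have := ringKrullDim_le_ringKrullDim_quotient_add_card (Finset.univ.image x) (by
      rw [IsLocalRing.ringJacobson_eq_maximalIdeal]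
      simpa [Set.range_subset_iff] using h.mem)
    rw [Finset.coe_image, Finset.coe_univ, Set.image_univ] at this
    refine this.trans ?_
    gcongr
    exact_mod_cast Finset.card_image_le.trans (by simp)
  rw [← (isRegularLocalRing_iff R).1 ‹_›] at h2
  have hbot : ringKrullDim (R ⧸ Ideal.span (Set.range x)) ≠ ⊥ := ringKrullDim_ne_bot
  generalize ringKrullDim (R ⧸ Ideal.span (Set.range x)) = d at *
  induction d with
  | bot => exact absurd rfl hbot
  | coe d =>
    induction d with
    | top => exact le_top
    | coe d =>
      norm_cast at h2 ⊢
      omega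

/-- Regular local rings are domains. -/
theorem isDomain_of_isRegularLocalRing (n : ℕ) : ∀ (R : Type*) [CommRing R] [IsRegularLocalRing R],
    (maximalIdeal R).spanFinrank ≤ n → IsDomain R := by
  induction n with
  | zero =>
    intro R _ _ h
    have h0 : maximalIdeal R = ⊥ := (Submodule.spanFinrank_eq_zero_iff_eq_bot
      (maximalIdeal R).fg_of_isNoetherianRing).1 (by omega)
    exact ((isField_iff_maximalIdeal_eq).2 h0).isDomain
  | succ n ih =>
    intro R _ _ h
    classical
    by_cases h0 : maximalIdeal R = ⊥
    · exact ((isField_iff_maximalIdeal_eq).2 h0).isDomain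
    have hfin := minimalPrimes.finite_of_isNoetherianRing R
    -- Prime avoidance supplies a parameter outside the square of the maximal ideal and outside all
    -- minimal primes.
    have h1 : ∃ x ∈ maximalIdeal R, x ∉ maximalIdeal R ^ 2 ∧ ∀ p ∈ minimalPrimes R, x ∉ p := by
      by_contra! hcon
      have h2 : (maximalIdeal R : Set R) ⊆
          ⋃ i ∈ (↑(insert (maximalIdeal R ^ 2) hfin.toFinset) : Set (Ideal R)), id i := by
        intro x hx
        by_cases hx2 : x ∈ maximalIdeal R ^ 2
        · exact Set.mem_biUnion (x := maximalIdeal R ^ 2) (by simp) hx2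
        · obtain ⟨p, hp, hxp⟩ := hcon x hx hx2
          exact Set.mem_biUnion (x := p) (by simp [hp]) hxp
      -- Prime avoidance tolerates two ideals that need not be prime; the square of the maximal
      -- ideal takes both places.
      obtain ⟨p, hp, hle⟩ := (Ideal.subset_union_prime (f := id) (maximalIdeal R ^ 2)
        (maximalIdeal R ^ 2) (by
          intro i hi h1 _
          have : i ∈ minimalPrimes R := by simpa [h1] using hi
          exact this.1.1)).1 h2
      rw [Finset.mem_insert, Set.Finite.mem_toFinset] at hp
      rcases hp with rfl | hp
      · refine h0 (Submodule.eq_bot_of_le_smul_of_le_jacobson_bot (maximalIdeal R) _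
          (maximalIdeal R).fg_of_isNoetherianRing ?_ (maximalIdeal_le_jacobson _))
        simpa [pow_two] using hle
      · have hmp : maximalIdeal R ∈ minimalPrimes R := by
          have := hp.1.1
          have heq : maximalIdeal R = p := le_antisymm hle (le_maximalIdeal this.ne_top)
          rwa [heq]
        have hd : ringKrullDim R = 0 := by
          rw [← maximalIdeal_height_eq_ringKrullDim, Ideal.height_eq_zero_iff.2 hmp]
          rfl
        have := (isRegularLocalRing_iff R).1 ‹_›
        rw [hd] at this
        exact h0 ((Submodule.spanFinrank_eq_zero_iff_eq_bot
          (maximalIdeal R).fg_of_isNoetherianRing).1 (by exact_mod_cast this))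
    obtain ⟨x, hx, hx2, hxp⟩ := h1
    have hind := indepModSq_singleton hx hx2
    have hreg := isRegularLocalRing_quotient hind
    obtain ⟨_, hlt⟩ := exists_generators_quotient hind
    rw [Fintype.card_unit] at hlt
    have hdom := ih (R ⧸ Ideal.span (Set.range fun _ : Unit => x)) (by omega)
    have hprime := (Ideal.Quotient.isDomain_iff_prime _).1 hdom
    rw [Set.range_const] at hprime
    obtain ⟨p, hp, hple⟩ := Ideal.exists_minimalPrimes_le (I := ⊥) (J := Ideal.span {x}) bot_le
    have hp' : p.IsPrime := hp.1.1
    -- The minimal prime `p` lies in the prime ideal generated by `x` but does not contain `x`, so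
    -- every element of `p` is `x` times an element of `p`, and Nakayama's lemma gives `p = 0`.
    have hpbot : p = ⊥ := by
      refine Submodule.eq_bot_of_le_smul_of_le_jacobson_bot (maximalIdeal R) _
        p.fg_of_isNoetherianRing ?_ (maximalIdeal_le_jacobson _)
      intro y hy
      obtain ⟨a, rfl⟩ := Ideal.mem_span_singleton.1 (hple hy)
      exact Ideal.mul_mem_mul hx ((hp'.mem_or_mem hy).resolve_left (hxp p hp))
    rw [hpbot] at hp'
    exact (IsDomain.of_bot_isPrime R)

instance (priority := 50) IsRegularLocalRing.toIsDomain (R : Type*) [CommRing R]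
    [IsRegularLocalRing R] : IsDomain R :=
  isDomain_of_isRegularLocalRing _ R le_rfl

theorem IndepModSq.isPrime_span [Fintype ι] {x : ι → R}
    (h : IndepModSq x) : (Ideal.span (Set.range x)).IsPrime := by
  have := isRegularLocalRing_quotient h
  exact (Ideal.Quotient.isDomain_iff_prime _).1 inferInstance

theorem prime_of_notMem_sq {x : R} (hx : x ∈ maximalIdeal R)
    (hx2 : x ∉ maximalIdeal R ^ 2) : Prime x := by
  have h := (indepModSq_singleton hx hx2).isPrime_span
  rw [Set.range_const] at h
  refine (Ideal.span_singleton_prime ?_).1 h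
  rintro rfl
  exact hx2 (Ideal.zero_mem _)

end RegularLocalRings

/-! ### Regularity of the local rings of smooth schemes -/

section Smooth

open IsLocalRing

/-- An étale extension of local rings preserves regularity. -/
theorem isRegularLocalRing_of_etale {P A : Type*} [CommRing P] [CommRing A] [Algebra P A]
    [Algebra.Etale P A] [IsRegularRing P] (p : Ideal A) [p.IsPrime] (S : Type*) [CommRing S]
    [Algebra A S] [IsLocalization.AtPrime S p] : IsRegularLocalRing S := by
  let q := p.under P
  have hA : IsNoetherianRing A := Algebra.FiniteType.isNoetherianRing P A
  have hqp : p.LiesOver q := ⟨rfl⟩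
  let Sp := Localization.AtPrime p
  let Pq := Localization.AtPrime q
  suffices IsRegularLocalRing Sp from
    .of_ringEquiv (IsLocalization.algEquiv p.primeCompl Sp S).toRingEquiv
  have hreg : IsRegularLocalRing Pq := inferInstance
  have hN : IsNoetherianRing Sp := IsLocalization.isNoetherianRing p.primeCompl Sp hA
  apply IsRegularLocalRing.of_spanFinrank_maximalIdeal_le
  let _ : Algebra Pq Sp := (Localization.localRingHom q p (algebraMap P A) rfl).toAlgebra
  have : Localization.AtPrime.IsLiesOverAlgebra q p := ⟨rfl⟩
  -- Unramified: the maximal ideal of the upper local ring is generated by that of the lower one, so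
  -- the embedding dimension does not grow.
  have hunr : Algebra.IsUnramifiedAt P p := Algebra.FormallyUnramified.comp P A _
  have hmax := ((Algebra.isUnramifiedAt_iff_map_eq P q p).1 hunr).2
  have hmax' : (maximalIdeal Pq).map (algebraMap Pq Sp) = maximalIdeal Sp := by
    rw [← hmax, ← Localization.AtPrime.map_eq_maximalIdeal, Ideal.map_map,
      ← IsScalarTower.algebraMap_eq]
  have h1 : (maximalIdeal Sp).spanFinrank ≤ (maximalIdeal Pq).spanFinrank := by
    rw [← hmax']
    exact Ideal.spanFinrank_map_le_of_fg _ (maximalIdeal Pq).fg_of_isNoetherianRing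
  -- Going down shows that the dimension does not drop, so regularity passes to the upper ring.
  have h2 : q.height ≤ p.height := by
    rw [Ideal.height_eq_height_add_of_liesOver_of_hasGoingDown q p]
    exact le_self_add
  have e1 : ringKrullDim Pq = q.height := IsLocalization.AtPrime.ringKrullDim_eq_height q Pq
  have e2 : ringKrullDim Sp = p.height := IsLocalization.AtPrime.ringKrullDim_eq_height p Sp
  rw [e2]
  refine (Nat.cast_le.2 h1).trans ?_
  rw [(isRegularLocalRing_iff Pq).1 hreg, e1]
  exact_mod_cast h2

/-- The local rings of a smooth scheme over a field are regular. -/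
theorem isRegularLocalRing_stalk {k : Type u} [Field k] {Y : Scheme.{u}}
    (q : Y ⟶ Spec (CommRingCat.of k)) [Smooth q] (y : Y) :
    IsRegularLocalRing (Y.presheaf.stalk y) := by
  obtain ⟨U, hU, V, hV, hy, e, hs⟩ := Smooth.exists_isStandardSmooth q y
  have hUtop : U = ⊤ := by
    have : Subsingleton (Spec (CommRingCat.of k)) :=
      inferInstanceAs (Subsingleton (PrimeSpectrum k))
    refine eq_top_iff.2 fun z _ => ?_
    rw [Subsingleton.elim z (q y)]
    exact e hy
  subst hUtop
  have hreg : IsRegularRing Γ(Spec (CommRingCat.of k), ⊤) :=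
    IsRegularRing.of_ringEquiv
      (R := k) (Scheme.ΓSpecIso (CommRingCat.of k)).commRingCatIsoToRingEquiv.symm
  obtain ⟨n, g, -, hg⟩ := hs.exists_etale_mvPolynomial
  algebraize [g]
  have hloc := hV.isLocalization_stalk ⟨y, hy⟩
  let _ : Algebra Γ(Y, V) (Y.presheaf.stalk y) :=
    TopCat.Presheaf.algebra_section_stalk Y.presheaf ⟨y, hy⟩
  exact isRegularLocalRing_of_etale (P := MvPolynomial (Fin n) Γ(Spec (CommRingCat.of k), ⊤))
    (hV.primeIdealOf ⟨y, hy⟩).asIdeal _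

end Smooth

end

section

/-! ### Formal sums in the group of points of the universal formal group law -/

section FormalGroupSums

open MvPowerSeries

/-- The relations in `lazardIdeal` identify a_{ij} with a_{ji}, and exchanging the variables
exchanges these coefficients. -/
instance isComm_universalFGL : universalFGL.IsComm where
  comm := by
    have hs : HasSubst ![(X 1 : MvPowerSeries (Fin 2) Lazard), X 0] := .X_X
    ext e
    have hprod : ∀ d : Fin 2 →₀ ℕ, coeff e (d.prod fun s n =>
        (![(X 1 : MvPowerSeries (Fin 2) Lazard), X 0] s) ^ n) =
          if e = Finsupp.single 1 (d 0) + Finsupp.single 0 (d 1) then 1 else 0 := by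
      intro d
      rw [Finsupp.prod_fintype _ _ (by simp), Fin.prod_univ_two]
      simp only [Matrix.cons_val_zero, Matrix.cons_val_one]
      rw [X_pow_eq, X_pow_eq, monomial_mul_monomial, coeff_monomial, one_mul]
    -- Only the exponent with its two entries exchanged contributes to the coefficient at `e`.
    have hiff : ∀ d : Fin 2 →₀ ℕ, e = Finsupp.single 1 (d 0) + Finsupp.single 0 (d 1) ↔
        d = Finsupp.equivFunOnFinite.symm ![e 1, e 0] := by
      intro d
      simp only [Finsupp.ext_iff, Fin.forall_fin_two]
      simp
      tauto
    rw [coeff_subst hs, finsum_eq_single _ (Finsupp.equivFunOnFinite.symm ![e 1, e 0])]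
    · rw [hprod, if_pos ((hiff _).2 rfl), smul_eq_mul, mul_one]
      simp only [universalFGL, coeff_map]
      have hsym : ∀ i j : ℕ, Ideal.Quotient.mk lazardIdeal (MvPolynomial.X (i, j)) =
          Ideal.Quotient.mk lazardIdeal (MvPolynomial.X (j, i)) := by
        intro i j
        rw [Ideal.Quotient.eq]
        exact Ideal.subset_span (Or.inr ⟨(i, j), rfl⟩)
      rw [coeff_apply, coeff_apply]
      simp only [genericSeries, Finsupp.equivFunOnFinite_symm_apply_apply, Matrix.cons_val_zero,
        Matrix.cons_val_one]
      generalize e 0 = i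
      generalize e 1 = j
      match i, j with
      | 0, 0 => rfl
      | 0, 1 => rfl
      | 1, 0 => rfl
      | i + 1, j + 1 => cases i <;> cases j <;> exact hsym _ _
      | 0, j + 2 => rfl
      | i + 2, 0 => rfl
    · intro d hd
      rw [hprod, if_neg (fun h => hd ((hiff d).1 h)), smul_zero]

variable {m m' : ℕ}

/-- A variable, as a point of the universal formal group. -/
def varPoint (i : Fin m) : universalFGL.Point (Fin m) :=
  ⟨X i, PowerSeries.HasSubst.of_constantCoeff_zero (by simp)⟩

theorem fglMul_eq (n : ℕ) (a : universalFGL.Point (Fin m)) : fglMul n a.val = (n • a).val := by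
  induction n with
  | zero => simp [fglMul]
  | succ n ih =>
    rw [fglMul, Function.iterate_succ_apply']
    change fglAdd _ (fglMul n a.val) = _
    rw [ih, succ_nsmul']
    rfl

/-- Read in the commutative group of points, an iterated formal sum can be permuted, and zero
summands can be dropped, by ordinary group theory. -/
theorem fglSum_eq (n : Fin m → ℕ) :
    fglSum n = (∑ i, n i • varPoint i : universalFGL.Point (Fin m)).val := by
  rw [Fin.sum_univ_def, fglSum]
  induction List.finRange m with
  | nil => rfl
  | cons i l ih =>
    rw [List.foldr_cons, ih, List.map_cons, List.sum_cons, FormalGroup.add_apply]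
    have := fglMul_eq (n i) (varPoint i)
    exact congrArg (fun z => fglAdd z _) this

/-- Substitution as a homomorphism of points of the universal formal group. -/
def substPoint (g : Fin m → universalFGL.Point (Fin m')) :
    universalFGL.Point (Fin m) →+ universalFGL.Point (Fin m') where
  toFun a := ⟨a.val.subst fun i => (g i).val,
    IsNilpotent_subst (hasSubst_of_constantCoeff_nilpotent fun i => (g i).prop) a.prop⟩
  map_zero' := by
    have hg : HasSubst fun i => (g i).val := hasSubst_of_constantCoeff_nilpotent fun i => (g i).prop
    apply Subtype.ext
    change subst _ (0 : MvPowerSeries (Fin m) Lazard) = 0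
    rw [← coe_substAlgHom hg, map_zero]
  map_add' a b := by
    have hg : HasSubst fun i => (g i).val := hasSubst_of_constantCoeff_nilpotent fun i => (g i).prop
    have hab : HasSubst ![a.val, b.val] :=
      hasSubst_of_constantCoeff_nilpotent (by
        intro i
        fin_cases i
        · exact a.prop
        · exact b.prop)
    apply Subtype.ext
    simp only [FormalGroup.add_apply]
    rw [subst_comp_subst_apply hab hg]
    congr 1
    ext1 i
    fin_cases i <;> rfl

/-- Leaving out summands and permuting the others in a formal sum. -/
theorem coeff_mapDomain_fglSum (n : Fin m → ℕ) (l : Fin m' → Fin m) (hl : Function.Injective l)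
    (e : Fin m' →₀ ℕ) : coeff (e.mapDomain l) (fglSum n) = coeff e (fglSum (n ∘ l)) := by
  classical
  -- The substitution sends the variable `l j` to the variable `j` and all variables outside the
  -- range of `l` to zero; being additive on points, it carries the long sum to the short one.
  let g : Fin m → universalFGL.Point (Fin m') := fun i =>
    if h : ∃ j, l j = i then varPoint h.choose else 0
  have hgl : ∀ j, g (l j) = varPoint j := by
    intro j
    have h : ∃ j', l j' = l j := ⟨j, rfl⟩
    simp only [g, dif_pos h]
    rw [hl h.choose_spec]
  have hg0 : ∀ i, (∀ j, l j ≠ i) → g i = 0 := by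
    intro i h
    simp only [g]
    rw [dif_neg]
    rintro ⟨j, hj⟩
    exact h j hj
  have hg : HasSubst fun i => (g i).val := hasSubst_of_constantCoeff_nilpotent fun i => (g i).prop
  have hvar : ∀ i, substPoint g (varPoint i) = g i := fun i => Subtype.ext (subst_X hg i)
  have h1 : (fglSum n).subst (fun i => (g i).val) = fglSum (n ∘ l) := by
    rw [fglSum_eq, fglSum_eq]
    have h2 : substPoint g (∑ i, n i • varPoint i) = ∑ j, (n ∘ l) j • varPoint j := ?_
    · exact congrArg Subtype.val h2
    rw [map_sum]
    simp only [map_nsmul, hvar]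
    rw [← Finset.sum_subset (Finset.subset_univ (Finset.univ.image l)),
      Finset.sum_image (fun a _ b _ h => hl h)]
    · exact Finset.sum_congr rfl fun j _ => by rw [hgl]; rfl
    · intro i _ hi
      rw [hg0 i (by simpa using hi), smul_zero]
  rw [← h1, coeff_subst hg, finsum_eq_single _ (e.mapDomain l)]
  · have : (e.mapDomain l).prod (fun s n => (g s).val ^ n) = monomial e (1 : Lazard) := by
      rw [Finsupp.prod_mapDomain_index_inj hl]
      simp only [hgl]
      exact (monomial_one_eq e).symm
    rw [this, coeff_monomial_same, smul_eq_mul, mul_one]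
  · intro d hd
    convert smul_zero _
    -- A monomial using a variable outside the range of `l` is killed; every other monomial is a
    -- relabelled one, and only one of these hits the exponent `e`.
    by_cases h : ∃ i ∈ d.support, ∀ j, l j ≠ i
    · obtain ⟨i, hi, hij⟩ := h
      have : (d.prod fun s n => (g s).val ^ n) = 0 := by
        refine Finset.prod_eq_zero hi ?_
        change (g i).val ^ d i = 0
        rw [show (g i).val = 0 from congrArg Subtype.val (hg0 i hij)]
        exact zero_pow (by simpa using hi)
      rw [this, map_zero]
    · push Not at h
      have hd' : d = (d.comapDomain l hl.injOn).mapDomain l := by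
        rw [Finsupp.mapDomain_comapDomain l hl]
        intro i hi
        exact h i hi
      rw [hd', Finsupp.prod_mapDomain_index_inj hl]
      simp only [hgl]
      have : (d.comapDomain l hl.injOn).prod (fun a m => (varPoint a).val ^ m) =
          monomial (d.comapDomain l hl.injOn) (1 : Lazard) := (monomial_one_eq _).symm
      rw [this, coeff_monomial_ne]
      rintro rfl
      exact hd hd'

/-- Restricting to the empty subfamily keeps the constant coefficient and leaves the zero series. -/
theorem constantCoeff_fglSum (n : Fin m → ℕ) : constantCoeff (fglSum n) = 0 := by
  let l : Fin 0 → Fin m := Fin.elim0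
  have := coeff_mapDomain_fglSum n l (fun i => i.elim0) 0
  simpa [fglSum] using this

end FormalGroupSums

/-! ### Evaluation of power series at nilpotent elements -/

section Evaluation

open MvPowerSeries

/-- Power series in no variables stand for `R` itself, so evaluation at nilpotent elements becomes
an instance of substitution. -/
theorem hasSubst_C {R : Type*} [CommRing R] {σ : Type*} [Finite σ] {a : σ → R} (ha : ∀ i, IsNilpotent (a i)) :
    HasSubst fun i => (C (a i) : MvPowerSeries PEmpty.{1} R) :=
  hasSubst_of_constantCoeff_nilpotent fun i => by simpa using ha i

variable {R : Type*} [CommRing R] [Algebra Lazard R] {m : ℕ}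

/-- The value of a power series at nilpotent elements. -/
def nilEval {σ : Type*} (a : σ → R) (φ : MvPowerSeries σ Lazard) : R :=
  constantCoeff (φ.subst fun i => (C (a i) : MvPowerSeries PEmpty.{1} R))

theorem C_nilEval {σ : Type*} (a : σ → R) (φ : MvPowerSeries σ Lazard) :
    (C (nilEval a φ) : MvPowerSeries PEmpty.{1} R) = φ.subst fun i => C (a i) := by
  ext e
  rw [Subsingleton.elim e 0, coeff_zero_eq_constantCoeff_apply, constantCoeff_C]
  rfl

theorem nilEval_X {σ : Type*} [Finite σ] {a : σ → R} (ha : ∀ i, IsNilpotent (a i)) (i : σ) :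
    nilEval a (X i) = a i := by
  rw [nilEval, subst_X (hasSubst_C ha), constantCoeff_C]

theorem nilEval_zero {σ : Type*} [Finite σ] {a : σ → R} (ha : ∀ i, IsNilpotent (a i)) :
    nilEval a 0 = 0 := by
  rw [nilEval, ← coe_substAlgHom (hasSubst_C ha), map_zero, map_zero]

/-- Monomials with an exponent above `N` vanish. The remaining finite sum has the shape of the
truncated Chern series in the definition of the divisor class. -/
theorem nilEval_eq_sum {σ : Type*} [Fintype σ] [DecidableEq σ] {a : σ → R} (N : ℕ)
    (ha : ∀ i, a i ^ (N + 1) = 0) (φ : MvPowerSeries σ Lazard) :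
    nilEval a φ = ∑ e : σ → Fin (N + 1),
      coeff (Finsupp.equivFunOnFinite.symm fun i => (e i : ℕ)) φ • ∏ i, a i ^ (e i : ℕ) := by
  have hs := hasSubst_C fun i => ⟨N + 1, ha i⟩
  have hprod : ∀ d : σ →₀ ℕ, coeff 0 (d.prod fun s n => (C (a s) : MvPowerSeries PEmpty.{1} R) ^ n) =
      ∏ i, a i ^ d i := by
    intro d
    rw [Finsupp.prod_fintype _ _ (by simp), coeff_zero_eq_constantCoeff_apply, map_prod]
    simp
  rw [nilEval, ← coeff_zero_eq_constantCoeff_apply, coeff_subst hs]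
  simp only [hprod]
  have hinj : Function.Injective fun e : σ → Fin (N + 1) =>
      Finsupp.equivFunOnFinite.symm fun i => (e i : ℕ) := by
    intro e e' h
    ext i
    simpa using DFunLike.congr_fun h i
  rw [finsum_eq_sum_of_support_subset (s := Finset.univ.image fun e : σ → Fin (N + 1) =>
      Finsupp.equivFunOnFinite.symm fun i => (e i : ℕ))]
  · rw [Finset.sum_image fun _ _ _ _ h => hinj h]
    simp
  · intro d hd
    have hlt : ∀ i, d i < N + 1 := by
      intro i
      by_contra hi
      refine hd ?_
      have : ∏ i, a i ^ d i = 0 := by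
        refine Finset.prod_eq_zero (Finset.mem_univ i) ?_
        rw [← Nat.add_sub_cancel' (not_lt.1 hi), pow_add, ha, zero_mul]
      simp only [this, smul_zero]
    simp only [Finset.coe_image, Finset.coe_univ, Set.image_univ, Set.mem_range]
    refine ⟨fun i => ⟨d i, hlt i⟩, ?_⟩
    ext i
    simp

theorem nilEval_fglAdd {a : Fin m → R} (ha : ∀ i, IsNilpotent (a i))
    {f g : MvPowerSeries (Fin m) Lazard} (hf : IsNilpotent (constantCoeff f))
    (hg : IsNilpotent (constantCoeff g)) :
    nilEval a (fglAdd f g) = nilEval ![nilEval a f, nilEval a g] universalFGL.toPowerSeries := by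
  have hfg : HasSubst ![f, g] := hasSubst_of_constantCoeff_nilpotent (by
    intro i
    fin_cases i
    · exact hf
    · exact hg)
  have : IsScalarTower Lazard Lazard R := ⟨fun a b c => by
    rw [Algebra.smul_def, Algebra.smul_def, Algebra.smul_def, smul_eq_mul, map_mul, mul_assoc]⟩
  rw [nilEval, fglAdd, subst_comp_subst_apply hfg (hasSubst_C ha), nilEval]
  congr 2
  ext1 i
  fin_cases i
  · exact (C_nilEval a f).symm
  · exact (C_nilEval a g).symm

/-- An operation on a type `B` to elements of `R` that is compatible with the universal formal
group law is compatible with formal sums. -/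
theorem nilEval_fglSum {B : Type*} (c : B → R) (add : B → B → B) (zero : B)
    (hc : ∀ x, IsNilpotent (c x)) (hzero : c zero = 0)
    (hadd : ∀ x y, c (add x y) = nilEval ![c x, c y] universalFGL.toPowerSeries)
    (n : Fin m → ℕ) (x : Fin m → B) :
    c ((List.finRange m).foldr (fun i r => add ((add (x i))^[n i] zero) r) zero) =
      nilEval (fun i => c (x i)) (fglSum n) := by
  have hx : ∀ i, IsNilpotent (c (x i)) := fun i => hc _
  -- Nilpotency of the constant coefficients is carried through the induction because it is what
  -- permits substitution into the formal group law.
  have hcc : ∀ (l : List (Fin m)), IsNilpotent (constantCoeff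
      (l.foldr (fun i r => fglAdd (fglMul (n i) (X i : MvPowerSeries (Fin m) Lazard)) r) 0)) ∧
      c (l.foldr (fun i r => add ((add (x i))^[n i] zero) r) zero) =
        nilEval (fun i => c (x i)) (l.foldr (fun i r => fglAdd (fglMul (n i) (X i)) r) 0) := by
    have hmul : ∀ (i : Fin m) (j : ℕ), IsNilpotent (constantCoeff
        (fglMul j (X i : MvPowerSeries (Fin m) Lazard))) ∧
        c ((add (x i))^[j] zero) = nilEval (fun i => c (x i)) (fglMul j (X i)) := by
      intro i j
      induction j with
      | zero => exact ⟨by simp [fglMul], by simpa [fglMul, nilEval_zero hx] using hzero⟩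
      | succ j ih =>
        have hX : IsNilpotent (constantCoeff (X i : MvPowerSeries (Fin m) Lazard)) := by simp
        refine ⟨?_, ?_⟩
        · change IsNilpotent (constantCoeff (fglMul (j + 1) (varPoint i).val))
          rw [fglMul_eq]
          exact ((j + 1) • varPoint i : universalFGL.Point (Fin m)).prop
        · have : fglMul (j + 1) (X i : MvPowerSeries (Fin m) Lazard) =
              fglAdd (X i) (fglMul j (X i)) := Function.iterate_succ_apply' _ _ _
          rw [Function.iterate_succ_apply', hadd, ih.2, this]
          rw [nilEval_fglAdd hx hX ih.1, nilEval_X hx]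
    intro l
    induction l with
    | nil => exact ⟨by simp, by simpa [nilEval_zero hx] using hzero⟩
    | cons i l ih =>
      refine ⟨?_, ?_⟩
      · exact IsNilpotent_subst (hasSubst_of_constantCoeff_nilpotent (by
          intro j
          fin_cases j
          · exact (hmul i (n i)).1
          · exact ih.1)) (universalFGL.zero_constantCoeff ▸ IsNilpotent.zero)
      · rw [List.foldr_cons, hadd, ih.2, (hmul i (n i)).2, List.foldr_cons,
          nilEval_fglAdd hx (hmul i (n i)).1 ih.1]
  exact (hcc _).2

end Evaluation

end

section

variable {X Y Z : Scheme.{u}}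

/-! ### Gluing quotients of sections -/

section Gluing

theorem germ_map {U V : Y.Opens} (h : V ≤ U) (a : Γ(Y, U)) (p : Y) (hp : p ∈ V) :
    Y.presheaf.germ V p hp (Y.presheaf.map (homOfLE h).op a) = Y.presheaf.germ U p (h hp) a :=
  TopCat.Presheaf.germ_res_apply Y.presheaf (homOfLE h) p hp a

theorem exists_germ (p : Y) (v : Y.presheaf.stalk p) :
    ∃ (V : Y.Opens) (hp : p ∈ V) (w : Γ(Y, V)), Y.presheaf.germ V p hp w = v :=
  Y.presheaf.exists_germ_eq v

theorem exists_germ_eq_of_germ_eq {U V : Y.Opens} (p : Y) (hU : p ∈ U) (hV : p ∈ V) (a : Γ(Y, U))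
    (b : Γ(Y, V)) (h : Y.presheaf.germ U p hU a = Y.presheaf.germ V p hV b) :
    ∃ (W : Y.Opens) (_ : p ∈ W) (hWU : W ≤ U) (hWV : W ≤ V), ∀ q (hq : q ∈ W),
      Y.presheaf.germ U q (hWU hq) a = Y.presheaf.germ V q (hWV hq) b := by
  obtain ⟨W, hp, i, j, hij⟩ := Y.presheaf.germ_eq p hU hV _ _ h
  refine ⟨W, hp, i.le, j.le, fun q hq => ?_⟩
  have := congrArg (Y.presheaf.germ W q hq) hij
  exact (TopCat.Presheaf.germ_res_apply Y.presheaf i q hq a).symm.trans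
    (this.trans (TopCat.Presheaf.germ_res_apply Y.presheaf j q hq b))

/-- Two sections with associated germs, which are not zero divisors, differ by a unit. -/
theorem exists_unit_mul_eq {U : Y.Opens} (a b : Γ(Y, U))
    (hb : ∀ p (hp : p ∈ U), Y.presheaf.germ U p hp b ∈ nonZeroDivisors (Y.presheaf.stalk p))
    (h : ∀ p (hp : p ∈ U), Associated (Y.presheaf.germ U p hp b) (Y.presheaf.germ U p hp a)) :
    ∃ g : Γ(Y, U)ˣ, ∀ p (hp : p ∈ U), Y.presheaf.germ U p hp a =
      Y.presheaf.germ U p hp (g : Γ(Y, U)) * Y.presheaf.germ U p hp b := by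
  -- The quotient of the two germs at a point spreads out to a neighbourhood.
  have hloc : ∀ p : U, ∃ (V : Y.Opens) (hV : V ≤ U) (_ : p.1 ∈ V) (v : Γ(Y, V)),
      ∀ q (hq : q ∈ V), Y.presheaf.germ U q (hV hq) a =
        Y.presheaf.germ V q hq v * Y.presheaf.germ U q (hV hq) b := by
    rintro ⟨p, hp⟩
    obtain ⟨v, hv⟩ := h p hp
    obtain ⟨V, hpV, w, hw⟩ := exists_germ p v.1
    have hpVU : p ∈ V ⊓ U := ⟨hpV, hp⟩
    have h1 : Y.presheaf.germ (V ⊓ U) p hpVU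
        (Y.presheaf.map (homOfLE inf_le_left).op w * Y.presheaf.map (homOfLE inf_le_right).op b) =
        Y.presheaf.germ U p hp a := by
      rw [PseudoDivisor.germ_mul_res, hw, ← hv, mul_comm]
    obtain ⟨V', hpV', i, j, hij⟩ := exists_germ_eq_of_germ_eq p hpVU hp _ _ h1
    refine ⟨V', j, hpV', Y.presheaf.map (homOfLE (i.trans inf_le_left)).op w, fun q hq => ?_⟩
    rw [germ_map, ← hij q hq, PseudoDivisor.germ_mul_res]
  choose V hVU hpV v hv using hloc
  -- Local quotients are unique because the germs of `b` can be cancelled, so they agree on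
  -- overlaps.
  have hcompat : TopCat.Presheaf.IsCompatible Y.sheaf.1 V v := by
    intro p q
    refine TopCat.Presheaf.section_ext Y.sheaf _ _ _ fun z hz => ?_
    have e1 := TopCat.Presheaf.germ_res_apply Y.presheaf ((V p).infLELeft (V q)) z hz (v p)
    have e2 := TopCat.Presheaf.germ_res_apply Y.presheaf ((V p).infLERight (V q)) z hz (v q)
    refine e1.trans (Eq.trans ?_ e2.symm)
    have h1 := hv p z hz.1
    have h2 := hv q z hz.2
    rw [h1] at h2
    exact (mul_cancel_right_mem_nonZeroDivisors (hb z (hVU p hz.1))).1 h2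
  obtain ⟨g, hg, -⟩ := Y.sheaf.existsUnique_gluing' V U (fun p => homOfLE (hVU p))
    (fun p hp => Opens.mem_iSup.2 ⟨⟨p, hp⟩, hpV ⟨p, hp⟩⟩) v hcompat
  have hgerm : ∀ p (hp : p ∈ U), Y.presheaf.germ U p hp a =
      Y.presheaf.germ U p hp g * Y.presheaf.germ U p hp b := by
    intro p hp
    have e1 := TopCat.Presheaf.germ_res_apply Y.presheaf (homOfLE (hVU ⟨p, hp⟩)) p
      (hpV ⟨p, hp⟩) g
    have e2 := congrArg (Y.presheaf.germ _ p (hpV ⟨p, hp⟩)) (hg ⟨p, hp⟩)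
    rw [hv ⟨p, hp⟩ p (hpV ⟨p, hp⟩)]
    congr 1
    exact e2.symm.trans e1
  have hunit : IsUnit g := by
    refine Y.toRingedSpace.isUnit_of_isUnit_germ U g fun p hp => ?_
    obtain ⟨w, hw⟩ := h p hp
    have h1 := hgerm p hp
    rw [← hw, mul_comm] at h1
    have := (mul_cancel_right_mem_nonZeroDivisors (hb p hp)).1 h1
    exact this ▸ w.isUnit
  exact ⟨hunit.unit, hgerm⟩

end Gluing

/-! ### Isomorphisms of line bundles and pull-back -/

namespace LineBundle

theorem Iso.of_germ_eq {L M : LineBundle Y}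
    (h : ∀ (x y p : Y) (hL : p ∈ L.U x ⊓ L.U y) (hM : p ∈ M.U x ⊓ M.U y),
      Y.presheaf.germ (M.U x ⊓ M.U y) p hM (M.g x y : Γ(Y, M.U x ⊓ M.U y)) =
      Y.presheaf.germ (L.U x ⊓ L.U y) p hL (L.g x y : Γ(Y, L.U x ⊓ L.U y))) : Iso L M := by
  refine ⟨fun _ => 1, fun x y p hx hy hL hM => ?_⟩
  rw [Units.val_one, Units.val_one, map_one, map_one, one_mul, mul_one, h x y p hL hM]

theorem Iso.refl (L : LineBundle Y) : Iso L L := .of_germ_eq fun _ _ _ _ _ => rfl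

theorem aux_ring {R : Type*} [CommRing R] {a a' b b' l m : R} (h1 : a * a' = 1) (h2 : b * b' = 1)
    (key : a * m = l * b) : a' * l = m * b' := by
  linear_combination (-(a' * b')) * key + m * b' * h1 - l * a' * h2

theorem Iso.symm {L M : LineBundle Y} (h : Iso L M) : Iso M L := by
  obtain ⟨h, hh⟩ := h
  refine ⟨fun x => resUnit (inf_comm _ _).le (h x)⁻¹, fun x y p hx hy hM hL => ?_⟩
  rw [germ_resUnit, germ_resUnit]
  have key := hh x y p ⟨hx.2, hx.1⟩ ⟨hy.2, hy.1⟩ hL hM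
  have hu : ∀ z (hz : p ∈ L.U z ⊓ M.U z), Y.presheaf.germ _ p hz (h z : Γ(Y, L.U z ⊓ M.U z)) *
      Y.presheaf.germ _ p hz ((h z)⁻¹ : Γ(Y, L.U z ⊓ M.U z)ˣ).1 = 1 := by
    intro z hz
    rw [← map_mul, Units.mul_inv, map_one]
  have h1 := hu x ⟨hx.2, hx.1⟩
  have h2 := hu y ⟨hy.2, hy.1⟩
  exact aux_ring h1 h2 key

end LineBundle

end

section

variable {X Y Z : Scheme.{u}}

namespace LineBundle

theorem germ_g_pullback (L : LineBundle X) (f : Y ⟶ X) (x y p : Y)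
    (hp : p ∈ (L.pullback f).U x ⊓ (L.pullback f).U y)
    (hp' : f p ∈ L.U (f x) ⊓ L.U (f y)) :
    Y.presheaf.germ ((L.pullback f).U x ⊓ (L.pullback f).U y) p hp
      ((L.pullback f).g x y : Γ(Y, (L.pullback f).U x ⊓ (L.pullback f).U y)) =
    f.stalkMap p (X.presheaf.germ (L.U (f x) ⊓ L.U (f y)) (f p) hp'
      (L.g (f x) (f y) : Γ(X, L.U (f x) ⊓ L.U (f y)))) :=
  germ_app f _ p hp' _

/-- Functoriality of the stalk maps makes the transition functions agree, so the constant unit 1 is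
an isomorphism. -/
theorem iso_pullback_comp (L : LineBundle X) (f : Y ⟶ X) (g : Z ⟶ Y) :
    Iso (L.pullback (g ≫ f)) ((L.pullback f).pullback g) := by
  refine .of_germ_eq fun x y p hL hM => ?_
  have hp : f (g p) ∈ L.U (f (g x)) ⊓ L.U (f (g y)) := hL
  refine (germ_g_pullback (L.pullback f) g x y p hM hM).trans ?_
  refine (congrArg (g.stalkMap p) (germ_g_pullback L f (g x) (g y) (g p) hM hp)).trans ?_
  refine Eq.trans ?_ (germ_g_pullback L (g ≫ f) x y p hL hp).symm
  exact (congrArg (fun φ => φ (X.presheaf.germ (L.U (f (g x)) ⊓ L.U (f (g y))) (f (g p)) hp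
    (L.g (f (g x)) (f (g y)) : Γ(X, L.U (f (g x)) ⊓ L.U (f (g y))))))
    (congrArg (fun φ => φ.hom) (Scheme.Hom.stalkMap_comp g f p))).symm

theorem Iso.pullback {L M : LineBundle X} (h : Iso L M) (f : Y ⟶ X) :
    Iso (L.pullback f) (M.pullback f) := by
  obtain ⟨h, hh⟩ := h
  refine ⟨fun y => Units.map (f.app (L.U (f y) ⊓ M.U (f y))).hom.toMonoidHom (h (f y)),
    fun x y p hx hy hL hM => ?_⟩
  have key := congrArg (f.stalkMap p) (hh (f x) (f y) (f p) hx hy hL hM)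
  rw [map_mul, map_mul] at key
  exact (congrArg₂ (· * ·) (germ_app f _ p hx _) (germ_g_pullback M f x y p hM hM)).trans
    (key.trans (congrArg₂ (· * ·) (germ_g_pullback L f x y p hL hL) (germ_app f _ p hy _)).symm)

theorem Iso.pullback_id {L M : LineBundle X} (h : Iso L M) : Iso L (M.pullback (𝟙 X)) := by
  obtain ⟨h, hh⟩ := h
  refine ⟨fun y => h y, fun x y p hx hy hL hM => ?_⟩
  have key := hh x y p hx hy hL hM
  refine Eq.trans (congrArg₂ (· * ·) rfl ?_) key
  refine (germ_g_pullback M (𝟙 X) x y p hM hM).trans ?_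
  exact (congrArg (fun φ => φ (X.presheaf.germ (M.U x ⊓ M.U y) p hM
    (M.g x y : Γ(X, M.U x ⊓ M.U y))))
    (congrArg (fun φ => φ.hom) (Scheme.Hom.stalkMap_id X p)))

/-- The trivial line bundle. -/
def trivial (X : Scheme.{u}) : LineBundle X where
  U _ := ⊤
  mem _ := _root_.trivial
  g _ _ := 1
  cocycle x y z p hxy hyz hxz := by simp

end LineBundle

/-! ### Local equations, generizations and ideals of pseudo-divisors -/

namespace PseudoDivisor

theorem associated_eqn (D : PseudoDivisor Y) (y z : Y) (hz : z ∈ D.bundle.U y) :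
    Associated (D.eqn z) (Y.presheaf.germ (D.bundle.U y) z hz (D.s y)) := by
  have hyz : z ∈ D.bundle.U y ⊓ D.bundle.U z := ⟨hz, D.bundle.mem z⟩
  have h := D.compat y z z hz (D.bundle.mem z) hyz
  rw [h, mul_comm]
  exact associated_mul_unit_right _ _ ((D.bundle.g y z).isUnit.map _)

theorem idealAt_eq_iff (D D' : PseudoDivisor Y) (y : Y) [IsDomain (Y.presheaf.stalk y)] :
    D.idealAt y = D'.idealAt y ↔ Associated (D.eqn y) (D'.eqn y) :=
  Ideal.span_singleton_eq_span_singleton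

theorem idealAt_eq_span_germ (D : PseudoDivisor Y) (y z : Y) (hz : z ∈ D.bundle.U y) :
    D.idealAt z = Ideal.span {Y.presheaf.germ (D.bundle.U y) z hz (D.s y)} :=
  le_antisymm (Ideal.span_singleton_le_span_singleton.2 (D.associated_eqn y z hz).symm.dvd)
    (Ideal.span_singleton_le_span_singleton.2 (D.associated_eqn y z hz).dvd)

theorem mem_support_iff (D : PseudoDivisor Y) (y : Y) :
    y ∈ D.support ↔ D.eqn y ∈ IsLocalRing.maximalIdeal (Y.presheaf.stalk y) := Iff.rfl

theorem mem_support_iff_idealAt (D : PseudoDivisor Y) (y : Y) :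
    y ∈ D.support ↔ D.idealAt y ≠ ⊤ := by
  rw [mem_support_iff, idealAt, Ne, Ideal.span_singleton_eq_top]
  simp

theorem support_eq_of_idealAt {D D' : PseudoDivisor Y} (h : ∀ y, D.idealAt y = D'.idealAt y) :
    D.support = D'.support := by
  ext y
  exact (D.mem_support_iff_idealAt y).trans (h y ▸ (D'.mem_support_iff_idealAt y).symm)

theorem associated_stalkSpecializes (D : PseudoDivisor Y) {ξ y : Y} (h : ξ ⤳ y) :
    Associated (D.eqn ξ) (Y.presheaf.stalkSpecializes h (D.eqn y)) := by
  have hξ : ξ ∈ D.bundle.U y := h.mem_open (D.bundle.U y).isOpen (D.bundle.mem y)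
  have e : Y.presheaf.stalkSpecializes h (D.eqn y) =
      Y.presheaf.germ (D.bundle.U y) ξ hξ (D.s y) :=
    TopCat.Presheaf.germ_stalkSpecializes_apply Y.presheaf (D.bundle.mem y) h (D.s y)
  rw [e]
  exact D.associated_eqn y ξ hξ

end PseudoDivisor

/-- The prime ideal of the local ring at `y` that belongs to a generization `ξ` of `y`. -/
def primeOf {ξ y : Y} (h : ξ ⤳ y) : Ideal (Y.presheaf.stalk y) :=
  (IsLocalRing.maximalIdeal (Y.presheaf.stalk ξ)).comap (Y.presheaf.stalkSpecializes h).hom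

theorem mem_primeOf {ξ y : Y} (h : ξ ⤳ y) (a : Y.presheaf.stalk y) :
    a ∈ primeOf h ↔ Y.presheaf.stalkSpecializes h a ∈
      IsLocalRing.maximalIdeal (Y.presheaf.stalk ξ) := Iff.rfl

instance isPrime_primeOf {ξ y : Y} (h : ξ ⤳ y) : (primeOf h).IsPrime :=
  Ideal.IsPrime.comap _

/-- Turns incidence of a generization with a support into membership in a prime of the single local
ring at `y`; the geometry of faces is done there. -/
theorem PseudoDivisor.eqn_mem_primeOf (D : PseudoDivisor Y) {ξ y : Y} (h : ξ ⤳ y) :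
    D.eqn y ∈ primeOf h ↔ ξ ∈ D.support := by
  rw [mem_primeOf, D.mem_support_iff]
  obtain ⟨v, hv⟩ := D.associated_stalkSpecializes h
  rw [← hv]
  exact Ideal.mul_unit_mem_iff_mem _ v.isUnit

/-- The points of the spectrum of the local ring at `y` are the generizations of `y`. -/
theorem exists_primeOf_eq (y : Y) (P : Ideal (Y.presheaf.stalk y)) [hP : P.IsPrime] :
    ∃ (ξ : Y) (h : ξ ⤳ y), primeOf h = P := by
  let z : Spec (Y.presheaf.stalk y) := (⟨P, hP⟩ : PrimeSpectrum _)
  let ξ := Y.fromSpecStalk y z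
  have h : ξ ⤳ y := by
    have : ξ ∈ Set.range (Y.fromSpecStalk y) := ⟨z, rfl⟩
    rwa [Scheme.range_fromSpecStalk] at this
  refine ⟨ξ, h, ?_⟩
  have e := Scheme.SpecMap_stalkSpecializes_fromSpecStalk h
  have e2 : Y.fromSpecStalk y (Spec.map (Y.presheaf.stalkSpecializes h)
      (IsLocalRing.closedPoint (Y.presheaf.stalk ξ))) = Y.fromSpecStalk y z := by
    exact (congrArg (fun φ : Spec (Y.presheaf.stalk ξ) ⟶ Y => φ
      (IsLocalRing.closedPoint (Y.presheaf.stalk ξ))) e).trans Scheme.fromSpecStalk_closedPoint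
  have e3 := (Y.fromSpecStalk y).isEmbedding.injective e2
  exact congrArg PrimeSpectrum.asIdeal e3

/-- A stalk element killed on a closed subscheme lies in the primes of all points of it. -/
theorem mem_primeOf_of_stalkMap_eq_zero (i : X ⟶ Y) {ξ y : X} (h : ξ ⤳ y)
    (a : Y.presheaf.stalk (i y)) (ha : i.stalkMap y a = 0) :
    a ∈ primeOf (h.map i.continuous) := by
  rw [mem_primeOf]
  have e := Scheme.Hom.stalkSpecializes_stalkMap_apply i ξ y h a
  rw [ha, map_zero] at e
  have : i.stalkMap ξ (Y.presheaf.stalkSpecializes (h.map i.continuous) a) ∈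
      IsLocalRing.maximalIdeal (X.presheaf.stalk ξ) := by
    erw [e]
    exact zero_mem _
  simpa using this

namespace PseudoDivisor

theorem eqn_add (D D' : PseudoDivisor Y) (y : Y) : (D + D').eqn y = D.eqn y * D'.eqn y :=
  germ_mul_res _ _ _ _ _ _

theorem idealAt_add (D D' : PseudoDivisor Y) (y : Y) :
    (D + D').idealAt y = D.idealAt y * D'.idealAt y := by
  rw [idealAt, eqn_add, idealAt, idealAt, Ideal.span_singleton_mul_span_singleton]

theorem idealAt_pullback (D : PseudoDivisor X) (f : Y ⟶ X) (y : Y) :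
    (D.pullback f).idealAt y = (D.idealAt (f y)).map (f.stalkMap y).hom := by
  rw [idealAt, idealAt, Ideal.map_span, Set.image_singleton, eqn_pullback]

/-- The pseudo-divisor with empty zero scheme. -/
def one (X : Scheme.{u}) : PseudoDivisor X where
  bundle := .trivial X
  s _ := 1
  compat x y p hx hy hxy := by
    have h (U : X.Opens) (hU : p ∈ U) : X.presheaf.germ U p hU 1 = 1 := map_one _
    exact (h _ hx).trans ((congrArg₂ (· * ·) (h _ hxy) (h _ hy)).trans (mul_one 1)).symm

theorem eqn_one (y : Y) : (one Y).eqn y = 1 := map_one _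

theorem idealAt_one (y : Y) : (one Y).idealAt y = ⊤ := by
  rw [idealAt, eqn_one, Ideal.span_singleton_one]

theorem exists_idealAt_eq_prod {ι : Type*} (S : Finset ι) (x : ι → PseudoDivisor Y) (a : ι → ℕ) :
    ∃ D : PseudoDivisor Y, ∀ y, D.idealAt y = ∏ l ∈ S, (x l).idealAt y ^ a l := by
  classical
  induction S using Finset.induction_on with
  | empty => exact ⟨one Y, fun y => by simp [idealAt_one]⟩
  | insert j S hj ih =>
    obtain ⟨D, hD⟩ := ih
    have : ∀ n : ℕ, ∃ D' : PseudoDivisor Y, ∀ y, D'.idealAt y = (x j).idealAt y ^ n := by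
      intro n
      induction n with
      | zero => exact ⟨one Y, fun y => by simp [idealAt_one]⟩
      | succ n ih =>
        obtain ⟨D', hD'⟩ := ih
        exact ⟨D' + x j, fun y => by rw [idealAt_add, hD', pow_succ]⟩
    obtain ⟨D', hD'⟩ := this (a j)
    exact ⟨D' + D, fun y => by rw [idealAt_add, hD, hD', Finset.prod_insert hj]⟩

/-- A family of stalk ideals that are locally generated by a nonzero function is the ideal of a
pseudo-divisor. -/
theorem exists_idealAt_eq (hdom : ∀ y : Y, IsDomain (Y.presheaf.stalk y))
    (I : ∀ y : Y, Ideal (Y.presheaf.stalk y))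
    (h : ∀ y : Y, ∃ (U : Y.Opens) (_ : y ∈ U) (t : Γ(Y, U)), ∀ p (hp : p ∈ U),
      Ideal.span {Y.presheaf.germ U p hp t} = I p ∧ Y.presheaf.germ U p hp t ≠ 0) :
    ∃ D : PseudoDivisor Y, ∀ y, D.idealAt y = I y := by
  choose U hU t ht using h
  have hg : ∀ x y, ∃ g : Γ(Y, U x ⊓ U y)ˣ, ∀ p (hp : p ∈ U x ⊓ U y),
      Y.presheaf.germ (U x) p hp.1 (t x) =
      Y.presheaf.germ _ p hp (g : Γ(Y, U x ⊓ U y)) * Y.presheaf.germ (U y) p hp.2 (t y) := by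
    intro x y
    obtain ⟨g, hg⟩ := exists_unit_mul_eq
      (Y.presheaf.map (homOfLE (inf_le_left : U x ⊓ U y ≤ _)).op (t x))
      (Y.presheaf.map (homOfLE (inf_le_right : U x ⊓ U y ≤ _)).op (t y))
      (fun p hp => by
        rw [germ_map]
        exact mem_nonZeroDivisors_of_ne_zero (ht y p hp.2).2)
      (fun p hp => by
        rw [germ_map, germ_map, ← Ideal.span_singleton_eq_span_singleton, (ht y p hp.2).1,
          (ht x p hp.1).1])
    refine ⟨g, fun p hp => ?_⟩
    have := hg p hp
    rwa [germ_map, germ_map] at this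
  choose g hg using hg
  -- The cocycle condition follows by cancelling the nonzero local equation.
  refine ⟨⟨⟨U, hU, g, fun x y z p hxy hyz hxz => ?_⟩, t, fun x y p hx hy hxy => hg x y p hxy⟩,
    fun y => (ht y y (hU y)).1⟩
  have h1 := hg x y p hxy
  rw [hg y z p hyz, hg x z p hxz, ← mul_assoc] at h1
  exact (mul_right_cancel₀ (ht z p hyz.2).2 h1).symm

/-- Pseudo-divisors with the same zero scheme have isomorphic line bundles. -/
theorem bundle_iso_of_idealAt_eq (hdom : ∀ y : Y, IsDomain (Y.presheaf.stalk y))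
    {D D' : PseudoDivisor Y} (h : ∀ y, D.idealAt y = D'.idealAt y) (h0 : ∀ y, D'.eqn y ≠ 0) :
    LineBundle.Iso D.bundle D'.bundle := by
  have hne : ∀ x p (hp : p ∈ D'.bundle.U x), Y.presheaf.germ _ p hp (D'.s x) ≠ 0 :=
    fun x p hp => (D'.associated_eqn x p hp).ne_zero_iff.1 (h0 p)
  have hh : ∀ x, ∃ g : Γ(Y, D.bundle.U x ⊓ D'.bundle.U x)ˣ,
      ∀ p (hp : p ∈ D.bundle.U x ⊓ D'.bundle.U x),
      Y.presheaf.germ (D.bundle.U x) p hp.1 (D.s x) =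
      Y.presheaf.germ _ p hp (g : Γ(Y, D.bundle.U x ⊓ D'.bundle.U x)) *
        Y.presheaf.germ (D'.bundle.U x) p hp.2 (D'.s x) := by
    intro x
    obtain ⟨g, hg⟩ := exists_unit_mul_eq
      (Y.presheaf.map (homOfLE (inf_le_left : D.bundle.U x ⊓ D'.bundle.U x ≤ _)).op (D.s x))
      (Y.presheaf.map (homOfLE (inf_le_right : D.bundle.U x ⊓ D'.bundle.U x ≤ _)).op (D'.s x))
      (fun p hp => by
        rw [germ_map]
        exact mem_nonZeroDivisors_of_ne_zero (hne x p hp.2))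
      (fun p hp => by
        rw [germ_map, germ_map, ← Ideal.span_singleton_eq_span_singleton,
          ← D.idealAt_eq_span_germ x p hp.1, ← D'.idealAt_eq_span_germ x p hp.2, h p])
    refine ⟨g, fun p hp => ?_⟩
    have := hg p hp
    rwa [germ_map, germ_map] at this
  choose g hg using hh
  refine ⟨g, fun x y p hx hy hL hM => ?_⟩
  refine mul_right_cancel₀ (hne y p hM.2) ?_
  rw [mul_assoc, mul_assoc, ← D'.compat x y p hM.1 hM.2 hM, ← hg x p hx, ← hg y p hy,
    ← D.compat x y p hL.1 hL.2 hL]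

end PseudoDivisor

section Reduced

/-- Closed immersions of reduced schemes with the same image are isomorphic. -/
theorem exists_iso_of_range_eq [IsReduced X] [IsReduced Y] (i : X ⟶ Z) (j : Y ⟶ Z)
    [IsClosedImmersion i] [IsClosedImmersion j] (h : Set.range i = Set.range j) :
    ∃ φ : X ≅ Y, φ.hom ≫ j = i := by
  let F : Closeds Z := ⟨Set.range i, i.isClosedEmbedding.isClosed_range⟩
  -- The kernel of a closed immersion from a reduced scheme is the vanishing ideal of its image,
  -- hence depends on the image only.
  have hker : ∀ {X' : Scheme.{u}} [IsReduced X'] (i' : X' ⟶ Z) [IsClosedImmersion i'],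
      Set.range i' = F → i'.ker = Scheme.IdealSheafData.vanishingIdeal F := by
    intro X' _ i' _ h'
    rw [← Scheme.IdealSheafData.map_bot, ← Scheme.nilradical_eq_bot,
      ← Scheme.IdealSheafData.vanishingIdeal_top, Scheme.IdealSheafData.map_vanishingIdeal]
    congr 1
    ext1
    simpa [h'] using F.isClosed.closure_eq
  have hi := hker i rfl
  have hj := hker j h.symm
  have := IsClosedImmersion.isIso_lift j i (hj.trans hi.symm)
  exact ⟨asIso (IsClosedImmersion.lift j i (hj.trans hi.symm).le), IsClosedImmersion.lift_fac _ _ _⟩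

end Reduced

end

section

variable {k : Type u} [Field k] {X Y Z G : Scheme.{u}}

/-! ### Irreducible components and closed immersions -/

section Components

theorem exists_generic (F : Closeds Y) (hF : IsIrreducible (F : Set Y)) :
    ∃ η ∈ F, ∀ y ∈ F, η ⤳ y := by
  have h := hF.isGenericPoint_genericPoint F.isClosed
  exact ⟨_, h.mem, fun y hy => h.specializes hy⟩

/-- The closure of a point. -/
def pointClosure (y : Y) : Closeds Y := ⟨closure {y}, isClosed_closure⟩

theorem mem_pointClosure {y z : Y} : z ∈ pointClosure y ↔ y ⤳ z :=
  (specializes_iff_mem_closure).symm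

theorem isIrreducible_pointClosure (y : Y) : IsIrreducible (pointClosure y : Set Y) :=
  isIrreducible_singleton.closure

theorem mem_closeds_of_specializes {F : Closeds Y} {y z : Y} (h : y ⤳ z) (hy : y ∈ F) : z ∈ F :=
  h.mem_closed F.isClosed hy

/-- The generic point of an irreducible subset of `K'` containing `F` specializes to a point of `K`,
hence lies in `K`; so nothing larger than `F` appears in `K'`. -/
theorem mem_components_of_generization_stable {K K' F : Closeds Y} (hle : K ≤ K')
    (hst : ∀ y ∈ K, ∀ ξ ∈ K', ξ ⤳ y → ξ ∈ K) (hF : F ∈ components K) : F ∈ components K' := by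
  refine ⟨⟨hF.1.1, hF.1.2.trans hle⟩, fun F' hF' hFF' => hF.2 ⟨hF'.1, fun z hz => ?_⟩ hFF'⟩
  obtain ⟨η, hη, hgen⟩ := exists_generic F' hF'.1
  obtain ⟨y, hy⟩ := hF.1.1.nonempty
  exact mem_closeds_of_specializes (hgen z hz)
    (hst y (hF.1.2 hy) η (hF'.2 hη) (hgen y (hFF' hy)))

/-- The image of a closed subset under a closed immersion. -/
def imageClosed (i : X ⟶ Y) [IsClosedImmersion i] (F : Closeds X) : Closeds Y :=
  ⟨i '' F, i.isClosedEmbedding.isClosedMap _ F.isClosed⟩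

theorem mem_imageClosed (i : X ⟶ Y) [IsClosedImmersion i] {F : Closeds X} {y : Y} :
    y ∈ imageClosed i F ↔ ∃ x ∈ F, i x = y := Iff.rfl

theorem apply_mem_imageClosed (i : X ⟶ Y) [IsClosedImmersion i] {F : Closeds X} {x : X} :
    i x ∈ imageClosed i F ↔ x ∈ F := by
  refine ⟨fun ⟨z, hz, e⟩ => ?_, fun h => ⟨x, h, rfl⟩⟩
  rwa [← i.isClosedEmbedding.injective e]

theorem imageClosed_injective (i : X ⟶ Y) [IsClosedImmersion i] :
    Function.Injective (imageClosed i) := by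
  intro F F' h
  ext x
  exact (apply_mem_imageClosed i).symm.trans
    ((iff_of_eq (congrArg (i x ∈ ·) h)).trans (apply_mem_imageClosed i))

theorem imageClosed_mono (i : X ⟶ Y) [IsClosedImmersion i] {F F' : Closeds X} (h : F ≤ F') :
    imageClosed i F ≤ imageClosed i F' := fun _ ⟨x, hx, e⟩ => ⟨x, h hx, e⟩

theorem exists_imageClosed_eq (i : X ⟶ Y) [IsClosedImmersion i] (F : Closeds Y)
    (h : (F : Set Y) ⊆ Set.range i) : ∃ F' : Closeds X, imageClosed i F' = F := by
  refine ⟨⟨i ⁻¹' F, F.isClosed.preimage i.continuous⟩, ?_⟩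
  ext1
  exact Set.image_preimage_eq_of_subset h

theorem isIrreducible_imageClosed (i : X ⟶ Y) [IsClosedImmersion i] {F : Closeds X} :
    IsIrreducible (imageClosed i F : Set Y) ↔ IsIrreducible (F : Set X) := by
  refine ⟨fun h => ?_, fun h => h.image i i.continuous.continuousOn⟩
  obtain ⟨η, ⟨x, hx, rfl⟩, hgen⟩ := exists_generic _ h
  have : F = pointClosure x := by
    ext z
    refine ⟨fun hz => mem_pointClosure.2 ?_, fun hz =>
      mem_closeds_of_specializes (mem_pointClosure.1 hz) hx⟩
    exact i.isClosedEmbedding.isInducing.specializes_iff.1 (hgen _ ⟨z, hz, rfl⟩)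
  rw [this]
  exact isIrreducible_pointClosure x

theorem imageClosed_mem_components (i : X ⟶ Y) [IsClosedImmersion i] {F K : Closeds X} :
    imageClosed i F ∈ components (imageClosed i K) ↔ F ∈ components K := by
  have hle : ∀ {F F' : Closeds X}, imageClosed i F ≤ imageClosed i F' → F ≤ F' :=
    fun h x hx => (apply_mem_imageClosed i).1 (h ⟨x, hx, rfl⟩)
  constructor
  · rintro ⟨⟨h1, h2⟩, h3⟩
    exact ⟨⟨(isIrreducible_imageClosed i).1 h1, hle h2⟩, fun F' hF' hFF' =>
      hle (h3 ⟨(isIrreducible_imageClosed i).2 hF'.1, imageClosed_mono i hF'.2⟩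
        (imageClosed_mono i hFF'))⟩
  · rintro ⟨⟨h1, h2⟩, h3⟩
    refine ⟨⟨(isIrreducible_imageClosed i).2 h1, imageClosed_mono i h2⟩, fun F' hF' hFF' => ?_⟩
    obtain ⟨F'', rfl⟩ := exists_imageClosed_eq i F' fun z hz => by
      obtain ⟨x, -, e⟩ := hF'.2 hz
      exact ⟨x, e⟩
    exact imageClosed_mono i
      (h3 ⟨(isIrreducible_imageClosed i).1 hF'.1, hle hF'.2⟩ (hle hFF'))

theorem range_redι_comp (i : X ⟶ Y) [IsClosedImmersion i] (F : Closeds X) :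
    Set.range (redι F ≫ i) = imageClosed i F := by
  have : Set.range (redι F ≫ i) = i '' Set.range (redι F) := by
    rw [← Set.range_comp]
    rfl
  rw [this, range_redι]
  rfl

theorem smooth_of_range_eq [IsReduced X] [IsReduced Z] (i : X ⟶ Y) (j : Z ⟶ Y)
    [IsClosedImmersion i] [IsClosedImmersion j] (h : Set.range i = Set.range j)
    (q : Y ⟶ Spec (CommRingCat.of k)) (hs : Smooth (j ≫ q)) : Smooth (i ≫ q) := by
  obtain ⟨φ, hφ⟩ := exists_iso_of_range_eq i j h
  rw [← hφ, Category.assoc]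
  infer_instance

end Components

/-! ### Normal crossing families and the local structure of their faces -/

section Family

variable {ι : Type*}

/-- The intersection of the supports of the members of `J`. -/
def face (x : ι → PseudoDivisor Y) (J : Finset ι) : Closeds Y := ⨅ i ∈ J, (x i).support

theorem mem_face {x : ι → PseudoDivisor Y} {J : Finset ι} {y : Y} :
    y ∈ face x J ↔ ∀ i ∈ J, y ∈ (x i).support := by
  simp [face]

/-- A family of effective divisors with simple normal crossings; its members need not be
irreducible. -/
structure SNCFamily (q : Y ⟶ Spec (CommRingCat.of k)) (x : ι → PseudoDivisor Y) : Prop where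
  regular : ∀ y : Y, IsRegularLocalRing (Y.presheaf.stalk y)
  indep : ∀ (J : Finset ι) (y : Y), y ∈ face x J → IndepModSq (fun i : J => (x i).eqn y)
  smooth_face : ∀ J : Finset ι, J.Nonempty → ∀ F ∈ components (face x J), Smooth (redι F ≫ q)

variable {q : Y ⟶ Spec (CommRingCat.of k)} {x : ι → PseudoDivisor Y}

/-- The ideal of a face in the local ring at `y`. -/
def faceIdeal (x : ι → PseudoDivisor Y) (J : Finset ι) (y : Y) : Ideal (Y.presheaf.stalk y) :=
  Ideal.span (Set.range fun i : J => (x i).eqn y)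

theorem faceIdeal_le_primeOf {J : Finset ι} {ξ y : Y} (h : ξ ⤳ y) :
    faceIdeal x J y ≤ primeOf h ↔ ξ ∈ face x J := by
  rw [faceIdeal, Ideal.span_le, mem_face]
  constructor
  · intro H i hi
    exact ((x i).eqn_mem_primeOf h).1 (H ⟨⟨i, hi⟩, rfl⟩)
  · rintro H _ ⟨⟨i, hi⟩, rfl⟩
    exact ((x i).eqn_mem_primeOf h).2 (H i hi)

theorem fromSpecStalk_primeOf {ξ y : Y} (h : ξ ⤳ y) :
    Y.fromSpecStalk y (⟨primeOf h, isPrime_primeOf h⟩ : PrimeSpectrum _) = ξ :=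
  (congrArg (fun φ : Spec (Y.presheaf.stalk ξ) ⟶ Y => φ
      (IsLocalRing.closedPoint (Y.presheaf.stalk ξ)))
    (Scheme.SpecMap_stalkSpecializes_fromSpecStalk h)).trans Scheme.fromSpecStalk_closedPoint

theorem specializes_of_primeOf_le {ζ ξ y : Y} (hζ : ζ ⤳ y) (hξ : ξ ⤳ y)
    (h : primeOf hζ ≤ primeOf hξ) : ζ ⤳ ξ := by
  have h1 : (⟨primeOf hζ, isPrime_primeOf hζ⟩ : PrimeSpectrum (Y.presheaf.stalk y)) ⤳
      ⟨primeOf hξ, isPrime_primeOf hξ⟩ := (PrimeSpectrum.le_iff_specializes _ _).1 h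
  have h2 := h1.map (Y.fromSpecStalk y).continuous
  rwa [fromSpecStalk_primeOf, fromSpecStalk_primeOf] at h2

theorem primeOf_le_of_specializes {ζ ξ y : Y} (hζ : ζ ⤳ y) (hξ : ξ ⤳ y) (h : ζ ⤳ ξ) :
    primeOf hζ ≤ primeOf hξ := by
  intro a ha
  rw [mem_primeOf] at ha ⊢
  have e : Y.presheaf.stalkSpecializes hζ a =
      Y.presheaf.stalkSpecializes h (Y.presheaf.stalkSpecializes hξ a) := by
    have := TopCat.Presheaf.stalkSpecializes_comp Y.presheaf h hξ
    exact (congrArg (fun φ => φ.hom a) this).symm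
  by_contra hu
  have hu' : IsUnit (Y.presheaf.stalkSpecializes hξ a) := by simpa using hu
  rw [e] at ha
  exact (IsLocalRing.mem_maximalIdeal _).1 ha (hu'.map (Y.presheaf.stalkSpecializes h).hom)

namespace SNCFamily

theorem isPrime_faceIdeal (hx : SNCFamily q x) {J : Finset ι} {y : Y} (hy : y ∈ face x J) :
    (faceIdeal x J y).IsPrime :=
  have := hx.regular y
  (hx.indep J y hy).isPrime_span

/-- Part of a regular system of parameters generates a prime ideal. The corresponding generization
of `y` is generic for the face near `y`, so a face is locally irreducible. -/
theorem exists_generic (hx : SNCFamily q x) {J : Finset ι} {y : Y} (hy : y ∈ face x J) :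
    ∃ (ζ : Y) (h : ζ ⤳ y), primeOf h = faceIdeal x J y ∧ ζ ∈ face x J ∧
      ∀ ξ ∈ face x J, ξ ⤳ y → ζ ⤳ ξ := by
  have := hx.isPrime_faceIdeal hy
  obtain ⟨ζ, h, e⟩ := exists_primeOf_eq y (faceIdeal x J y)
  refine ⟨ζ, h, e, (faceIdeal_le_primeOf h).1 e.ge, fun ξ hξ hξy => ?_⟩
  exact specializes_of_primeOf_le h hξy (e.trans_le ((faceIdeal_le_primeOf hξy).2 hξ))

/-- By local irreducibility the generic point of `F` is the generic point of the face near `y`, and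
every generization of `y` in the face specializes from it. -/
theorem mem_component_of_specializes (hx : SNCFamily q x) {J : Finset ι} {F : Closeds Y}
    (hF : F ∈ components (face x J)) {y ξ : Y} (hy : y ∈ F) (hξ : ξ ∈ face x J) (h : ξ ⤳ y) :
    ξ ∈ F := by
  obtain ⟨ζ, hζy, -, hζ, hgen⟩ := hx.exists_generic (hF.1.2 hy)
  obtain ⟨η, hη, hηgen⟩ := RefinedCobordism.exists_generic F hF.1.1
  have h1 : F ≤ pointClosure ζ := fun z hz => mem_pointClosure.2
    ((hgen η (hF.1.2 hη) (hηgen y hy)).trans (hηgen z hz))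
  have h2 := hF.2 (y := pointClosure ζ) ⟨isIrreducible_pointClosure ζ, fun z hz =>
    mem_closeds_of_specializes (mem_pointClosure.1 hz) hζ⟩ h1
  exact h2 (mem_pointClosure.2 (hgen ξ hξ h))

theorem component_eq (hx : SNCFamily q x) {J : Finset ι} {F F' : Closeds Y}
    (hF : F ∈ components (face x J)) (hF' : F' ∈ components (face x J)) {y : Y} (hy : y ∈ F)
    (hy' : y ∈ F') : F = F' := by
  have key : ∀ {F F' : Closeds Y}, F ∈ components (face x J) → F' ∈ components (face x J) →
      y ∈ F → y ∈ F' → F ≤ F' := by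
    intro F F' hF hF' hy hy'
    obtain ⟨η, hη, hηgen⟩ := RefinedCobordism.exists_generic F hF.1.1
    have := hx.mem_component_of_specializes hF' hy' (hF.1.2 hη) (hηgen y hy)
    exact fun z hz => mem_closeds_of_specializes (hηgen z hz) this
  exact le_antisymm (key hF hF' hy hy') (key hF' hF hy' hy)

theorem exists_component (hx : SNCFamily q x) {J : Finset ι} {y : Y} (hy : y ∈ face x J) :
    ∃ F ∈ components (face x J), y ∈ F := by
  obtain ⟨ζ, hζy, -, hζ, hgen⟩ := hx.exists_generic hy
  refine ⟨pointClosure ζ, ⟨⟨isIrreducible_pointClosure ζ, fun z hz =>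
    mem_closeds_of_specializes (mem_pointClosure.1 hz) hζ⟩, fun F' hF' hle => ?_⟩,
    mem_pointClosure.2 hζy⟩
  obtain ⟨η, hη, hηgen⟩ := RefinedCobordism.exists_generic F' hF'.1
  exact fun z hz => mem_pointClosure.2
    ((hgen η (hF'.2 hη) (hηgen y (hle (mem_pointClosure.2 hζy)))).trans (hηgen z hz))

theorem isDomain (hx : SNCFamily q x) (y : Y) : IsDomain (Y.presheaf.stalk y) :=
  have := hx.regular y
  inferInstance

theorem eqn_notMem_sq (hx : SNCFamily q x) (l : ι) {y : Y} (hy : y ∈ (x l).support) :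
    (x l).eqn y ∉ IsLocalRing.maximalIdeal (Y.presheaf.stalk y) ^ 2 :=
  (hx.indep {l} y (mem_face.2 (by simpa using hy))).notMem_sq ⟨l, Finset.mem_singleton_self l⟩

theorem prime_eqn (hx : SNCFamily q x) (l : ι) {y : Y} (hy : y ∈ (x l).support) :
    Prime ((x l).eqn y) :=
  have := hx.regular y
  prime_of_notMem_sq hy (hx.eqn_notMem_sq l hy)

theorem eqn_ne_zero (hx : SNCFamily q x) (l : ι) (y : Y) : (x l).eqn y ≠ 0 := by
  by_cases hy : y ∈ (x l).support
  · exact (hx.prime_eqn l hy).ne_zero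
  · have : IsUnit ((x l).eqn y) := by simpa [PseudoDivisor.mem_support_iff] using hy
    have := hx.isDomain y
    exact IsUnit.ne_zero ‹_›

theorem congr {x' : ι → PseudoDivisor Y} (hx : SNCFamily q x)
    (h : ∀ l y, (x' l).idealAt y = (x l).idealAt y) : SNCFamily q x' := by
  have hface : ∀ J, face x' J = face x J := fun J => by
    simp only [face, PseudoDivisor.support_eq_of_idealAt (h _)]
  refine ⟨hx.regular, fun J y hy => ?_, fun J hJ => hface J ▸ hx.smooth_face J hJ⟩
  have := hx.isDomain y
  exact (hx.indep J y (hface J ▸ hy)).of_associated fun i =>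
    ((PseudoDivisor.idealAt_eq_iff _ _ y).1 (h i y)).symm

theorem comp {κ : Type*} (hx : SNCFamily q x) (f : κ → ι) (hf : Function.Injective f) :
    SNCFamily q (x ∘ f) := by
  have hface : ∀ J : Finset κ, face (x ∘ f) J = face x (J.map ⟨f, hf⟩) := fun J => by
    ext y
    change y ∈ face (x ∘ f) J ↔ y ∈ face x (J.map ⟨f, hf⟩)
    simp [mem_face]
  refine ⟨hx.regular, fun J y hy => ?_, fun J hJ => hface J ▸ hx.smooth_face _ (hJ.map)⟩
  exact (hx.indep (J.map ⟨f, hf⟩) y (hface J ▸ hy)).comp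
    (fun i : J => ⟨f i, Finset.mem_map_of_mem ⟨f, hf⟩ i.2⟩)
    (fun i j hij => Subtype.ext (hf (congrArg Subtype.val hij)))

/-- Distinct members through a point have independent cotangent classes, so they cannot have
associated equations. -/
theorem not_associated (hx : SNCFamily q x) {l l' : ι} {y : Y} (hy : y ∈ (x l).support)
    (hy' : y ∈ (x l').support) (h : Associated ((x l).eqn y) ((x l').eqn y)) : l = l' := by
  classical
  by_contra hne
  obtain ⟨v, hv⟩ := h
  have hi := (hx.indep {l, l'} y (mem_face.2 (by simp [hy, hy']))).comp
    (fun b : Bool => if b then ⟨l, by simp⟩ else ⟨l', by simp⟩) (by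
      intro a b; cases a <;> cases b <;> simp [hne, Ne.symm hne])
  -- If the second equation is `v` times the first, this relation holds with the unit coefficient
  -- -1.
  have := hi.indep (fun b => if b then v else -1) (by
    simp only [Fintype.sum_bool, Function.comp, if_true, Bool.false_eq_true, if_false, ← hv]
    have : (v : Y.presheaf.stalk y) * (x l).eqn y + -1 * ((x l).eqn y * v) = 0 := by ring
    rw [this]
    exact zero_mem _) false
  simp at this

end SNCFamily

theorem SNCDecomposition.family {E : PseudoDivisor Y} (σ : SNCDecomposition q E)
    (hreg : ∀ y : Y, IsRegularLocalRing (Y.presheaf.stalk y)) : SNCFamily q σ.comp := by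
  classical
  refine ⟨hreg, fun J y hy => ?_, σ.smooth_face⟩
  have h := (indepModSq_iff (fun i : {i // y ∈ (σ.comp i).support} => (σ.comp i).eqn y)
    fun i => i.2).2 (σ.transversal y)
  exact h.comp (fun i : J => ⟨i, mem_face.1 hy i i.2⟩)
    (fun i j hij => Subtype.ext (congrArg (fun a => a.1) hij))

end Family

end

/-! ### Restriction to faces and refinement to irreducible members -/

section

variable {k : Type u} [Field k] {P X Y Z G : Scheme.{u}} {ι : Type*}
  {q : Y ⟶ Spec (CommRingCat.of k)} {x : ι → PseudoDivisor Y}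

theorem face_singleton (x : ι → PseudoDivisor Y) (l : ι) : face x {l} = (x l).support := by
  ext y
  change y ∈ face x {l} ↔ y ∈ (x l).support
  simp [mem_face]

/-- `i` is a closed immersion of a reduced scheme onto a union of connected components of a face. -/
structure IsFaceImmersion (x : ι → PseudoDivisor Y) (J : Finset ι) (i : G ⟶ Y) : Prop where
  closed : IsClosedImmersion i
  reduced : IsReduced G
  mem : ∀ g, i g ∈ face x J
  stable : ∀ g, ∀ ξ ∈ face x J, ξ ⤳ i g → ξ ∈ Set.range i

theorem SNCFamily.isFaceImmersion (hx : SNCFamily q x) {J : Finset ι} {F : Closeds Y}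
    (hF : F ∈ components (face x J)) (i : G ⟶ Y) [IsClosedImmersion i] [IsReduced G]
    (hi : Set.range i = F) : IsFaceImmersion x J i := by
  have hm : ∀ g, i g ∈ F := fun g => (hi ▸ Set.mem_range_self g : i g ∈ (F : Set Y))
  refine ⟨‹_›, ‹_›, fun g => hF.1.2 (hm g), fun g ξ hξ h => ?_⟩
  rw [hi]
  exact hx.mem_component_of_specializes hF (hm g) hξ h

theorem isFaceImmersion_of_range_eq_face {J : Finset ι} (i : G ⟶ Y) [IsClosedImmersion i]
    [IsReduced G] (hi : Set.range i = face x J) : IsFaceImmersion x J i :=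
  ⟨‹_›, ‹_›, fun g => (hi ▸ Set.mem_range_self g : i g ∈ (face x J : Set Y)),
    fun _ _ hξ _ => hi ▸ hξ⟩

theorem eqn_pullback_eq_zero [IsReduced G] (D : PseudoDivisor Y) (i : G ⟶ Y)
    (h : ∀ g, i g ∈ D.support) (g : G) : i.stalkMap g (D.eqn (i g)) = 0 := by
  have h1 : (D.pullback i).support = ⊤ := by
    rw [eq_top_iff]
    exact fun g _ => (D.mem_support_pullback i g).2 (h g)
  have h2 := (D.pullback i).idealAt_eq_bot h1 g
  rwa [PseudoDivisor.idealAt, Ideal.span_singleton_eq_bot, D.eqn_pullback] at h2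

namespace IsFaceImmersion

variable {J : Finset ι} {i : G ⟶ Y}

/-- A germ vanishing on `G` lies in the prime of the generic point of the face through `i g`, which
is the face ideal. Conversely the equations of the face vanish on the reduced scheme `G`. -/
theorem ker_stalkMap (h : IsFaceImmersion x J i) (hx : SNCFamily q x) (g : G) :
    RingHom.ker (i.stalkMap g).hom = faceIdeal x J (i g) := by
  have := h.reduced
  have := h.closed
  refine le_antisymm (fun a ha => ?_) ?_
  · obtain ⟨ζ, hζ, e, hζf, -⟩ := hx.exists_generic (h.mem g)
    obtain ⟨ζ', rfl⟩ := h.stable g ζ hζf hζ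
    have hζ' : ζ' ⤳ g := i.isClosedEmbedding.isInducing.specializes_iff.1 hζ
    rw [← e]
    exact mem_primeOf_of_stalkMap_eq_zero i hζ' a ha
  · rw [faceIdeal, Ideal.span_le]
    rintro _ ⟨⟨j, hj⟩, rfl⟩
    exact eqn_pullback_eq_zero (x j) i (fun g => mem_face.1 (h.mem g) j hj) g

theorem stalkMap_surjective (h : IsFaceImmersion x J i) (g : G) :
    Function.Surjective (i.stalkMap g).hom :=
  have := h.closed
  SurjectiveOnStalks.stalkMap_surjective i g

/-- The members of the family not containing the face restrict to a family with simple normal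
crossings. -/
theorem restrict (h : IsFaceImmersion x J i) (hx : SNCFamily q x) :
    SNCFamily (i ≫ q) (fun l : {l // l ∉ J} => (x l).pullback i) := by
  classical
  have := h.closed
  have := h.reduced
  have hface : ∀ (K : Finset {l // l ∉ J}) (g : G),
      g ∈ face (fun l : {l // l ∉ J} => (x l).pullback i) K ↔
      i g ∈ face x (J ∪ K.map (Function.Embedding.subtype _)) := by
    intro K g
    simp only [mem_face, PseudoDivisor.mem_support_pullback, Finset.mem_union, Finset.mem_map,
      Function.Embedding.subtype_apply]
    constructor
    · rintro H l (hl | ⟨l, hl, rfl⟩)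
      · exact mem_face.1 (h.mem g) l hl
      · exact H l hl
    · exact fun H l hl => H l (Or.inr ⟨l, hl, rfl⟩)
  refine ⟨fun g => ?_, fun K g hg => ?_, fun K hK F hF => ?_⟩
  · have := hx.regular (i g)
    have h1 := isRegularLocalRing_quotient (hx.indep J (i g) (h.mem g))
    have e : Ideal.span (Set.range fun j : J => (x j).eqn (i g)) =
        RingHom.ker (i.stalkMap g).hom := (h.ker_stalkMap hx g).symm
    exact IsRegularLocalRing.of_ringEquiv ((Ideal.quotEquivOfEq e).trans
      (RingHom.quotientKerEquivOfSurjective (h.stalkMap_surjective g)))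
  -- The members of `J` and `K` are jointly independent in the ambient local ring; those of `K` stay
  -- independent modulo those of `J`.
  · have hi := (hx.indep _ (i g) ((hface K g).1 hg)).comp
      (Sum.elim (fun j : J => ⟨j.1, Finset.mem_union_left _ j.2⟩)
        (fun l : K => ⟨l.1.1, Finset.mem_union_right _
          (Finset.mem_map_of_mem (Function.Embedding.subtype _) l.2)⟩)) (by
        rintro (a | a) (b | b) hab
        · have e : (a.1 : ι) = b.1 := (Subtype.mk.injEq _ _ _ _).mp hab
          exact congrArg Sum.inl (Subtype.ext e)
        · exact absurd (congrArg Subtype.val hab ▸ a.2 : b.1.1 ∈ J) b.1.2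
        · exact absurd ((congrArg Subtype.val hab).symm ▸ b.2 : a.1.1 ∈ J) a.1.2
        · have e : (a.1.1 : ι) = b.1.1 := (Subtype.mk.injEq _ _ _ _).mp hab
          exact congrArg Sum.inr (Subtype.ext (Subtype.ext e)))
    have hi' : IndepModSq (Sum.elim (fun j : J => (x j).eqn (i g))
        (fun l : K => (x l.1.1).eqn (i g))) := by
      convert hi using 1
      ext (a | a) <;> rfl
    have := hi'.map_of_ker (i.stalkMap g).hom (h.stalkMap_surjective g) (h.ker_stalkMap hx g)
    convert this using 1
    ext l
    exact (x l.1.1).eqn_pullback i g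
  -- A face of the restricted family is a union of connected components of the ambient face for `J ∪
  -- K`, so smoothness is inherited.
  · have hF' : imageClosed i F ∈ components
        (face x (J ∪ K.map (Function.Embedding.subtype _))) := by
      refine mem_components_of_generization_stable ?_ ?_ ((imageClosed_mem_components i).2 hF)
      · rintro _ ⟨g, hg, rfl⟩
        exact (hface K g).1 hg
      · rintro _ ⟨g, hg, rfl⟩ ξ hξ hs
        obtain ⟨g', rfl⟩ := h.stable g ξ (mem_face.2 fun l hl =>
          mem_face.1 hξ l (Finset.mem_union_left _ hl)) hs
        exact ⟨g', (hface K g').2 hξ, rfl⟩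
    have hs := hx.smooth_face _ (Finset.Nonempty.inr hK.map) _ hF'
    have := smooth_of_range_eq (redι F ≫ i) (redι (imageClosed i F))
      (by rw [range_redι_comp, range_redι]) q hs
    rwa [Category.assoc] at this

end IsFaceImmersion

section Refinement

namespace SNCFamily

theorem component_support_eq (hx : SNCFamily q x) (l : ι) {F F' : Closeds Y}
    (hF : F ∈ components (x l).support) (hF' : F' ∈ components (x l).support) {y : Y} (hy : y ∈ F)
    (hy' : y ∈ F') : F = F' := by
  have : face x {l} = (x l).support := face_singleton _ _
  exact hx.component_eq (this ▸ hF) (this ▸ hF') hy hy'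

theorem exists_component_support (hx : SNCFamily q x) (l : ι) {y : Y} (hy : y ∈ (x l).support) :
    ∃ F ∈ components (x l).support, y ∈ F := by
  have : face x {l} = (x l).support := face_singleton _ _
  rw [← this] at hy ⊢
  exact hx.exists_component hy

/-- The divisor supported on a connected component of a member of the family. -/
theorem exists_componentDivisor [NoetherianSpace Y] (hx : SNCFamily q x) (l : ι) (F : Closeds Y)
    (hF : F ∈ components (x l).support) :
    ∃ D : PseudoDivisor Y, (∀ y ∈ F, D.idealAt y = (x l).idealAt y) ∧
      ∀ y ∉ F, D.idealAt y = ⊤ := by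
  classical
  obtain ⟨D, hD⟩ := PseudoDivisor.exists_idealAt_eq hx.isDomain
    (fun y => if y ∈ F then (x l).idealAt y else ⊤) (fun y => by
    by_cases hy : y ∈ F
    -- Away from the finitely many other components, the equation of the member cuts out exactly
    -- `F`.
    · let R : Set Y := ⋃ F' ∈ components (x l).support \ {F}, (F' : Set Y)
      have hR : IsClosed R :=
        ((finite_components (x l).support).subset Set.sdiff_subset).isClosed_biUnion
          fun F' _ => F'.isClosed
      let U : Y.Opens := (x l).bundle.U y ⊓ ⟨Rᶜ, hR.isOpen_compl⟩
      have hyR : y ∉ R := by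
        simp only [R, Set.mem_iUnion, not_exists]
        exact fun F' hF' hyF' => hF'.2 (hx.component_support_eq l hF'.1 hF hyF' hy)
      refine ⟨U, ⟨(x l).bundle.mem y, hyR⟩,
        Y.presheaf.map (homOfLE (inf_le_left : U ≤ _)).op ((x l).s y), fun p hp => ?_⟩
      rw [germ_map, ← (x l).idealAt_eq_span_germ y p hp.1]
      refine ⟨?_, ((x l).associated_eqn y p hp.1).ne_zero_iff.1 (hx.eqn_ne_zero l p)⟩
      by_cases hpF : p ∈ F
      · rw [if_pos hpF]
      · rw [if_neg hpF]
        by_contra hne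
        obtain ⟨F', hF', hpF'⟩ := hx.exists_component_support l
          (((x l).mem_support_iff_idealAt p).2 hne)
        exact hp.2 (Set.mem_biUnion (x := F') ⟨hF', fun e => hpF (e ▸ hpF')⟩ hpF')
    · refine ⟨⟨(F : Set Y)ᶜ, F.isClosed.isOpen_compl⟩, hy, 1, fun p hp => ?_⟩
      have := hx.isDomain p
      have h1 : Y.presheaf.germ ⟨(F : Set Y)ᶜ, F.isClosed.isOpen_compl⟩ p hp 1 = 1 := map_one _
      rw [h1, if_neg (show p ∉ F from hp)]
      exact ⟨Ideal.span_singleton_one, one_ne_zero⟩)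
  exact ⟨D, fun y hy => (hD y).trans (if_pos hy), fun y hy => (hD y).trans (if_neg hy)⟩

/-- Every family with simple normal crossings can be refined to one with irreducible members. -/
theorem exists_refinement [NoetherianSpace Y] [Finite ι] (hx : SNCFamily q x) :
    ∃ (κ : Type (max u_1 u)) (_ : Fintype κ) (z : κ → PseudoDivisor Y) (π : κ → ι),
      SNCFamily q z ∧ (∀ c, IsIrreducible ((z c).support : Set Y)) ∧
      ∀ [Fintype ι] (a : ι → ℕ) (y : Y),
        ∏ l, (x l).idealAt y ^ a l = ∏ c, (z c).idealAt y ^ a (π c) := by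
  classical
  have (l : ι) : Finite (components (x l).support) := finite_components _
  have (l : ι) : Fintype (components (x l).support) := Fintype.ofFinite _
  let _ : Fintype ι := Fintype.ofFinite ι
  choose z hz1 hz2 using fun c : Σ l, components (x l).support =>
    hx.exists_componentDivisor c.1 c.2.1 c.2.2
  have hsupp : ∀ c, (z c).support = c.2.1 := by
    intro c
    ext y
    change y ∈ (z c).support ↔ y ∈ c.2.1
    rw [PseudoDivisor.mem_support_iff_idealAt]
    by_cases hy : y ∈ c.2.1
    · simp only [hy, iff_true]
      rw [hz1 c y hy, ← PseudoDivisor.mem_support_iff_idealAt]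
      exact c.2.2.1.2 hy
    · simp [hz2 c y hy, hy]
  -- Components of the same member are disjoint, so at most one component of each member passes
  -- through a point and independence is inherited from `x`.
  have hinj : ∀ c c' (y : Y), y ∈ (z c).support → y ∈ (z c').support → c.1 = c'.1 → c = c' := by
    rintro ⟨l, F, hF⟩ ⟨l', F', hF'⟩ y hy hy' (rfl : l = l')
    rw [hsupp] at hy hy'
    congr
    exact hx.component_support_eq l hF hF' hy hy'
  have hle : ∀ c, (z c).support ≤ (x c.1).support := fun c => hsupp c ▸ c.2.2.1.2
  have hmem : ∀ J y, y ∈ face z J → y ∈ face x (J.image Sigma.fst) := by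
    intro J y hy
    rw [mem_face]
    intro l hl
    obtain ⟨c, hc, rfl⟩ := Finset.mem_image.1 hl
    exact hle c (mem_face.1 hy c hc)
  refine ⟨Σ l, components (x l).support, inferInstance, z, Sigma.fst,
    ⟨hx.regular, fun J y hy => ?_, fun J hJ F hF => ?_⟩, fun c => ?_, fun {I} a y => ?_⟩
  · have := hx.isDomain y
    have h1 := (hx.indep _ y (hmem J y hy)).comp
      (fun c : J => ⟨c.1.1, Finset.mem_image_of_mem _ c.2⟩) (fun c c' h => Subtype.ext
        (hinj _ _ y (mem_face.1 hy _ c.2) (mem_face.1 hy _ c'.2) (congrArg Subtype.val h)))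
    refine h1.of_associated fun c => ?_
    refine (PseudoDivisor.idealAt_eq_iff _ _ y).1 (hz1 c.1 y ?_).symm
    rw [← hsupp]
    exact mem_face.1 hy _ c.2
  · refine hx.smooth_face _ (hJ.image Sigma.fst) F
      (mem_components_of_generization_stable (K := face z J) (fun y => hmem J y) ?_ hF)
    intro y hy ξ hξ h
    rw [mem_face]
    intro c hc
    have hyc : y ∈ (z c).support := mem_face.1 hy c hc
    rw [hsupp] at hyc ⊢
    have e : face x {c.1} = (x c.1).support := face_singleton _ _
    exact hx.mem_component_of_specializes (J := {c.1}) (by rw [e]; exact c.2.2) hyc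
      (e ▸ mem_face.1 hξ c.1 (Finset.mem_image_of_mem _ hc)) h
  · rw [hsupp]
    exact c.2.2.1.1
  · obtain rfl : I = Fintype.ofFinite ι := Subsingleton.elim _ _
    rw [Fintype.prod_sigma]
    refine Finset.prod_congr rfl fun l _ => ?_
    change _ = ∏ F : components (x l).support, (z ⟨l, F⟩).idealAt y ^ a l
    rw [Finset.prod_pow]
    congr 1
    by_cases hy : y ∈ (x l).support
    · obtain ⟨F, hF, hyF⟩ := hx.exists_component_support l hy
      rw [Finset.prod_eq_single ⟨F, hF⟩, hz1 ⟨l, F, hF⟩ y hyF]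
      · intro F' _ hne
        rw [hz2, Ideal.one_eq_top]
        exact fun hyF' => hne (Subtype.ext (hx.component_support_eq l F'.2 hF hyF' hyF))
      · simp
    · have e : (x l).idealAt y = ⊤ := by
        by_contra hne
        exact hy (((x l).mem_support_iff_idealAt y).2 hne)
      rw [e, ← Ideal.one_eq_top, Finset.prod_eq_one]
      intro F _
      rw [hz2, Ideal.one_eq_top]
      exact fun hyF => hy (F.2.1.2 hyF)

theorem isSNC_of_isIrreducible [Fintype ι] (hx : SNCFamily q x)
    (hirr : ∀ l, IsIrreducible ((x l).support : Set Y)) {E : PseudoDivisor Y} (a : ι → ℕ)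
    (hE : ∀ y, E.idealAt y = ∏ l, (x l).idealAt y ^ a l) : IsSNC q E := by
  classical
  -- A decomposition has positive multiplicities only, so members with exponent zero are discarded.
  let e := (Fintype.equivFin {l // 0 < a l}).symm
  have hf : Function.Injective (fun i => (e i).1) := Subtype.val_injective.comp e.injective
  have hx' := hx.comp _ hf
  refine ⟨⟨_, fun i => x (e i).1, fun i => a (e i).1, fun i => (e i).2, fun i => hirr _,
    fun y => ?_, fun y => ?_, hx'.smooth_face⟩⟩
  · rw [hE, e.prod_comp (fun l : {l // 0 < a l} => (x l.1).idealAt y ^ a l.1)]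
    rw [← Finset.prod_subtype (Finset.univ.filter fun l => 0 < a l) (by simp)
      (fun l => (x l).idealAt y ^ a l)]
    refine (Finset.prod_filter_of_ne fun l _ hne => ?_).symm
    by_contra h0
    exact hne (by rw [Nat.eq_zero_of_not_pos h0, pow_zero])
  · refine (indepModSq_iff (fun i : {i // y ∈ (x (e i).1).support} => (x (e i).1).eqn y)
      fun i => i.2).1 ?_
    refine (hx'.indep (Finset.univ.filter fun i => y ∈ (x (e i).1).support) y
      (mem_face.2 (by simp))).comp
      (fun i : {i // y ∈ (x (e i).1).support} => ⟨i.1, by simpa using i.2⟩) ?_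
    exact fun i j h => Subtype.ext (congrArg (fun a => a.1) h)

theorem isSNC [NoetherianSpace Y] [Fintype ι] (hx : SNCFamily q x) {E : PseudoDivisor Y}
    (a : ι → ℕ) (hE : ∀ y, E.idealAt y = ∏ l, (x l).idealAt y ^ a l) : IsSNC q E := by
  obtain ⟨κ, _, z, π, hz, hirr, h⟩ := hx.exists_refinement
  exact hz.isSNC_of_isIrreducible hirr (a ∘ π) fun y => (hE y).trans (h a y)

/-- An irreducible divisor that is regular at its points and contained in the union of a family of
irreducible divisors with simple normal crossings is a member of the family. -/
theorem exists_idealAt_eq (hx : SNCFamily q x)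
    (hirr : ∀ l, IsPreirreducible ((x l).support : Set Y)) {κ : Type*} {c : κ → PseudoDivisor Y}
    (hc : SNCFamily q c) (j : κ) (hj : IsIrreducible ((c j).support : Set Y))
    (hle : ∀ y ∈ (c j).support, ∃ l, y ∈ (x l).support) :
    ∃ l, ∀ y, (c j).idealAt y = (x l).idealAt y := by
  obtain ⟨η, hη, hηgen⟩ := RefinedCobordism.exists_generic _ hj
  obtain ⟨l, hl⟩ := hle η hη
  -- The equation of `x l` vanishes at the generic point of `c j`, so it is divisible by the
  -- equation of `c j`; both are prime.
  have hassoc : ∀ y ∈ (c j).support, Associated ((c j).eqn y) ((x l).eqn y) := by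
    intro y hy
    have hyl : y ∈ (x l).support := mem_closeds_of_specializes (hηgen y hy) hl
    have := hx.isDomain y
    have e : face c {j} = (c j).support := face_singleton _ _
    obtain ⟨ζ, hζy, h1, hζ, -⟩ := hc.exists_generic (J := {j}) (e ▸ hy)
    have h2 := primeOf_le_of_specializes (hηgen y hy) hζy (hηgen ζ (e ▸ hζ))
    have h3 : (x l).eqn y ∈ faceIdeal c {j} y :=
      h1 ▸ h2 (((x l).eqn_mem_primeOf (hηgen y hy)).2 hl)
    have h4 : (c j).eqn y ∣ (x l).eqn y := by
      have : faceIdeal c {j} y = Ideal.span {(c j).eqn y} := by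
        rw [faceIdeal]
        congr 1
        ext a
        simp [eq_comm]
      rw [this] at h3
      exact Ideal.mem_span_singleton.1 h3
    exact (hc.prime_eqn j hy).irreducible.associated_of_dvd (hx.prime_eqn l hyl).irreducible h4
  refine ⟨l, fun y => ?_⟩
  have := hx.isDomain y
  by_cases hy : y ∈ (c j).support
  · exact (PseudoDivisor.idealAt_eq_iff _ _ y).2 (hassoc y hy)
  -- The generic point of `x l` specializes to `η`, where the two equations are associated; so it
  -- lies on `c j`, and `x l` has no points off `c j`.
  · have hyl : y ∉ (x l).support := by
      intro hyl
      obtain ⟨ζ, hζ, hζgen⟩ := RefinedCobordism.exists_generic (x l).support ⟨⟨y, hyl⟩, hirr l⟩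
      have h1 : η ∈ (x l).support := hl
      have h2 := ((x l).eqn_mem_primeOf (hζgen η h1)).2 hζ
      have h3 := ((c j).eqn_mem_primeOf (hζgen η h1)).1
        ((Ideal.mem_iff_of_associated (hassoc η hη)).2 h2)
      exact hy (mem_closeds_of_specializes (hζgen y hyl) h3)
    rw [not_not.1 (mt ((c j).mem_support_iff_idealAt y).2 hy),
      not_not.1 (mt ((x l).mem_support_iff_idealAt y).2 hyl)]

end SNCFamily

theorem mem_support_iff_of_prod {E : PseudoDivisor Y} {S : Finset ι} {a : ι → ℕ} {y : Y}
    (hE : E.idealAt y = ∏ l ∈ S, (x l).idealAt y ^ a l) :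
    y ∈ E.support ↔ ∃ l ∈ S, 0 < a l ∧ y ∈ (x l).support := by
  rw [PseudoDivisor.mem_support_iff_idealAt, hE]
  constructor
  · contrapose!
    intro h
    rw [← Ideal.one_eq_top]
    refine Finset.prod_eq_one fun l hl => ?_
    rcases Nat.eq_zero_or_pos (a l) with h0 | h0
    · rw [h0, pow_zero]
    · rw [not_not.1 (mt ((x l).mem_support_iff_idealAt y).2 (h l hl h0)), ← Ideal.one_eq_top,
        one_pow]
  · rintro ⟨l, hl, h0, hy⟩ htop
    rw [PseudoDivisor.mem_support_iff_idealAt] at hy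
    apply hy
    rw [eq_top_iff, ← htop]
    exact (Ideal.prod_le_inf.trans (Finset.inf_le hl)).trans (Ideal.pow_le_self h0.ne')

/-- The components of a divisor supported on a family of irreducible divisors with simple normal
crossings are members of the family. -/
theorem SNCFamily.exists_matching (hx : SNCFamily q x)
    (hirr : ∀ l, IsPreirreducible ((x l).support : Set Y)) {C : PseudoDivisor Y}
    (σ : SNCDecomposition q C) (hle : ∀ y ∈ C.support, ∃ l, y ∈ (x l).support) :
    ∃ l : Fin σ.m → ι, Function.Injective l ∧
      ∀ j y, (σ.comp j).idealAt y = (x (l j)).idealAt y := by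
  have hσ := σ.family hx.regular
  choose l hl using fun j => hx.exists_idealAt_eq hirr hσ j (σ.irreducible j) fun y hy =>
    hle y ((mem_support_iff_of_prod (σ.ideal_eq y)).2 ⟨j, Finset.mem_univ j, σ.mult_pos j, hy⟩)
  refine ⟨l, fun j j' h => ?_, hl⟩
  have e : ∀ y, (σ.comp j).idealAt y = (σ.comp j').idealAt y := fun y => by rw [hl, hl, h]
  obtain ⟨y, hy⟩ := (σ.irreducible j).nonempty
  have := hx.isDomain y
  exact hσ.not_associated hy (PseudoDivisor.support_eq_of_idealAt e ▸ hy)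
    ((PseudoDivisor.idealAt_eq_iff _ _ y).1 (e y))

theorem SNCFamily.exists_exponents [Fintype ι] (hx : SNCFamily q x)
    (hirr : ∀ l, IsPreirreducible ((x l).support : Set Y)) {C : PseudoDivisor Y} (hC : IsSNC q C)
    (hle : ∀ y ∈ C.support, ∃ l, y ∈ (x l).support) :
    ∃ a : ι → ℕ, ∀ y, C.idealAt y = ∏ l, (x l).idealAt y ^ a l := by
  classical
  obtain ⟨σ⟩ := hC
  obtain ⟨l, hinj, hl⟩ := hx.exists_matching hirr σ hle
  -- The exponent of a member is the multiplicity of the component matched with it, and zero if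
  -- there is none.
  refine ⟨fun i => ∑ j with l j = i, σ.mult j, fun y => ?_⟩
  rw [σ.ideal_eq y]
  simp_rw [← Finset.prod_pow_eq_pow_sum]
  rw [← Finset.prod_fiberwise (s := Finset.univ) (g := l)]
  refine Finset.prod_congr rfl fun i _ => Finset.prod_congr rfl fun j hj => ?_
  rw [hl, (Finset.mem_filter.1 hj).2]

end Refinement

end

/-! ### Admissibility and good position through monomials -/

section

variable {k : Type u} [Field k] {P X Y Z G : Scheme.{u}} {ι : Type*}
  {q : Y ⟶ Spec (CommRingCat.of k)} {x : ι → PseudoDivisor Y} {r : Y ⟶ P}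
  {D : List (PseudoDivisor P)}

theorem interIdealAt_comp (D : List (PseudoDivisor P)) (r : Y ⟶ P) (i : G ⟶ Y) (g : G) :
    interIdealAt D (i ≫ r) g = (interIdealAt D r (i g)).map (i.stalkMap g).hom := by
  simp only [interIdealAt, Ideal.map_iSup]
  refine iSup_congr fun d => iSup_congr fun _ => ?_
  rw [← d.idealAt_pullback_comp, PseudoDivisor.idealAt_pullback]

theorem interIdealAt_cons (d : PseudoDivisor P) (D : List (PseudoDivisor P)) (r : Y ⟶ P) (y : Y) :
    interIdealAt (d :: D) r y = (d.pullback r).idealAt y ⊔ interIdealAt D r y := by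
  simp [interIdealAt, iSup_or, iSup_sup_eq]

theorem interIdealAt_append (D D' : List (PseudoDivisor P)) (r : Y ⟶ P) (y : Y) :
    interIdealAt (D ++ D') r y = interIdealAt D r y ⊔ interIdealAt D' r y := by
  simp [interIdealAt, iSup_or, iSup_sup_eq]

/-- Earlier divisors have full support and hence zero ideal on a reduced scheme. Up to the leading
divisor the intersection is that divisor itself, which links admissibility to good position. -/
theorem interIdealAt_take_leading [IsReduced Y] {D₁ D₂ : List (PseudoDivisor P)}
    {d : PseudoDivisor P} (hD₁ : ∀ d' ∈ D₁, (d'.pullback r).support = ⊤) (y : Y) :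
    interIdealAt ((D₁ ++ d :: D₂).take (D₁.length + 1)) r y = (d.pullback r).idealAt y := by
  have h1 : interIdealAt D₁ r y = ⊥ := by
    simp only [interIdealAt, iSup_eq_bot]
    exact fun d' hd' => (d'.pullback r).idealAt_eq_bot (hD₁ d' hd') y
  rw [List.take_append, List.take_of_length_le (Nat.le_succ _), Nat.add_sub_cancel_left,
    List.take_succ_cons, List.take_zero, interIdealAt_append, h1, bot_sup_eq, interIdealAt_cons]
  simp [interIdealAt]

variable [Fintype ι]

/-- The intersections of the initial segments of `D` are everything or are combinations of the
members of the family `x`. -/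
def IsMonomial (x : ι → PseudoDivisor Y) (r : Y ⟶ P) (D : List (PseudoDivisor P)) : Prop :=
  ∀ s : ℕ, (∀ y, interIdealAt (D.take s) r y = ⊥) ∨
    ∃ a : ι → ℕ, ∀ y, interIdealAt (D.take s) r y = ∏ l, (x l).idealAt y ^ a l

namespace IsMonomial

theorem pullback (h : IsMonomial x r D) (i : G ⟶ Y) :
    IsMonomial (fun l => (x l).pullback i) (i ≫ r) D := by
  intro s
  refine (h s).imp (fun h g => ?_) (fun ⟨a, h⟩ => ⟨a, fun g => ?_⟩)
  · rw [interIdealAt_comp, h, Ideal.map_bot]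
  · rw [interIdealAt_comp, h, ← Ideal.mapHom_apply, map_prod]
    simp_rw [map_pow, Ideal.mapHom_apply, PseudoDivisor.idealAt_pullback]

theorem congr {x' : ι → PseudoDivisor Y} (h : IsMonomial x r D)
    (e : ∀ l y, (x' l).idealAt y = (x l).idealAt y) : IsMonomial x' r D := by
  simpa only [IsMonomial, e] using h

theorem refine {κ : Type*} [Fintype κ] {z : κ → PseudoDivisor Y} (π : κ → ι)
    (h : IsMonomial x r D) (e : ∀ (a : ι → ℕ) (y : Y),
      ∏ l, (x l).idealAt y ^ a l = ∏ c, (z c).idealAt y ^ a (π c)) : IsMonomial z r D :=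
  fun s => (h s).imp id fun ⟨a, h⟩ => ⟨a ∘ π, fun y => (h y).trans (e a y)⟩

theorem tail [IsReduced Y] {d : PseudoDivisor P} (h : IsMonomial x r (d :: D))
    (hd : (d.pullback r).support = ⊤) : IsMonomial x r D := by
  intro s
  have e : ∀ y, interIdealAt ((d :: D).take (s + 1)) r y = interIdealAt (D.take s) r y := by
    intro y
    rw [List.take_succ_cons, interIdealAt_cons, (d.pullback r).idealAt_eq_bot hd y, bot_sup_eq]
  simpa only [e] using h (s + 1)

theorem isAdmissibleIrr [NoetherianSpace Y] (h : IsMonomial x r D) (hx : SNCFamily q x) :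
    IsAdmissibleIrr q r D := by
  intro s
  refine (h s).imp id fun ⟨a, ha⟩ => ?_
  obtain ⟨C, hC⟩ := PseudoDivisor.exists_idealAt_eq_prod Finset.univ x a
  exact ⟨C, hx.isSNC a hC, fun y => (ha y).trans (hC y).symm⟩

/-- The leading divisor is a monomial in the same family as `E`, so their sum is again a monomial in
a normal crossing family. -/
theorem goodPosition [NoetherianSpace Y] [IsReduced Y] (h : IsMonomial x r D)
    (hx : SNCFamily q x) {E : PseudoDivisor Y} (c : ι → ℕ)
    (hE : ∀ y, E.idealAt y = ∏ l, (x l).idealAt y ^ c l) : GoodPosition q r E D := by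
  refine ⟨hx.isSNC c hE, ?_⟩
  rintro D₁ d D₂ rfl hD₁ hd
  have e : ∀ y, interIdealAt ((D₁ ++ d :: D₂).take (D₁.length + 1)) r y =
      (d.pullback r).idealAt y := interIdealAt_take_leading hD₁
  rcases h (D₁.length + 1) with h0 | ⟨a, ha⟩
  · refine absurd ?_ hd
    rw [eq_top_iff]
    intro y _
    rw [PseudoDivisor.mem_support_iff_idealAt, ← e y, h0 y]
    exact bot_ne_top
  · refine hx.isSNC (c + a) fun y => ?_
    rw [PseudoDivisor.idealAt_add, hE, ← e, ha, ← Finset.prod_mul_distrib]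
    simp_rw [← pow_add, Pi.add_apply]

/-- A monomial involving a member of `J` vanishes on the face, which is the case of the intersection
being everything; any other monomial uses only the remaining members. -/
theorem restrict [DecidableEq ι] {J : Finset ι} {i : G ⟶ Y} (hi : IsFaceImmersion x J i)
    {r : G ⟶ P} (h : IsMonomial (fun l => (x l).pullback i) r D) :
    IsMonomial (fun l : {l // l ∉ J} => (x l).pullback i) r D := by
  have := hi.reduced
  intro s
  rcases h s with h | ⟨a, ha⟩
  · exact Or.inl h
  by_cases hJ : ∃ l ∈ J, 0 < a l
  · left
    obtain ⟨l, hl, h0⟩ := hJ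
    intro g
    rw [ha, ← Ideal.zero_eq_bot]
    refine Finset.prod_eq_zero (Finset.mem_univ l) ?_
    have : ((x l).pullback i).idealAt g = ⊥ := by
      refine PseudoDivisor.idealAt_eq_bot _ ?_ g
      rw [eq_top_iff]
      exact fun g _ => ((x l).mem_support_pullback i g).2 (mem_face.1 (hi.mem g) l hl)
    rw [this, ← Ideal.zero_eq_bot, zero_pow h0.ne']
  · right
    push Not at hJ
    refine ⟨fun l => a l, fun g => ?_⟩
    rw [ha, ← Finset.prod_subtype (Finset.univ.filter fun l => l ∉ J) (by simp)
      (fun l => ((x l).pullback i).idealAt g ^ a l)]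
    refine (Finset.prod_filter_of_ne (p := fun l => l ∉ J) fun l _ hne hl => hne ?_).symm
    rw [Nat.le_zero.1 (hJ l hl), pow_zero]

end IsMonomial

/-- From the first step on, every intersection is contained in the divisor of `d`. The normal
crossing divisors given by admissibility are thus supported on the family, and their components are
members of it. -/
theorem IsAdmissibleIrr.isMonomial {d : PseudoDivisor P} (h : IsAdmissibleIrr q r (d :: D))
    (hx : SNCFamily q x) (hirr : ∀ l, IsPreirreducible ((x l).support : Set Y))
    (hd : ∀ y ∈ (d.pullback r).support, ∃ l, y ∈ (x l).support) : IsMonomial x r (d :: D) := by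
  intro s
  rcases s with _ | s
  · exact Or.inl fun y => by simp [interIdealAt]
  refine (h (s + 1)).imp id fun ⟨C, hC, e⟩ => ?_
  obtain ⟨a, ha⟩ := hx.exists_exponents hirr hC fun y hy => hd y (by
    rw [PseudoDivisor.mem_support_iff_idealAt] at hy ⊢
    rw [← e, List.take_succ_cons, interIdealAt_cons] at hy
    exact fun htop => hy (by rw [htop, top_sup_eq]))
  exact ⟨a, fun y => (e y).trans (ha y)⟩

/-- On the closed subschemes of a component, admissibility of the ambient scheme for `d, D` means
that the intersections are combinations of members of a family containing the divisor of `d`. -/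
theorem IsAdmissible.isMonomial {d : PseudoDivisor P} (h : IsAdmissible q r (d :: D))
    (hx : SNCFamily q x) (hirr : ∀ l, IsIrreducible ((x l).support : Set Y))
    (hd : ∀ y ∈ (d.pullback r).support, ∃ l, y ∈ (x l).support) (i : G ⟶ Y) [IsReduced G]
    (F : Closeds Y) (hF : IsIrreducible (F : Set Y)) (hi : Set.range i ⊆ F) :
    IsMonomial (fun l => (x l).pullback i) (i ≫ r) (d :: D) := by
  classical
  obtain ⟨η, hη, hgen⟩ := exists_generic F hF
  have hface : face x ∅ = ⊤ := by simp [face]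
  -- The empty face is all of `Y`; `Z` is the irreducible component containing `F`, where
  -- admissibility can be used.
  obtain ⟨Z, hZ, hηZ⟩ := hx.exists_component (J := ∅) (y := η) (mem_face.2 (by simp))
  have hFZ : F ≤ Z := fun y hy => mem_closeds_of_specializes (hgen y hy) hηZ
  have hZi := hx.isFaceImmersion hZ (redι Z) (range_redι Z)
  have hxZ : SNCFamily (redι Z ≫ q) (fun l => (x l).pullback (redι Z)) :=
    (hZi.restrict hx).comp (fun l => ⟨l, Finset.notMem_empty l⟩)
      (fun l l' e => congrArg Subtype.val e)
  have hirrZ : ∀ l, IsPreirreducible (((x l).pullback (redι Z)).support : Set (red Z)) := by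
    intro l
    rcases Set.eq_empty_or_nonempty (((x l).pullback (redι Z)).support : Set (red Z)) with h0 | ⟨g, hg⟩
    · rw [h0]
      exact isPreirreducible_empty
    · refine IsIrreducible.isPreirreducible ((isIrreducible_imageClosed (redι Z)).1 ?_)
      have hg' : redι Z g ∈ (x l).support := ((x l).mem_support_pullback _ g).1 hg
      have hgZ : ∀ g, redι Z g ∈ Z := fun g =>
        (range_redι Z ▸ Set.mem_range_self g : redι Z g ∈ (Z : Set Y))
      have hle : (x l).support ≤ Z := by
        obtain ⟨ζ, hζ, hζgen⟩ := exists_generic _ (hirr l)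
        have := hx.mem_component_of_specializes hZ (hgZ g) (ξ := ζ) (mem_face.2 (by simp))
          (hζgen _ hg')
        exact fun y hy => mem_closeds_of_specializes (hζgen y hy) this
      have e : imageClosed (redι Z) ((x l).pullback (redι Z)).support = (x l).support := by
        ext y
        constructor
        · rintro ⟨g, hg, rfl⟩
          exact ((x l).mem_support_pullback _ g).1 hg
        · intro hy
          have : y ∈ Set.range (redι Z) := by
            rw [range_redι]
            exact hle hy
          obtain ⟨g, rfl⟩ := this
          exact ⟨g, ((x l).mem_support_pullback _ g).2 hy, rfl⟩
      rw [e]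
      exact hirr l
  have hm := (h Z (hface ▸ hZ)).isMonomial hxZ hirrZ (fun y hy => by
    obtain ⟨l, hl⟩ := hd (redι Z y) (by
      rw [PseudoDivisor.mem_support_pullback] at hy ⊢
      exact hy)
    exact ⟨l, ((x l).mem_support_pullback _ y).2 hl⟩)
  have hj := redLift_redι i Z (hi.trans hFZ)
  have := hm.pullback (redLift i Z (hi.trans hFZ))
  rw [← Category.assoc, hj] at this
  refine this.congr fun l y => ?_
  rw [PseudoDivisor.idealAt_pullback_comp, hj]

end

section

variable {k : Type u} [Field k] {P X Y Z G : Scheme.{u}}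

/-! ### Finiteness of dimension -/

section Dimension

theorem exists_ringKrullDim_le (q : Y ⟶ Spec (CommRingCat.of k)) [LocallyOfFiniteType q]
    (U : Y.affineOpens) : ∃ N : ℕ, ringKrullDim Γ(Y, U) ≤ N := by
  have h := LocallyOfFiniteType.finiteType_appLE q (U := ⊤) (isAffineOpen_top _) U.2 le_top
  let e : Γ(Spec (CommRingCat.of k), ⊤) ≃+* k :=
    (Scheme.ΓSpecIso (CommRingCat.of k)).commRingCatIsoToRingEquiv
  have : IsNoetherianRing Γ(Spec (CommRingCat.of k), ⊤) := isNoetherianRing_of_ringEquiv k e.symm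
  let _ : Algebra Γ(Spec (CommRingCat.of k), ⊤) Γ(Y, U.1) := (q.appLE ⊤ U.1 le_top).hom.toAlgebra
  have : Algebra.FiniteType Γ(Spec (CommRingCat.of k), ⊤) Γ(Y, U.1) := h
  obtain ⟨n, f, hf⟩ := Algebra.FiniteType.iff_quotient_mvPolynomial''.1 this
  refine ⟨n, (ringKrullDim_le_of_surjective f.toRingHom hf).trans ?_⟩
  rw [MvPolynomial.ringKrullDim_of_isNoetherianRing, ringKrullDim_eq_of_ringEquiv e,
    ringKrullDim_eq_zero_of_field]
  simp

/-- Coheights of irreducible closed sets can be computed in an affine open set meeting them, and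
finitely many affine open sets suffice. -/
theorem exists_topologicalKrullDim_le (q : Y ⟶ Spec (CommRingCat.of k)) [LocallyOfFiniteType q]
    [CompactSpace Y] : ∃ N : ℕ, topologicalKrullDim Y ≤ N := by
  choose N hN using exists_ringKrullDim_le q
  obtain ⟨S, -, hc⟩ := (isCompact_univ (X := Y)).elim_finite_subcover_image (b := Set.univ)
    (c := fun U : Y.affineOpens => ((U.1 : Y.Opens) : Set Y)) (fun U _ => U.1.isOpen) (by
      intro y _
      obtain ⟨U, hU, hy, -⟩ := exists_isAffineOpen_mem_and_subset (x := y) (U := ⊤) trivial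
      exact Set.mem_biUnion (x := ⟨U, hU⟩) trivial hy)
  refine ⟨hc.1.toFinset.sup N, ?_⟩
  rw [topologicalKrullDim, Order.krullDim_eq_iSup_coheight]
  refine iSup_le fun V => ?_
  obtain ⟨y, hy⟩ := V.isIrreducible.nonempty
  obtain ⟨U, hU, hyU⟩ : ∃ U ∈ S, y ∈ (U : Y.affineOpens).1 := by
    simpa using hc.2 (Set.mem_univ y)
  have hemb : Topology.IsOpenEmbedding (fun u : (U.1 : Set Y) => (u : Y)) :=
    U.1.isOpen.isOpenEmbedding_subtypeVal
  obtain ⟨V', hV'⟩ := (IrreducibleCloseds.orderIsoOfIsOpenEmbedding _ hemb).surjective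
    ⟨V, ⟨⟨y, hyU⟩, hy⟩⟩
  have hV : IrreducibleCloseds.map _ hemb.continuous V' = V := congrArg Subtype.val hV'
  rw [← hV, hemb.coheight_map]
  have h1 : topologicalKrullDim (U.1 : Set Y) = ringKrullDim Γ(Y, U) := by
    rw [← PrimeSpectrum.topologicalKrullDim_eq_ringKrullDim]
    exact IsHomeomorph.topologicalKrullDim_eq _ U.2.isoSpec.hom.homeomorph.isHomeomorph
  refine (Order.coheight_le_krullDim V').trans (h1.le.trans ((hN U).trans ?_))
  exact_mod_cast Finset.le_sup (f := N) (hc.1.mem_toFinset.2 hU)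

theorem IsSm.exists_topologicalKrullDim_le {q : Y ⟶ Spec (CommRingCat.of k)} (hY : IsSm q) :
    ∃ N : ℕ, topologicalKrullDim Y ≤ N := by
  have := hY.smooth
  have := hY.noetherianSpace
  exact RefinedCobordism.exists_topologicalKrullDim_le q

/-- The dimension as a natural number. -/
def natDim (Y : Scheme.{u}) : ℕ := ((topologicalKrullDim Y).unbotD 0).toNat

/-- The conversion to natural numbers loses nothing because the dimension is finite; this makes the
exponent bound in `Cycle.chernSeries` the true dimension. -/
theorem IsSm.topologicalKrullDim_le_natDim {q : Y ⟶ Spec (CommRingCat.of k)} (hY : IsSm q) :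
    topologicalKrullDim Y ≤ natDim Y := by
  obtain ⟨N, hN⟩ := hY.exists_topologicalKrullDim_le
  rw [natDim]
  cases h : topologicalKrullDim Y with
  | bot => exact bot_le
  | coe d =>
    rw [h] at hN
    have hd : d ≠ ⊤ := by
      rintro rfl
      exact absurd (WithBot.coe_le_coe.1 hN) (by simp)
    rw [WithBot.unbotD_coe]
    exact WithBot.coe_le_coe.2 (ENat.natCast_toNat hd).ge

theorem IsSm.natDim_le {q : Y ⟶ Spec (CommRingCat.of k)} (hY : IsSm q) (i : X ⟶ Y)
    [IsClosedImmersion i] : natDim X ≤ natDim Y := by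
  have h1 := i.isClosedEmbedding.isInducing.topologicalKrullDim_le
  have h2 := h1.trans hY.topologicalKrullDim_le_natDim
  rw [natDim]
  cases h : topologicalKrullDim X with
  | bot => simp
  | coe d =>
    rw [h] at h2
    exact ENat.toNat_le_of_le_natCast (WithBot.coe_le_coe.1 h2)

end Dimension

end

section

/-! ### Polynomials in line bundles as operators -/

section Polynomials

open MvPolynomial

variable {σ R M : Type*} [CommRing R] [AddCommGroup M] [Module R M]

theorem list_prod_X (Ls : List σ) : (Ls.map (X : σ → MvPolynomial σ R)).prod =
    monomial (Ls.map fun L => Finsupp.single L 1).sum 1 := by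
  induction Ls with
  | nil => rfl
  | cons L Ls ih =>
    rw [List.map_cons, List.prod_cons, ih, List.map_cons, List.sum_cons, X, monomial_mul, one_mul]

theorem toMultiset_list_sum (Ls : List σ) :
    Finsupp.toMultiset (Ls.map fun L => Finsupp.single L 1).sum = (Ls : Multiset σ) := by
  induction Ls with
  | nil => rfl
  | cons L Ls ih =>
    rw [List.map_cons, List.sum_cons, map_add, ih, Finsupp.toMultiset_single, one_smul,
      Multiset.singleton_add, Multiset.cons_coe]

/-- Products of variables over lists are exactly the monomials, so linear maps can be tested on
cycles with a list of bundles. -/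
theorem linearMap_ext_list {f g : MvPolynomial σ R →ₗ[R] M}
    (h : ∀ Ls : List σ, f (Ls.map X).prod = g (Ls.map X).prod) : f = g := by
  refine (basisMonomials σ R).ext fun e => ?_
  rw [coe_basisMonomials]
  classical
  have e1 : ((Finsupp.toMultiset e).toList.map fun L => Finsupp.single L 1).sum = e := by
    apply Multiset.toFinsupp.symm.injective
    change Finsupp.toMultiset _ = Finsupp.toMultiset _
    rw [toMultiset_list_sum, Multiset.coe_toList]
  have := h (Finsupp.toMultiset e).toList
  rwa [list_prod_X, e1] at this

variable {A : Type*} [CommRing A] [Algebra R A]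

/-- The ideal of elements all of whose multiples are killed by a linear map. -/
def killIdeal (f : A →ₗ[R] M) : Ideal A where
  carrier := {a | ∀ b, f (a * b) = 0}
  add_mem' ha hb c := by rw [add_mul, map_add, ha, hb, add_zero]
  zero_mem' c := by rw [zero_mul, map_zero]
  smul_mem' a b hb c := by
    rw [smul_eq_mul, mul_comm a b, mul_assoc]
    exact hb _

theorem mem_killIdeal {f : A →ₗ[R] M} {a : A} : a ∈ killIdeal f ↔ ∀ b, f (a * b) = 0 := Iff.rfl

/-- The largest quotient of `A` that acts on the multiples of `f`. -/
def KillRing (f : A →ₗ[R] M) : Type _ := A ⧸ killIdeal f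

instance (f : A →ₗ[R] M) : CommRing (KillRing f) := inferInstanceAs (CommRing (A ⧸ killIdeal f))

instance (f : A →ₗ[R] M) : Algebra R (KillRing f) :=
  inferInstanceAs (Algebra R (A ⧸ killIdeal f))

/-- The quotient map. -/
def toKill (f : A →ₗ[R] M) : A →ₐ[R] KillRing f := Ideal.Quotient.mkₐ R (killIdeal f)

theorem toKill_eq_iff {f : A →ₗ[R] M} {x y : A} :
    toKill f x = toKill f y ↔ ∀ z, f (x * z) = f (y * z) := by
  refine (Ideal.Quotient.eq (I := killIdeal f)).trans (mem_killIdeal.trans ?_)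
  simp only [sub_mul, map_sub, sub_eq_zero]

theorem toKill_eq_iff_list {f : MvPolynomial σ R →ₗ[R] M} {x y : MvPolynomial σ R} :
    toKill f x = toKill f y ↔
      ∀ Ls : List σ, f (x * (Ls.map X).prod) = f (y * (Ls.map X).prod) := by
  refine toKill_eq_iff.trans ⟨fun h Ls => h _, fun h z => ?_⟩
  have : f ∘ₗ LinearMap.mulLeft R x = f ∘ₗ LinearMap.mulLeft R y :=
    linearMap_ext_list fun Ls => h Ls
  exact LinearMap.congr_fun this z

end Polynomials

/-! ### Truncated power series and the face decomposition of formal sums -/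

section Truncation

open MvPowerSeries

variable {A : Type*} [CommRing A] [Algebra Lazard A] {m : ℕ}

/-- The value at `a` of the part of a power series with exponents at most `N`. -/
def truncEval (N : ℕ) (φ : MvPowerSeries (Fin m) Lazard) (a : Fin m → A) : A :=
  ∑ e : Fin m → Fin (N + 1),
    coeff (Finsupp.equivFunOnFinite.symm fun i => (e i : ℕ)) φ • ∏ i, a i ^ (e i : ℕ)

theorem map_truncEval {A' : Type*} [CommRing A'] [Algebra Lazard A'] (f : A →ₐ[Lazard] A') (N : ℕ)
    (φ : MvPowerSeries (Fin m) Lazard) (a : Fin m → A) :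
    f (truncEval N φ a) = truncEval N φ (f ∘ a) := by
  simp [truncEval]

/-- Truncation becomes invisible after a homomorphism that kills the powers beyond the bound. -/
theorem map_truncEval_eq_nilEval {A' : Type*} [CommRing A'] [Algebra Lazard A']
    (f : A →ₐ[Lazard] A') (N : ℕ) (φ : MvPowerSeries (Fin m) Lazard) (a : Fin m → A)
    (ha : ∀ i, f (a i) ^ (N + 1) = 0) : f (truncEval N φ a) = nilEval (fun i => f (a i)) φ := by
  rw [nilEval_eq_sum N ha]
  exact map_truncEval f N φ a

variable {a : Fin m → A}

theorem nilEval_mul (ha : ∀ i, IsNilpotent (a i)) (φ ψ : MvPowerSeries (Fin m) Lazard) :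
    nilEval a (φ * ψ) = nilEval a φ * nilEval a ψ := by
  simp only [nilEval, ← coe_substAlgHom (hasSubst_C ha), map_mul]

theorem nilEval_one (ha : ∀ i, IsNilpotent (a i)) : nilEval a (1 : MvPowerSeries (Fin m) Lazard) = 1 := by
  simp only [nilEval, ← coe_substAlgHom (hasSubst_C ha), map_one]

theorem nilEval_sum (ha : ∀ i, IsNilpotent (a i)) {κ : Type*} (S : Finset κ) (φ : κ → MvPowerSeries (Fin m) Lazard) :
    nilEval a (∑ j ∈ S, φ j) = ∑ j ∈ S, nilEval a (φ j) := by
  simp only [nilEval, ← coe_substAlgHom (hasSubst_C ha), map_sum]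

theorem nilEval_prod_X (ha : ∀ i, IsNilpotent (a i)) (J : Finset (Fin m)) :
    nilEval a (∏ j ∈ J, (X j : MvPowerSeries (Fin m) Lazard)) = ∏ j ∈ J, a j := by
  classical
  induction J using Finset.induction_on with
  | empty => exact nilEval_one ha
  | insert j J hj ih => rw [Finset.prod_insert hj, Finset.prod_insert hj, nilEval_mul ha, ih,
      nilEval_X ha]

theorem prod_X_eq_monomial (J : Finset (Fin m)) :
    (∏ j ∈ J, (X j : MvPowerSeries (Fin m) Lazard)) =
      monomial (∑ j ∈ J, Finsupp.single j 1) 1 := by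
  classical
  induction J using Finset.induction_on with
  | empty => rfl
  | insert j J hj ih =>
    rw [Finset.prod_insert hj, Finset.sum_insert hj, ih, X, monomial_mul_monomial, one_mul]

theorem sum_single_apply (J : Finset (Fin m)) (i : Fin m) :
    (∑ j ∈ J, Finsupp.single j 1 : Fin m →₀ ℕ) i = if i ∈ J then 1 else 0 := by
  rw [Finsupp.finsetSum_apply]
  simp [Finsupp.single_apply]

/-- The decomposition of a formal sum along the faces. -/
theorem fglSum_eq_sum_fglFace (n : Fin m → ℕ) :
    fglSum n = ∑ J : {J : Finset (Fin m) // J.Nonempty}, (∏ j ∈ J.1, X j) * fglFace n J.1 := by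
  classical
  ext e
  -- A monomial of the formal sum occurs in exactly one face term, the one indexed by the set of
  -- variables it involves.
  have key : ∀ J : Finset (Fin m), coeff e ((∏ j ∈ J, X j) * fglFace n J) =
      if J = e.support then coeff e (fglSum n) else 0 := by
    intro J
    rw [prod_X_eq_monomial, coeff_monomial_mul]
    have hd := sum_single_apply J
    by_cases hle : (∑ j ∈ J, Finsupp.single j 1 : Fin m →₀ ℕ) ≤ e
    · rw [if_pos hle, one_mul]
      change (if (e - ∑ j ∈ J, Finsupp.single j 1).support ⊆ J then _ else _) = _
      have hJe : J ⊆ e.support := by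
        intro i hi
        have := hle i
        rw [hd, if_pos hi] at this
        simp only [Finsupp.mem_support_iff]
        omega
      have hiff : (e - ∑ j ∈ J, Finsupp.single j 1).support ⊆ J ↔ J = e.support := by
        constructor
        · refine fun h => Finset.Subset.antisymm hJe fun i hi => ?_
          by_contra hiJ
          refine hiJ (h ?_)
          simp only [Finsupp.mem_support_iff, Finsupp.tsub_apply, hd, if_neg hiJ] at hi ⊢
          exact hi
        · rintro rfl i hi
          simp only [Finsupp.mem_support_iff, Finsupp.tsub_apply, hd] at hi ⊢
          intro h0
          simp [h0] at hi
      simp only [hiff]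
      rw [tsub_add_cancel_of_le hle]
    · rw [if_neg hle, if_neg]
      rintro rfl
      refine hle fun i => ?_
      rw [hd]
      split_ifs with hi
      · exact Nat.one_le_iff_ne_zero.2 (Finsupp.mem_support_iff.1 hi)
      · exact Nat.zero_le _
  rw [map_sum]
  simp only [key]
  -- The exponent zero would belong to the empty face, which is not summed; the formal sum has no
  -- constant term.
  by_cases he : e = 0
  · subst he
    rw [Finset.sum_eq_zero, coeff_zero_eq_constantCoeff_apply, constantCoeff_fglSum]
    intro J _
    rw [if_neg]
    rw [Finsupp.support_zero]
    exact J.2.ne_empty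
  · have hne : e.support.Nonempty := Finsupp.support_nonempty_iff.2 he
    rw [Finset.sum_eq_single (⟨e.support, hne⟩ : {J : Finset (Fin m) // J.Nonempty}), if_pos rfl]
    · intro J _ hJ
      rw [if_neg]
      exact fun h => hJ (Subtype.ext h)
    · simp

/-- The face series of a family and of a subfamily. -/
theorem nilEval_fglFace_map {m' : ℕ} (n : Fin m → ℕ) (l : Fin m' → Fin m)
    (hl : Function.Injective l) (J : Finset (Fin m')) {a : Fin m → A}
    (ha : ∀ i, IsNilpotent (a i)) :
    nilEval a (fglFace n (J.map ⟨l, hl⟩)) = nilEval (a ∘ l) (fglFace (n ∘ l) J) := by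
  classical
  have hs := hasSubst_C ha
  have hs' := hasSubst_C (a := a ∘ l) fun i => ha (l i)
  rw [nilEval, nilEval, ← coeff_zero_eq_constantCoeff_apply, ← coeff_zero_eq_constantCoeff_apply,
    coeff_subst hs, coeff_subst hs']
  have hinj := Finsupp.mapDomain_injective (M := ℕ) hl
  have hJ : (∑ i ∈ J.map ⟨l, hl⟩, Finsupp.single i 1 : Fin m →₀ ℕ) =
      (∑ i ∈ J, Finsupp.single i 1 : Fin m' →₀ ℕ).mapDomain l := by
    rw [Finset.sum_map, Finsupp.mapDomain_finsetSum]
    simp [Finsupp.mapDomain_single]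
  have hsupp : ∀ e : Fin m' →₀ ℕ, (e.mapDomain l).support ⊆ J.map ⟨l, hl⟩ ↔ e.support ⊆ J := by
    intro e
    rw [Finsupp.mapDomain_support_of_injective hl]
    change Finset.image (⇑(⟨l, hl⟩ : Fin m' ↪ Fin m)) e.support ⊆ _ ↔ _
    rw [← Finset.map_eq_image, Finset.map_subset_map]
  have hcoeff : ∀ e : Fin m' →₀ ℕ, coeff (e.mapDomain l) (fglFace n (J.map ⟨l, hl⟩)) =
      coeff e (fglFace (n ∘ l) J) := by
    intro e
    change (if (e.mapDomain l).support ⊆ J.map ⟨l, hl⟩ then _ else _) =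
      (if e.support ⊆ J then _ else _)
    simp only [hsupp]
    congr 1
    rw [hJ, ← Finsupp.mapDomain_add, coeff_mapDomain_fglSum n l hl]
  -- A series `fglFace` contains only monomials in the variables of its face, so only relabelled
  -- exponents contribute to the evaluation.
  have hrange : ∀ f : (Fin m →₀ ℕ) → A, (∀ d, f d ≠ 0 → d.support ⊆ J.map ⟨l, hl⟩) →
      ∑ᶠ d, f d = ∑ᶠ e, f (Finsupp.mapDomain l e) := by
    intro f hf
    rw [← finsum_mem_range hinj, ← finsum_mem_univ]
    refine finsum_mem_inter_support_eq' f _ _ fun d hd => ⟨fun _ => ?_, fun _ => trivial⟩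
    refine ⟨d.comapDomain l hl.injOn, Finsupp.mapDomain_comapDomain l hl d fun i hi => ?_⟩
    obtain ⟨j, -, rfl⟩ := Finset.mem_map.1 (hf d hd hi)
    exact ⟨j, rfl⟩
  rw [hrange]
  · refine finsum_congr fun e => ?_
    rw [hcoeff, Finsupp.prod_mapDomain_index_inj hl]
    rfl
  · intro d hd
    by_contra h
    refine hd ?_
    have : coeff d (fglFace n (J.map ⟨l, hl⟩)) = 0 := if_neg h
    rw [this]
    exact (Algebra.smul_def (0 : Lazard) (_ : A)).trans (by rw [map_zero, zero_mul])

end Truncation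

end

/-! ### The ring of first Chern class operators on a cycle -/

section

instance (priority := 3000) commSemiringLazard : CommSemiring Lazard :=
  @CommRing.toCommSemiring _ (Ideal.Quotient.commRing lazardIdeal)

instance (priority := 3000) semiringLazard : Semiring Lazard :=
  @CommSemiring.toSemiring _ (@CommRing.toCommSemiring _ (Ideal.Quotient.commRing lazardIdeal))

variable {k : Type u} [Field k] {P X X' S M : Scheme.{u}} {b : P ⟶ Spec (CommRingCat.of k)}
  {p : X ⟶ P} {p' : X' ⟶ P} {D : List (PseudoDivisor P)}

theorem IsSNC.congr {Y : Scheme.{u}} {q : Y ⟶ Spec (CommRingCat.of k)} {E E' : PseudoDivisor Y}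
    (h : IsSNC q E) (e : ∀ y, E'.idealAt y = E.idealAt y) : IsSNC q E' := by
  obtain ⟨σ⟩ := h
  exact ⟨{ σ with ideal_eq := fun y => (e y).trans (σ.ideal_eq y) }⟩

theorem mkQ_eq_of_rel {x y : Free b p D} (h : Rel b p D (x - y)) :
    (relations b p D).mkQ x = (relations b p D).mkQ y := by
  rw [← sub_eq_zero, ← map_sub]
  exact (Submodule.Quotient.mk_eq_zero _).2 (Submodule.subset_span h)

theorem mkQ_eq_zero_of_rel {x : Free b p D} (h : Rel b p D x) : (relations b p D).mkQ x = 0 :=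
  (Submodule.Quotient.mk_eq_zero _).2 (Submodule.subset_span h)

namespace Cycle

variable (c d : Cycle b p D)

/-- The class of the morphism of `c` with other line bundles. -/
def cls (Ls : List (LineBundle c.Y)) : Omega b p D :=
  (relations b p D).mkQ (Finsupp.single (c.withBundles Ls) 1)

variable {c d}

theorem mkQ_single (Ls : List (LineBundle c.Y)) (a : Lazard) :
    (relations b p D).mkQ (Finsupp.single (c.withBundles Ls) a) = a • c.cls Ls := by
  rw [cls, ← map_smul, Finsupp.smul_single, smul_eq_mul, mul_one]

theorem cls_eq_of_iso (φ : c.Y ≅ d.Y) (hφ : φ.hom ≫ d.f = c.f) {Ls : List (LineBundle c.Y)}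
    {Ms : List (LineBundle d.Y)}
    (h : List.Forall₂ (fun L M => LineBundle.Iso L (M.pullback φ.hom)) Ls Ms) :
    c.cls Ls = d.cls Ms :=
  mkQ_eq_of_rel (.iso _ _ ⟨φ, hφ, Ls, List.Perm.refl _, h⟩)

theorem cls_perm {Ls Ms : List (LineBundle c.Y)} (h : Ls.Perm Ms) : c.cls Ls = c.cls Ms :=
  mkQ_eq_of_rel (.iso _ _ ⟨Iso.refl _, Category.id_comp _, Ms, h.symm,
    List.forall₂_same.2 fun L _ => (LineBundle.Iso.refl L).pullback_id⟩)

theorem cls_congr {Ls Ms : List (LineBundle c.Y)} (h : List.Forall₂ LineBundle.Iso Ls Ms) :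
    c.cls Ls = c.cls Ms :=
  cls_eq_of_iso (Iso.refl _) (Category.id_comp _) (h.imp fun _ _ h => h.pullback_id)

variable (c d)

/-- The class of `c` with a polynomial in first Chern classes applied to it. -/
def eval : MvPolynomial (LineBundle c.Y) Lazard →ₗ[Lazard] Omega b p D :=
  (MvPolynomial.basisMonomials _ Lazard).constr Lazard
    fun e => c.cls (Finsupp.toMultiset e).toList

/-- The list chosen for each monomial is irrelevant because permuted lists of bundles give
isomorphic cycles. -/
theorem eval_prod (Ls : List (LineBundle c.Y)) :
    c.eval (Ls.map MvPolynomial.X).prod = c.cls Ls := by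
  rw [list_prod_X, eval]
  have := (MvPolynomial.basisMonomials (LineBundle c.Y) Lazard).constr_basis Lazard
    (fun e => c.cls (Finsupp.toMultiset e).toList) (Ls.map fun L => Finsupp.single L 1).sum
  rw [MvPolynomial.coe_basisMonomials] at this
  rw [this, toMultiset_list_sum]
  exact cls_perm (Multiset.coe_eq_coe.1 (by simp))

/-- The ring of first Chern class operators on `c`. -/
abbrev ChernRing : Type u :=
  KillRing (R := Lazard) (A := MvPolynomial (LineBundle c.Y) Lazard) (M := Omega b p D) c.eval

/-- The operator given by a polynomial in first Chern classes. -/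
def toChern : MvPolynomial (LineBundle c.Y) Lazard →ₐ[Lazard] c.ChernRing :=
  toKill (R := Lazard) (A := MvPolynomial (LineBundle c.Y) Lazard) (M := Omega b p D) c.eval

/-- The first Chern class operator of a line bundle. -/
def chern (L : LineBundle c.Y) : c.ChernRing := c.toChern (MvPolynomial.X L)

variable {c d}

/-- An identity in the Chern ring is an identity of classes that persists after adding arbitrary
further bundles. -/
theorem toChern_eq_iff {f g : MvPolynomial (LineBundle c.Y) Lazard} :
    c.toChern f = c.toChern g ↔ ∀ Ls : List (LineBundle c.Y),
      c.eval (f * (Ls.map MvPolynomial.X).prod) = c.eval (g * (Ls.map MvPolynomial.X).prod) :=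
  toKill_eq_iff_list (R := Lazard) (M := Omega b p D) (f := c.eval)

theorem eval_eq_of_toChern_eq {f g : MvPolynomial (LineBundle c.Y) Lazard}
    (h : c.toChern f = c.toChern g) : c.eval f = c.eval g := by
  simpa using toChern_eq_iff.1 h []

theorem chern_eq_of_iso {L M : LineBundle c.Y} (h : LineBundle.Iso L M) :
    c.chern L = c.chern M := by
  refine toChern_eq_iff.2 fun Ls => ?_
  have e : ∀ L : LineBundle c.Y, MvPolynomial.X (R := Lazard) L * (Ls.map MvPolynomial.X).prod =
      ((L :: Ls).map MvPolynomial.X).prod := fun L => by simp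
  rw [e, e, eval_prod, eval_prod]
  exact cls_congr (.cons h (List.forall₂_same.2 fun L _ => .refl L))

theorem isQuasiProjective_id {Y : Scheme.{u}} {q : Y ⟶ Spec (CommRingCat.of k)} (hY : IsSm q) :
    IsQuasiProjective (𝟙 Y) q := by
  obtain ⟨n, i, hi, h⟩ := IsProjective.of_isProper (𝟙 Y) (p := q) (by simpa using hY)
  exact ⟨n, i, inferInstance, h⟩

theorem smooth_id (Y : Scheme.{u}) : Smooth (𝟙 Y) := by
  have : IsOpenImmersion (𝟙 Y) := inferInstance
  infer_instance

/-- The dimension relation for the identity morphism of the source. -/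
theorem cls_eq_zero_of_natDim_lt {Ls Ms : List (LineBundle c.Y)} (h : natDim c.Y < Ls.length) :
    c.cls (Ls ++ Ms) = 0 := by
  have h1 : c.cls (Ls ++ Ms) = c.cls (Ls.map (fun L => L.pullback (𝟙 c.Y)) ++ Ms) := by
    refine cls_congr (List.rel_append ?_ (List.forall₂_same.2 fun L _ => .refl L))
    exact List.forall₂_map_right_iff.2
      (List.forall₂_same.2 fun L _ => (LineBundle.Iso.refl L).pullback_id)
  rw [h1]
  refine mkQ_eq_zero_of_rel (.dim _ c.Y (c.f ≫ p ≫ b) c.sm (𝟙 c.Y) (Category.id_comp _)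
    (smooth_id c.Y) (isQuasiProjective_id c.sm) Ls Ms rfl ?_)
  refine c.sm.topologicalKrullDim_le_natDim.trans_lt ?_
  exact_mod_cast h

theorem chern_pow (L : LineBundle c.Y) {N : ℕ} (hN : natDim c.Y ≤ N) :
    c.chern L ^ (N + 1) = 0 := by
  rw [chern, ← map_pow, ← map_zero c.toChern]
  refine toChern_eq_iff.2 fun Ls => ?_
  have e : MvPolynomial.X (R := Lazard) L ^ (N + 1) * (Ls.map MvPolynomial.X).prod =
      ((List.replicate (N + 1) L ++ Ls).map MvPolynomial.X).prod := by
    simp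
  rw [e, eval_prod, zero_mul, map_zero]
  exact cls_eq_zero_of_natDim_lt (by simpa using Nat.lt_succ_of_le hN)

theorem isNilpotent_chern (L : LineBundle c.Y) : IsNilpotent (c.chern L) :=
  ⟨_, chern_pow L le_rfl⟩

theorem toChern_truncEval {m N : ℕ} (hN : natDim c.Y ≤ N) (φ : MvPowerSeries (Fin m) Lazard)
    (Ls : Fin m → LineBundle c.Y) :
    c.toChern (truncEval N φ fun i => MvPolynomial.X (Ls i)) =
      nilEval (fun i => c.chern (Ls i)) φ :=
  map_truncEval_eq_nilEval c.toChern N φ _ fun i => chern_pow (Ls i) hN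

theorem prod_flatMap_replicate {σ : Type*} {m : ℕ} (e : Fin m → ℕ) (Ls : Fin m → σ) :
    ((((List.finRange m).flatMap fun i => List.replicate (e i) (Ls i)).map
      (MvPolynomial.X (R := Lazard))).prod) = ∏ i, MvPolynomial.X (Ls i) ^ e i := by
  rw [List.map_flatMap, List.flatMap_def, List.prod_flatten, List.map_map, Fin.prod_univ_def]
  congr 1
  refine List.map_congr_left fun i _ => ?_
  simp

/-- Passes from the sum over exponents in the definition to a polynomial, which can then be
simplified in the Chern ring. -/
theorem mkQ_chernSeries {m : ℕ} (φ : MvPowerSeries (Fin m) Lazard) (Ls : Fin m → LineBundle c.Y) :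
    (relations b p D).mkQ (c.chernSeries φ Ls) =
      c.eval ((c.bundles.map MvPolynomial.X).prod *
        truncEval (natDim c.Y) φ fun i => MvPolynomial.X (Ls i)) := by
  rw [chernSeries, map_sum, truncEval, Finset.mul_sum, map_sum]
  refine Finset.sum_congr rfl fun e _ => ?_
  rw [mkQ_single, mul_smul_comm, map_smul, ← prod_flatMap_replicate, ← List.prod_append,
    ← List.map_append, eval_prod]

theorem chern_tensor (L M : LineBundle c.Y) : c.chern (L.tensor M) =
    nilEval ![c.chern L, c.chern M] universalFGL.toPowerSeries := by
  have e : ![c.chern L, c.chern M] = fun i => c.chern (![L, M] i) := by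
    ext1 i
    fin_cases i <;> rfl
  rw [e, ← toChern_truncEval le_rfl]
  refine Eq.symm (toChern_eq_iff.2 fun Ls => ?_)
  -- The relation is used with arbitrary bundles already on the cycle, which makes it an identity of
  -- operators.
  have h := mkQ_eq_of_rel (Rel.fgl (c.withBundles Ls) L M)
  have h2 : (relations b p D).mkQ ((c.withBundles Ls).chernSeries universalFGL.toPowerSeries
      ![L, M]) = c.eval ((Ls.map MvPolynomial.X).prod *
        truncEval (natDim c.Y) universalFGL.toPowerSeries fun i => MvPolynomial.X (![L, M] i)) :=
    mkQ_chernSeries (c := c.withBundles Ls) _ _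
  have h3 : (relations b p D).mkQ (Finsupp.single ((c.withBundles Ls).withBundles
      (Ls ++ [L.tensor M] : List (LineBundle c.Y))) 1) = c.cls (Ls ++ [L.tensor M]) := rfl
  replace h := h2.symm.trans (h.trans h3)
  rw [← eval_prod] at h
  rw [mul_comm, h, List.map_append, List.prod_append, mul_comm]
  simp

theorem isSNC_one {Y : Scheme.{u}} (q : Y ⟶ Spec (CommRingCat.of k)) :
    IsSNC q (PseudoDivisor.one Y) :=
  ⟨{ m := 0
     comp := Fin.elim0
     mult := Fin.elim0
     mult_pos := fun i => i.elim0
     irreducible := fun i => i.elim0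
     ideal_eq := fun y => by simp [PseudoDivisor.idealAt_one]
     transversal := fun y =>
       have : IsEmpty {i : Fin 0 // y ∈ ((Fin.elim0 i : PseudoDivisor Y)).support} :=
         ⟨fun i => i.1.elim0⟩
       linearIndependent_empty_type
     smooth_face := fun J hJ => by
       obtain ⟨i, -⟩ := hJ
       exact i.elim0 }⟩

theorem goodPosition_one {Y : Scheme.{u}} [IsReduced Y] {q : Y ⟶ Spec (CommRingCat.of k)}
    {r : Y ⟶ P} (h : IsAdmissibleIrr q r D) : GoodPosition q r (PseudoDivisor.one Y) D := by
  refine ⟨isSNC_one q, ?_⟩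
  rintro D₁ d D₂ rfl hD₁ hd
  have e : ∀ y, interIdealAt ((D₁ ++ d :: D₂).take (D₁.length + 1)) r y =
      (d.pullback r).idealAt y := interIdealAt_take_leading hD₁
  rcases h (D₁.length + 1) with h0 | ⟨C, hC, hCe⟩
  · refine absurd ?_ hd
    rw [eq_top_iff]
    intro y _
    rw [PseudoDivisor.mem_support_iff_idealAt, ← e y, h0 y]
    exact bot_ne_top
  · refine hC.congr fun y => ?_
    rw [PseudoDivisor.idealAt_add, PseudoDivisor.idealAt_one, ← e, hCe, ← Ideal.one_eq_top, one_mul]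

/-- The section 1 of the trivial bundle has no zeros, so the section relation has an empty
right-hand side. -/
theorem chern_trivial : c.chern (LineBundle.trivial c.Y) = 0 := by
  rw [chern, ← map_zero c.toChern]
  refine toChern_eq_iff.2 fun Ls => ?_
  have hsupp : ∀ y, y ∉ (PseudoDivisor.one c.Y).support := fun y => by
    rw [PseudoDivisor.mem_support_iff_idealAt, PseudoDivisor.idealAt_one]
    simp
  have h := mkQ_eq_of_rel (Rel.sect (c.withBundles (Ls ++ [LineBundle.trivial c.Y])) Ls
    (PseudoDivisor.one c.Y) rfl (fun y hy => absurd hy (hsupp y))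
    (goodPosition_one c.admissible) ∅ (fun F => by
      simp only [Finset.notMem_empty, false_iff]
      intro hF
      obtain ⟨y, hy⟩ := hF.1.1.nonempty
      exact hsupp y (hF.1.2 hy)) (fun F => absurd F.2 (Finset.notMem_empty _)))
  have h2 : c.cls (Ls ++ [LineBundle.trivial c.Y]) = 0 := h.trans
    ((congrArg _ (Finset.sum_eq_zero fun F _ => absurd F.2 (Finset.notMem_empty _))).trans
      (map_zero _))
  rw [← eval_prod, List.map_append, List.prod_append, mul_comm] at h2
  simpa using h2

/-- The first Chern class of a divisor in terms of its components. -/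
theorem chern_bundle_eq {m : ℕ} (x : Fin m → PseudoDivisor c.Y) (n : Fin m → ℕ)
    (E : PseudoDivisor c.Y) (hdom : ∀ y : c.Y, IsDomain (c.Y.presheaf.stalk y))
    (hE : ∀ y, E.idealAt y = ∏ i, (x i).idealAt y ^ n i) (h0 : ∀ i y, (x i).eqn y ≠ 0) :
    c.chern E.bundle = nilEval (fun i => c.chern (x i).bundle) (fglSum n) := by
  -- Realizes the iterated tensor product of the bundles of the components as the bundle of a
  -- divisor with the same ideals as `E`; equal ideals give isomorphic bundles.
  have key : ∀ l : List (Fin m), ∃ E' : PseudoDivisor c.Y,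
      E'.bundle = l.foldr (fun i r => LineBundle.tensor
        ((LineBundle.tensor (x i).bundle)^[n i] (.trivial c.Y)) r) (.trivial c.Y) ∧
      ∀ y, E'.idealAt y = (l.map fun i => (x i).idealAt y ^ n i).prod := by
    have hpow : ∀ i (j : ℕ), ∃ E' : PseudoDivisor c.Y,
        E'.bundle = (LineBundle.tensor (x i).bundle)^[j] (.trivial c.Y) ∧
        ∀ y, E'.idealAt y = (x i).idealAt y ^ j := by
      intro i j
      induction j with
      | zero => exact ⟨.one c.Y, rfl, fun y => by simp [PseudoDivisor.idealAt_one]⟩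
      | succ j ih =>
        obtain ⟨E', h1, h2⟩ := ih
        refine ⟨x i + E', ?_, fun y => ?_⟩
        · rw [Function.iterate_succ_apply', ← h1]
          rfl
        · rw [PseudoDivisor.idealAt_add, h2, pow_succ']
    intro l
    induction l with
    | nil => exact ⟨.one c.Y, rfl, fun y => by simp [PseudoDivisor.idealAt_one]⟩
    | cons i l ih =>
      obtain ⟨E', h1, h2⟩ := ih
      obtain ⟨E'', h3, h4⟩ := hpow i (n i)
      refine ⟨E'' + E', ?_, fun y => ?_⟩
      · rw [List.foldr_cons, ← h1, ← h3]
        rfl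
      · rw [PseudoDivisor.idealAt_add, h2, h4, List.map_cons, List.prod_cons]
  obtain ⟨E', h1, h2⟩ := key (List.finRange m)
  have hEE' : ∀ y, E.idealAt y = E'.idealAt y := fun y => by
    rw [hE, h2, Fin.prod_univ_def]
  rw [← nilEval_fglSum c.chern LineBundle.tensor (.trivial c.Y) isNilpotent_chern chern_trivial
    chern_tensor n fun i => (x i).bundle, ← h1]
  refine chern_eq_of_iso (PseudoDivisor.bundle_iso_of_idealAt_eq hdom hEE' fun y hy => ?_)
  have h3 : (∏ i, (x i).idealAt y ^ n i) = ⊥ := by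
    rw [← hE, hEE', PseudoDivisor.idealAt, hy, Ideal.span_singleton_eq_bot]
  have := hdom y
  rw [← Ideal.zero_eq_bot, Finset.prod_eq_zero_iff] at h3
  obtain ⟨i, -, hi⟩ := h3
  have h4 := eq_zero_of_pow_eq_zero hi
  exact h0 i y (Ideal.span_singleton_eq_bot.1 h4)

end Cycle

end

section

/-! ### Classes of closed subsets and intersection with normal crossing divisors -/

section SubClass

variable {k : Type u} [Field k] {P X S M : Scheme.{u}} {b : P ⟶ Spec (CommRingCat.of k)}
  {p : X ⟶ P} {D : List (PseudoDivisor P)} {m : M ⟶ S} {n : M ⟶ X}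

/-- The cobordism cycle `d` is the inclusion of the closed subset `F` of `S`, where the morphism to
`X` is the partially defined one given by `m` and `n`. -/
structure IsSub (m : M ⟶ S) (n : M ⟶ X) (d : Cycle b p D) (F : Closeds S) (i : d.Y ⟶ S) :
    Prop where
  closed : IsClosedImmersion i
  range : Set.range i = F
  fac : ∃ h : d.Y ⟶ M, h ≫ m = i ∧ h ≫ n = d.f

open Classical in
/-- The class of the closed subset `F` of `S` with a polynomial in the first Chern classes of line
bundles on `S` applied to it. -/
def subClass (b : P ⟶ Spec (CommRingCat.of k)) (p : X ⟶ P) (D : List (PseudoDivisor P))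
    (m : M ⟶ S) (n : M ⟶ X) (F : Closeds S) :
    MvPolynomial (LineBundle S) Lazard →ₗ[Lazard] Omega b p D :=
  if h : ∃ (d : Cycle b p D) (i : d.Y ⟶ S), IsSub m n d F i then
    h.choose.eval ∘ₗ (MvPolynomial.rename
      (fun L : LineBundle S => L.pullback h.choose_spec.choose)).toLinearMap
  -- Default value for subsets that underlie no cycle of the required kind.
  else 0

/-- The class is independent of the chosen cycle: integral closed subschemes with the same image are
isomorphic over `S`, and since `m` is a monomorphism the isomorphism respects the maps to `X`. -/
theorem subClass_eq [Mono m] {d : Cycle b p D} {F : Closeds S} {i : d.Y ⟶ S}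
    (h : IsSub m n d F i) : subClass b p D m n F = d.eval ∘ₗ (MvPolynomial.rename
      (fun L : LineBundle S => L.pullback i)).toLinearMap := by
  have hex : ∃ (d : Cycle b p D) (i : d.Y ⟶ S), IsSub m n d F i := ⟨d, i, h⟩
  rw [subClass, dif_pos hex]
  have h' := hex.choose_spec.choose_spec
  set d' := hex.choose
  set i' := hex.choose_spec.choose
  have := h.closed
  have := h'.closed
  obtain ⟨φ, hφ⟩ := exists_iso_of_range_eq i' i (h'.range.trans h.range.symm)
  obtain ⟨g, hg, hgn⟩ := h.fac
  obtain ⟨g', hg', hgn'⟩ := h'.fac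
  have e : g' = φ.hom ≫ g := by
    rw [← cancel_mono m, hg', Category.assoc, hg, hφ]
  refine linearMap_ext_list fun Ls => ?_
  have e1 : ∀ {Y : Scheme.{u}} (j : Y ⟶ S), MvPolynomial.rename
      (fun L : LineBundle S => L.pullback j) ((Ls.map (MvPolynomial.X (R := Lazard))).prod) =
      ((Ls.map fun L => L.pullback j).map MvPolynomial.X).prod := by
    intro Y j
    rw [map_list_prod, List.map_map, List.map_map]
    congr 2
    ext1 L
    simp
  simp only [LinearMap.comp_apply, AlgHom.toLinearMap_apply, e1, Cycle.eval_prod]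
  refine Cycle.cls_eq_of_iso φ (by rw [← hgn, ← hgn', e, Category.assoc]) ?_
  rw [List.forall₂_map_left_iff, List.forall₂_map_right_iff]
  refine List.forall₂_same.2 fun L _ => ?_
  rw [← hφ]
  exact L.iso_pullback_comp i φ.hom

theorem subClass_prod [Mono m] {d : Cycle b p D} {F : Closeds S} {i : d.Y ⟶ S}
    (h : IsSub m n d F i) (Ls : List (LineBundle S)) :
    subClass b p D m n F (Ls.map MvPolynomial.X).prod = d.cls (Ls.map fun L => L.pullback i) := by
  rw [subClass_eq h, LinearMap.comp_apply, AlgHom.toLinearMap_apply, map_list_prod, List.map_map,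
    ← Cycle.eval_prod, List.map_map]
  congr 3
  ext1 L
  simp

/-- Components of a face are disjoint, and a generization inside the face stays in its component; so
intersecting with one more member can be done componentwise. -/
theorem SNCFamily.mem_components_insert {ι : Type*} [DecidableEq ι]
    {q : S ⟶ Spec (CommRingCat.of k)} {x : ι → PseudoDivisor S} (hx : SNCFamily q x)
    {J : Finset ι} {j : ι} {G : Closeds S} : G ∈ components (face x (insert j J)) ↔
      ∃ F ∈ components (face x J), G ∈ components (F ⊓ (x j).support) := by
  have hface : ∀ y, y ∈ face x (insert j J) ↔ y ∈ face x J ∧ y ∈ (x j).support := by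
    intro y
    simp only [mem_face, Finset.mem_insert, forall_eq_or_imp]
    tauto
  constructor
  · intro hG
    obtain ⟨η, hη, hgen⟩ := RefinedCobordism.exists_generic G hG.1.1
    obtain ⟨F, hF, hηF⟩ := hx.exists_component ((hface η).1 (hG.1.2 hη)).1
    have hGF : G ≤ F := fun z hz => mem_closeds_of_specializes (hgen z hz) hηF
    refine ⟨F, hF, ⟨hG.1.1, le_inf hGF fun z hz => ((hface z).1 (hG.1.2 hz)).2⟩,
      fun G' hG' hle => hG.2 ⟨hG'.1, fun z hz => (hface z).2 ⟨hF.1.2 (hG'.2 hz).1,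
        (hG'.2 hz).2⟩⟩ hle⟩
  · rintro ⟨F, hF, hG⟩
    refine mem_components_of_generization_stable
      (fun z (hz : z ∈ F ∧ z ∈ (x j).support) => (hface z).2 ⟨hF.1.2 hz.1, hz.2⟩) ?_ hG
    intro y hy ξ hξ hs
    exact ⟨hx.mem_component_of_specializes hF hy.1 ((hface ξ).1 hξ).1 hs, ((hface ξ).1 hξ).2⟩

variable {ι : Type*} [Fintype ι] {q : S ⟶ Spec (CommRingCat.of k)} {x : ι → PseudoDivisor S}

/-- The cycle `d` is the inclusion of `F` and is compatible with the family `x`. -/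
structure IsMonomialSub (q : S ⟶ Spec (CommRingCat.of k)) (x : ι → PseudoDivisor S) (m : M ⟶ S)
    (n : M ⟶ X) (d : Cycle b p D) (F : Closeds S) (i : d.Y ⟶ S) : Prop extends
    IsSub m n d F i where
  comp : i ≫ q = d.f ≫ p ≫ b
  monomial : IsMonomial (fun l => (x l).pullback i) (d.f ≫ p) D

/-- The section relation applies to a member of a normal crossing family: its equation lies outside
the square of the maximal ideal, and monomiality gives good position of the divisor and
admissibility of its components. -/
theorem Cycle.cls_append_bundle {d : Cycle b p D} {κ : Type*} [Fintype κ]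
    {z : κ → PseudoDivisor d.Y}
    (hz : SNCFamily (d.f ≫ p ≫ b) z) (hmon : IsMonomial z (d.f ≫ p) D) (j : κ) :
    ∃ hr : ∀ G ∈ components (z j).support, d.CanRestrict G,
      ∀ (Ls : List (LineBundle d.Y)) (A : Finset (Closeds d.Y))
        (hA : ∀ G, G ∈ A ↔ G ∈ components (z j).support),
        d.cls (Ls ++ [(z j).bundle]) = ∑ G : A, (d.restrict G.1 (hr G.1 ((hA G.1).1 G.2)) []).cls
          (Ls.map fun L => L.pullback (redι G.1)) := by
  classical
  have := d.sm.noetherianSpace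
  have hr : ∀ G ∈ components (z j).support, d.CanRestrict G := by
    intro G hG
    have hG' : G ∈ components (face z {j}) := by rwa [face_singleton]
    have hs := hz.smooth_face {j} (Finset.singleton_nonempty j) G hG'
    have himm := hz.isFaceImmersion hG' (redι G) (range_redι G)
    have := (d.sm.of_isClosedImmersion (redι G) hs).noetherianSpace
    exact ⟨hG.1.1, hs, ((hmon.pullback (redι G)).restrict himm).isAdmissibleIrr
      (himm.restrict hz)⟩
  refine ⟨hr, fun Ls A hA => ?_⟩
  have h := mkQ_eq_of_rel (Rel.sect (d.withBundles (Ls ++ [(z j).bundle])) Ls (z j) rfl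
    (fun y hy => hz.eqn_notMem_sq j hy)
    (hmon.goodPosition hz (Pi.single j 1) fun y => by
      rw [Finset.prod_eq_single j] <;> simp +contextual)
    A hA (fun G =>
      have hG := hr G.1 ((hA G.1).1 G.2)
      ⟨hG.irreducible, hG.smooth, hG.admissible⟩))
  exact h.trans (map_sum _ _ _)

variable [NoetherianSpace S] [DecidableEq ι]

/-- On `F` the members outside `J` restrict to a normal crossing family, and monomiality survives
the restriction; so the bundle of `x j` cuts `F` in `F ∩ x j` by the section relation. -/
theorem subClass_X_mul [Mono m] (hx : SNCFamily q x) {J : Finset ι} {F : Closeds S}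
    (hF : F ∈ components (face x J)) {d : Cycle b p D} {i : d.Y ⟶ S}
    (h : IsMonomialSub q x m n d F i) {j : ι} (hj : j ∉ J) :
    (∀ G ∈ components (F ⊓ (x j).support), ∃ (d' : Cycle b p D) (i' : d'.Y ⟶ S),
      IsMonomialSub q x m n d' G i') ∧
    ∀ Q, subClass b p D m n F (MvPolynomial.X (x j).bundle * Q) =
      ∑ G ∈ (finite_components (F ⊓ (x j).support)).toFinset, subClass b p D m n G Q := by
  have := h.closed
  have := d.sm.noetherianSpace
  have himm := hx.isFaceImmersion hF i h.range
  have hz := himm.restrict hx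
  rw [h.comp] at hz
  obtain ⟨hr, hcls⟩ := Cycle.cls_append_bundle hz (h.monomial.restrict himm) ⟨j, hj⟩
  have himage : imageClosed i ((x j).pullback i).support = F ⊓ (x j).support := by
    ext y
    change y ∈ imageClosed i ((x j).pullback i).support ↔ y ∈ F ∧ y ∈ (x j).support
    rw [mem_imageClosed]
    constructor
    · rintro ⟨z, hz, rfl⟩
      exact ⟨(h.range ▸ Set.mem_range_self z : i z ∈ (F : Set S)),
        ((x j).mem_support_pullback i z).1 hz⟩
    · rintro ⟨hy, hy'⟩
      obtain ⟨z, rfl⟩ : y ∈ Set.range i := by rwa [h.range]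
      exact ⟨z, ((x j).mem_support_pullback i z).2 hy', rfl⟩
  obtain ⟨g, hg, hgn⟩ := h.fac
  have hsub : ∀ (G : Closeds d.Y) (hG : G ∈ components ((x j).pullback i).support),
      IsMonomialSub q x m n (d.restrict G (hr G hG) []) (imageClosed i G) (redι G ≫ i) := by
    intro G hG
    have hcl : IsClosedImmersion (redι G ≫ i) := inferInstance
    refine ⟨⟨hcl, range_redι_comp i G, redι G ≫ g, ?_, ?_⟩, ?_, ?_⟩
    · exact (Category.assoc _ _ _).trans (congrArg (redι G ≫ ·) hg)
    · exact (Category.assoc _ _ _).trans (congrArg (redι G ≫ ·) hgn)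
    · have := congrArg (redι G ≫ ·) h.comp
      simpa [Cycle.restrict] using this
    · have := h.monomial.pullback (redι G)
      rw [← Category.assoc] at this
      exact this.congr fun l y => ((x l).idealAt_pullback_comp i (redι G) y).symm
  constructor
  · intro G hG
    obtain ⟨G', rfl⟩ := exists_imageClosed_eq i G (by
      rw [h.range]
      exact hG.1.2.trans inf_le_left)
    rw [← himage, imageClosed_mem_components] at hG
    exact ⟨_, _, hsub G' hG⟩
  · intro Q
    have key : subClass b p D m n F ∘ₗ LinearMap.mulLeft Lazard
        (MvPolynomial.X (x j).bundle : MvPolynomial (LineBundle S) Lazard) =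
        ∑ G ∈ (finite_components (F ⊓ (x j).support)).toFinset, subClass b p D m n G := by
      refine linearMap_ext_list fun Ls => ?_
      have e1 : (MvPolynomial.X (R := Lazard) (x j).bundle) * (Ls.map MvPolynomial.X).prod =
          ((Ls ++ [(x j).bundle]).map MvPolynomial.X).prod := by simp [mul_comm]
      rw [LinearMap.comp_apply, LinearMap.mulLeft_apply, e1, subClass_prod h.toIsSub,
        List.map_append, LinearMap.sum_apply]
      have hA : ∀ G : Closeds d.Y,
          G ∈ (finite_components ((x j).pullback i).support).toFinset ↔ _ := fun G =>
        Set.Finite.mem_toFinset _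
      refine (hcls _ _ hA).trans ?_
      refine Eq.trans (b := ∑ G ∈ (finite_components ((x j).pullback i).support).toFinset,
        subClass b p D m n (imageClosed i G) (Ls.map MvPolynomial.X).prod) ?_ ?_
      · rw [← Finset.sum_coe_sort (finite_components ((x j).pullback i).support).toFinset
          fun G => subClass b p D m n (imageClosed i G) (Ls.map MvPolynomial.X).prod]
        refine Finset.sum_congr rfl fun G _ => ?_
        rw [subClass_prod (hsub G.1 ((hA G.1).1 G.2)).toIsSub, List.map_map]
        refine Cycle.cls_congr ?_
        rw [List.forall₂_map_left_iff, List.forall₂_map_right_iff]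
        exact List.forall₂_same.2 fun L _ => (L.iso_pullback_comp i (redι G.1)).symm
      · refine Finset.sum_bij (fun G _ => imageClosed i G) ?_ ?_ ?_ ?_
        · intro G hG
          rw [Set.Finite.mem_toFinset, ← himage, imageClosed_mem_components]
          exact (hA G).1 hG
        · exact fun G _ G' _ e => imageClosed_injective i e
        · intro G hG
          rw [Set.Finite.mem_toFinset] at hG
          obtain ⟨G', rfl⟩ := exists_imageClosed_eq i G (by
            rw [h.range]
            exact hG.1.2.trans inf_le_left)
          rw [← himage, imageClosed_mem_components] at hG
          exact ⟨G', (hA G').2 hG, rfl⟩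
        · exact fun _ _ => rfl
    have := congrArg (fun f => f Q) key
    simpa using this

theorem sum_subClass_insert [Mono m] (hx : SNCFamily q x) {J : Finset ι}
    (h : ∀ F ∈ components (face x J), ∃ (d : Cycle b p D) (i : d.Y ⟶ S),
      IsMonomialSub q x m n d F i) {j : ι} (hj : j ∉ J) :
    (∀ G ∈ components (face x (insert j J)), ∃ (d : Cycle b p D) (i : d.Y ⟶ S),
      IsMonomialSub q x m n d G i) ∧
    ∀ Q, ∑ F ∈ (finite_components (face x J)).toFinset,
        subClass b p D m n F (MvPolynomial.X (x j).bundle * Q) =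
      ∑ G ∈ (finite_components (face x (insert j J))).toFinset, subClass b p D m n G Q := by
  classical
  constructor
  · intro G hG
    obtain ⟨F, hF, hG⟩ := hx.mem_components_insert.1 hG
    obtain ⟨d, i, hd⟩ := h F hF
    exact (subClass_X_mul hx hF hd hj).1 G hG
  · intro Q
    -- Components of the smaller face are distributed, without repetition, among the disjoint
    -- components of the larger one.
    have e : (finite_components (face x (insert j J))).toFinset =
        (finite_components (face x J)).toFinset.biUnion fun F =>
          (finite_components (F ⊓ (x j).support)).toFinset := by
      ext G
      simp [hx.mem_components_insert]
    rw [e, Finset.sum_biUnion]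
    · refine Finset.sum_congr rfl fun F hF => ?_
      rw [Set.Finite.mem_toFinset] at hF
      obtain ⟨d, i, hd⟩ := h F hF
      exact (subClass_X_mul hx hF hd hj).2 Q
    · intro F hF F' hF' hne
      refine Finset.disjoint_left.2 fun G hG hG' => hne ?_
      rw [Finset.mem_coe, Set.Finite.mem_toFinset] at hF hF'
      rw [Set.Finite.mem_toFinset] at hG hG'
      obtain ⟨y, hy⟩ := hG.1.1.nonempty
      exact hx.component_eq hF hF' (hG.1.2 hy).1 (hG'.1.2 hy).1

/-- Cutting with one member at a time, the product of the Chern classes of the members of `J`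
becomes the face of `J`. -/
theorem sum_subClass_prod [Mono m] (hx : SNCFamily q x)
    (h : ∀ F ∈ components (⊤ : Closeds S), ∃ (d : Cycle b p D) (i : d.Y ⟶ S),
      IsMonomialSub q x m n d F i) (J : Finset ι) :
    (∀ G ∈ components (face x J), ∃ (d : Cycle b p D) (i : d.Y ⟶ S),
      IsMonomialSub q x m n d G i) ∧
    ∀ Q, ∑ F ∈ (finite_components (⊤ : Closeds S)).toFinset,
        subClass b p D m n F ((∏ j ∈ J, MvPolynomial.X (x j).bundle) * Q) =
      ∑ G ∈ (finite_components (face x J)).toFinset, subClass b p D m n G Q := by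
  induction J using Finset.induction_on with
  | empty =>
    have e : face x ∅ = ⊤ := by simp [face]
    simp only [e]
    exact ⟨h, fun Q => by simp⟩
  | insert j J hj ih =>
    obtain ⟨h1, h2⟩ := sum_subClass_insert hx ih.1 hj
    refine ⟨h1, fun Q => ?_⟩
    rw [← h2, ← ih.2, Finset.prod_insert hj]
    refine Finset.sum_congr rfl fun F _ => congrArg _ ?_
    ring

end SubClass

end

section

theorem foldr_eq_prod_apply {R V α : Type*} [Semiring R] [AddCommMonoid V] [Module R V]
    (f : α → Module.End R V) (l : List α) (v : V) :
    l.foldr (fun a => f a) v = (l.map f).prod v := by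
  induction l with
  | nil => rfl
  | cons a l ih => rw [List.foldr_cons, ih, List.map_cons, List.prod_cons, Module.End.mul_apply]

/-! ### Divisor classes as polynomials in line bundles of the ambient scheme -/

section DivisorEvaluation

variable {k : Type u} [Field k] {P X X' X'' S M : Scheme.{u}} {b : P ⟶ Spec (CommRingCat.of k)}
  {p : X ⟶ P} {p' : X' ⟶ P} {p'' : X'' ⟶ P} {D : List (PseudoDivisor P)}

theorem foldr_chernFree_single (e : Cycle b p D) (Ls : List (LineBundle e.Y))
    (Ms : List (LineBundle X)) (a : Lazard) :
    Ms.foldr (fun L => chernFree (b := b) (p := p) (D := D) L)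
      (Finsupp.single (e.withBundles Ls) a) =
      Finsupp.single (e.withBundles (Ls ++ (Ms.map fun L => L.pullback e.f).reverse)) a := by
  induction Ms with
  | nil => simp
  | cons L Ms ih =>
    rw [List.foldr_cons, ih, chernFree, Finsupp.lmapDomain_apply, Finsupp.mapDomain_single,
      List.map_cons, List.reverse_cons, ← List.append_assoc]
    rfl

theorem pushFree_pushFree (g : X' ⟶ X) [IsProper g] (hg : g ≫ p = p') (g' : X'' ⟶ X')
    [IsProper g'] (hg' : g' ≫ p' = p'') (h : (g' ≫ g) ≫ p = p'') (x : Free b p'' D) :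
    pushFree g hg (pushFree g' hg' x) = pushFree (g' ≫ g) h x := by
  have e : ∀ c : Cycle b p'' D, (c.push g' hg').push g hg = c.push (g' ≫ g) h := by
    intro c
    simp only [Cycle.push, Category.assoc]
  induction x using Finsupp.induction_linear with
  | zero => simp
  | add x y hx hy => rw [map_add, map_add, hx, hy, map_add]
  | single c a => rw [pushFree_single, pushFree_single, pushFree_single, e]

theorem mkQ_foldr_chernSeries (e : Cycle b p D) (Ms : List (LineBundle X)) {m : ℕ}
    (φ : MvPowerSeries (Fin m) Lazard) (Ls : Fin m → LineBundle e.Y) :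
    (relations b p D).mkQ (Ms.foldr (fun L => chernFree L) (e.chernSeries φ Ls)) =
      e.eval ((e.bundles.map MvPolynomial.X).prod *
        (Ms.map fun L => MvPolynomial.X (L.pullback e.f)).prod *
        truncEval (natDim e.Y) φ fun i => MvPolynomial.X (Ls i)) := by
  rw [foldr_eq_prod_apply, Cycle.chernSeries, map_sum, map_sum, truncEval,
    Finset.mul_sum, map_sum]
  refine Finset.sum_congr rfl fun a _ => ?_
  rw [← foldr_eq_prod_apply (V := Free b p D), foldr_chernFree_single, Cycle.mkQ_single,
    mul_smul_comm, map_smul, ← Cycle.prod_flatMap_replicate, ← Cycle.eval_prod]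
  congr 2
  simp only [List.map_append, List.prod_append, List.map_reverse, List.prod_reverse, List.map_map]
  rw [mul_right_comm]
  rfl

theorem push_eval (g : X' ⟶ X) [IsProper g] (hg : g ≫ p = p') (e : Cycle b p' D)
    (Q : MvPolynomial (LineBundle e.Y) Lazard) :
    Omega.push g hg (e.eval Q) = (e.push g hg).eval Q := by
  have : Omega.push g hg ∘ₗ e.eval = (show MvPolynomial (LineBundle e.Y) Lazard →ₗ[Lazard] _
      from (e.push g hg).eval) := by
    refine linearMap_ext_list fun Ls => ?_
    rw [LinearMap.comp_apply, Cycle.eval_prod]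
    refine Eq.trans ?_ (Cycle.eval_prod (e.push g hg) Ls).symm
    exact congrArg (relations b p D).mkQ (pushFree_single g hg (e.withBundles Ls) 1)
  exact LinearMap.congr_fun this Q

theorem prod_map_X_eq {c : Cycle b p D} {Ls Ms : List (LineBundle c.Y)}
    (h : List.Forall₂ LineBundle.Iso Ls Ms) :
    c.toChern (Ls.map MvPolynomial.X).prod = c.toChern (Ms.map MvPolynomial.X).prod := by
  rw [map_list_prod, map_list_prod, List.map_map, List.map_map]
  congr 1
  induction h with
  | nil => rfl
  | cons h _ ih =>
    rw [List.map_cons, List.map_cons, ih]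
    congr 1
    exact Cycle.chern_eq_of_iso h

variable {m : M ⟶ S} {n : M ⟶ X} [Mono m]

theorem subClass_eq_push (g : X' ⟶ X) [IsProper g] (hg : g ≫ p = p')
    (e : Cycle b p' D) {F : Closeds S} {i : e.Y ⟶ S} (hi : IsSub m n (e.push g hg) F i)
    (Q : MvPolynomial (LineBundle S) Lazard) :
    subClass b p D m n F Q = Omega.push g hg
      (e.eval (MvPolynomial.rename (fun L : LineBundle S => L.pullback i) Q)) := by
  rw [push_eval]
  exact LinearMap.congr_fun (subClass_eq hi) Q

theorem rename_prod_X (i : X' ⟶ S) (Ms : List (LineBundle S)) :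
    MvPolynomial.rename (fun L : LineBundle S => L.pullback i)
      ((Ms.map (MvPolynomial.X (R := Lazard))).prod) =
      ((Ms.map fun L => L.pullback i).map MvPolynomial.X).prod := by
  rw [map_list_prod, List.map_map, List.map_map]
  congr 2
  ext1 L
  simp

theorem rename_truncEval (i : X' ⟶ S) {r : ℕ} (N : ℕ) (φ : MvPowerSeries (Fin r) Lazard)
    (Ls : Fin r → LineBundle S) :
    MvPolynomial.rename (fun L : LineBundle S => L.pullback i)
      (truncEval N φ fun j => MvPolynomial.X (R := Lazard) (Ls j)) =
      truncEval N φ fun j => MvPolynomial.X ((Ls j).pullback i) := by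
  rw [map_truncEval]
  congr 1
  ext1 j
  simp

/-- `Cycle.eval` factors through the Chern ring, so bundles matter only through their Chern
operators and any truncation bound at least the dimension gives the same class. -/
theorem mkQ_chernSeries_eq_subClass (g : X' ⟶ X) [IsProper g] (hg : g ≫ p = p')
    (e : Cycle b p' D) (he : e.bundles = []) {F : Closeds S} {i : e.Y ⟶ S}
    (hi : IsSub m n (e.push g hg) F i) {Ms : List (LineBundle X')} {Ms' : List (LineBundle S)}
    (hMs : List.Forall₂ (fun L L' => LineBundle.Iso (L.pullback e.f) (L'.pullback i)) Ms Ms')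
    {r : ℕ} (φ : MvPowerSeries (Fin r) Lazard) {Ls : Fin r → LineBundle e.Y}
    {Ls' : Fin r → LineBundle S} (hLs : ∀ j, e.chern (Ls j) = e.chern ((Ls' j).pullback i)) {N : ℕ}
    (hN : natDim e.Y ≤ N) :
    (relations b p D).mkQ (pushFree g hg (Ms.foldr (fun L => chernFree L) (e.chernSeries φ Ls))) =
      subClass b p D m n F ((Ms'.map MvPolynomial.X).prod *
        truncEval N φ fun j => MvPolynomial.X (Ls' j)) := by
  rw [subClass_eq_push g hg e hi]
  have h0 : ∀ v : Free b p' D, (relations b p D).mkQ (pushFree g hg v) =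
      Omega.push g hg ((relations b p' D).mkQ v) := fun v => rfl
  rw [h0, mkQ_foldr_chernSeries]
  refine congrArg (Omega.push g hg) ?_
  refine Cycle.eval_eq_of_toChern_eq ?_
  rw [he, List.map_nil, List.prod_nil, one_mul, map_mul, map_mul, map_mul, rename_prod_X,
    rename_truncEval, Cycle.toChern_truncEval le_rfl, Cycle.toChern_truncEval hN]
  refine congrArg₂ (· * ·) ?_ ?_
  · have e2 : (Ms.map fun L => MvPolynomial.X (R := Lazard) (L.pullback e.f)).prod =
        ((Ms.map fun L => L.pullback e.f).map MvPolynomial.X).prod := by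
      rw [List.map_map]
      rfl
    rw [e2]
    refine prod_map_X_eq ?_
    rwa [List.forall₂_map_left_iff, List.forall₂_map_right_iff]
  · exact congrArg (fun a => nilEval a φ) (funext hLs)

end DivisorEvaluation

/-! ### The class of a divisor and the first Chern class of its bundle -/

section IntersectionFormula

variable {k : Type u} [Field k] {P X : Scheme.{u}} {b : P ⟶ Spec (CommRingCat.of k)}
  {p : X ⟶ P} {D : List (PseudoDivisor P)}

theorem isSub_top (c : Cycle b p D) : IsSub (𝟙 c.Y) c.f c ⊤ (𝟙 c.Y) :=
  ⟨inferInstance, by simp, 𝟙 _, Category.id_comp _, Category.id_comp _⟩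

theorem subClass_top (c : Cycle b p D) : subClass b p D (𝟙 c.Y) c.f ⊤ = c.eval := by
  refine linearMap_ext_list fun Ls => ?_
  rw [subClass_prod (isSub_top c), Cycle.eval_prod]
  refine (Cycle.cls_congr ?_).symm
  rw [List.forall₂_map_right_iff]
  exact List.forall₂_same.2 fun L _ => (LineBundle.Iso.refl L).pullback_id

theorem components_top (Y : Scheme.{u}) [IrreducibleSpace Y] :
    components (⊤ : Closeds Y) = {⊤} := by
  have htop : IsIrreducible ((⊤ : Closeds Y) : Set Y) := IrreducibleSpace.isIrreducible_univ Y
  ext F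
  constructor
  · exact fun hF => le_antisymm le_top (hF.2 ⟨htop, le_rfl⟩ le_top)
  · rintro rfl
    exact ⟨⟨htop, le_rfl⟩, fun _ _ _ => le_top⟩

/-- The first Chern class of the bundle of a divisor with simple normal crossings, as a sum over
the faces of the divisor. -/
theorem Cycle.eval_mul_X_bundle (c : Cycle b p D) {C : PseudoDivisor c.Y}
    (σ : SNCDecomposition (c.f ≫ p ≫ b) C)
    (hreg : ∀ y : c.Y, IsRegularLocalRing (c.Y.presheaf.stalk y))
    (Q : MvPolynomial (LineBundle c.Y) Lazard) :
    c.eval (Q * MvPolynomial.X C.bundle) = ∑ J : {J : Finset (Fin σ.m) // J.Nonempty},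
      c.eval ((∏ j ∈ J.1, MvPolynomial.X (σ.comp j).bundle) *
        (Q * truncEval (natDim c.Y) (fglFace σ.mult J.1)
          fun i => MvPolynomial.X (σ.comp i).bundle)) := by
  have hσ := σ.family hreg
  have ha : ∀ i, IsNilpotent (c.chern (σ.comp i).bundle) := fun i => isNilpotent_chern _
  rw [← map_sum]
  refine eval_eq_of_toChern_eq ?_
  have h1 : c.toChern (MvPolynomial.X C.bundle) = _ := chern_bundle_eq σ.comp σ.mult C hσ.isDomain
    σ.ideal_eq hσ.eqn_ne_zero
  rw [map_mul, h1, fglSum_eq_sum_fglFace, nilEval_sum ha, Finset.mul_sum, map_sum]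
  refine Finset.sum_congr rfl fun J _ => ?_
  rw [nilEval_mul ha, nilEval_prod_X ha, map_mul, map_mul, toChern_truncEval le_rfl, map_prod]
  simp only [chern]
  ring

/-- The face reaches `X` through `|C|` by the same morphism as through the source of `c`, and
bundles pulled back in two stages are isomorphic to those pulled back directly. -/
theorem Cycle.mkQ_faceCycle (c : Cycle b p D) {C : PseudoDivisor c.Y}
    (h : IsAdmissibleDivisor (c.f ≫ p ≫ b) (c.f ≫ p) C D)
    (σ : SNCDecomposition (c.f ≫ p ≫ b) C) {J : Finset (Fin σ.m)} (hJ : J.Nonempty)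
    {F : Closeds c.Y} (hF : F ∈ components (σ.face J)) (g : red C.support ⟶ X) [IsProper g]
    (hg : g = redι C.support ≫ c.f) (hgp : g ≫ p = redι C.support ≫ c.f ≫ p)
    (Ms : List (LineBundle c.Y)) (φ : MvPowerSeries (Fin σ.m) Lazard) :
    (relations b p D).mkQ (pushFree g hgp
      ((Ms.map fun L => L.pullback (redι C.support)).foldr (fun L => chernFree L)
        ((faceCycle (Category.assoc c.f p b) rfl h σ J hJ F hF).chernSeries φ
          fun i => (σ.comp i).bundle.pullback (redι F)))) =
      subClass b p D (𝟙 c.Y) c.f F ((Ms.map MvPolynomial.X).prod *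
        truncEval (natDim c.Y) φ fun i => MvPolynomial.X (σ.comp i).bundle) := by
  have hle : Set.range (redι F) ⊆ C.support := by
    rw [range_redι]
    exact hF.1.2.trans (σ.face_le hJ)
  have := isIntegral_red F hF.1.1
  have hfac : redι F ≫ c.f = redLift (redι F) C.support hle ≫ g := by
    rw [hg, ← Category.assoc, redLift_redι]
  have hN : natDim (red F) ≤ natDim c.Y := c.sm.natDim_le (redι F)
  refine mkQ_chernSeries_eq_subClass (i := redι F) g hgp
    (faceCycle (Category.assoc c.f p b) rfl h σ J hJ F hF) rfl ?_ ?_ φ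
    (fun j => rfl)
    hN
  · refine ⟨inferInstanceAs (IsClosedImmersion (redι F)), range_redι F, redι F,
      Category.comp_id _, hfac⟩
  · rw [List.forall₂_map_left_iff]
    refine List.forall₂_same.2 fun L _ => ?_
    have e := L.iso_pullback_comp (redι C.support) (redLift (redι F) C.support hle)
    rw [redLift_redι] at e
    exact e.symm

/-- The image in the cobordism of `X` of the class of the divisor `C` on the source of `c` is the
class of `c` with the bundle of `C` added. -/
theorem Cycle.mkQ_pushFree_divisorCycle (c : Cycle b p D) {κ : Type*} [Fintype κ]
    {x : κ → PseudoDivisor c.Y} (hx : SNCFamily (c.f ≫ p ≫ b) x)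
    (hirr : ∀ l, IsPreirreducible ((x l).support : Set c.Y)) (hmon : IsMonomial x (c.f ≫ p) D)
    {C : PseudoDivisor c.Y} (h : IsAdmissibleDivisor (c.f ≫ p ≫ b) (c.f ≫ p) C D)
    (hle : ∀ y ∈ C.support, ∃ l, y ∈ (x l).support) (g : red C.support ⟶ X) [IsProper g]
    (hg : g = redι C.support ≫ c.f) (hgp : g ≫ p = redι C.support ≫ c.f ≫ p)
    (Ms : List (LineBundle c.Y)) :
    (relations b p D).mkQ (pushFree g hgp
      (Ms.foldr (fun L => chernFree (L.pullback (redι C.support)))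
        (divisorCycle (Category.assoc ..) rfl h))) =
      c.eval ((Ms.map MvPolynomial.X).prod * MvPolynomial.X C.bundle) := by
  classical
  have hnoeth := c.sm.noetherianSpace
  set σ := Classical.choice h.snc with hσ
  obtain ⟨l, hl, hlx⟩ := hx.exists_matching hirr σ hle
  -- Members matched with components of `C` are replaced by those components, so that the bundles
  -- agree literally and not only up to isomorphism.
  let x' : κ → PseudoDivisor c.Y := Function.extend l σ.comp x
  have hx'l : ∀ j, x' (l j) = σ.comp j := hl.extend_apply σ.comp x
  have hxx' : ∀ i y, (x' i).idealAt y = (x i).idealAt y := by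
    intro i y
    by_cases hi : ∃ j, l j = i
    · obtain ⟨j, rfl⟩ := hi
      rw [hx'l, hlx]
    · rw [show x' i = x i from Function.extend_apply' _ _ _ hi]
  have hx' := hx.congr hxx'
  have hmon' := hmon.congr hxx'
  have htop : ∀ F ∈ components (⊤ : Closeds c.Y), ∃ (d : Cycle b p D) (i : d.Y ⟶ c.Y),
      IsMonomialSub (c.f ≫ p ≫ b) x' (𝟙 c.Y) c.f d F i := by
    intro F hF
    rw [components_top] at hF
    obtain rfl : F = ⊤ := hF
    refine ⟨c, 𝟙 _, isSub_top c, Category.id_comp _, ?_⟩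
    simpa using hmon'.pullback (𝟙 c.Y)
  have hface : ∀ J : Finset (Fin σ.m), face x' (J.map ⟨l, hl⟩) = σ.face J := by
    intro J
    ext y
    change y ∈ face x' _ ↔ y ∈ face σ.comp J
    simp [mem_face, hx'l]
  rw [c.eval_mul_X_bundle σ hx.regular]
  have hL : Ms.foldr (fun L => chernFree (L.pullback (redι C.support)))
        (divisorCycle (Category.assoc c.f p b) rfl h) =
      (Ms.map fun L => L.pullback (redι C.support)).foldr (fun L => chernFree L)
        (divisorCycle (Category.assoc c.f p b) rfl h) := by
    rw [List.foldr_map]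
  rw [hL, foldr_eq_prod_apply, divisorCycle, map_sum, map_sum, map_sum]
  refine Finset.sum_congr rfl fun J _ => ?_
  have hcomp : ∏ j ∈ J.1, MvPolynomial.X (R := Lazard) (σ.comp j).bundle =
      ∏ j ∈ J.1.map ⟨l, hl⟩, MvPolynomial.X (x' j).bundle := by
    rw [Finset.prod_map]
    refine Finset.prod_congr rfl fun j _ => ?_
    exact congrArg (fun D : PseudoDivisor c.Y => MvPolynomial.X (R := Lazard) D.bundle)
      (hx'l j).symm
  have hsum := (sum_subClass_prod hx' htop (J.1.map ⟨l, hl⟩)).2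
    ((Ms.map MvPolynomial.X).prod * truncEval (natDim c.Y) (fglFace σ.mult J.1)
          fun i => MvPolynomial.X (σ.comp i).bundle)
  have htop' : (finite_components (⊤ : Closeds c.Y)).toFinset = {⊤} := by
    ext F
    rw [Set.Finite.mem_toFinset, components_top]
    simp
  rw [htop', Finset.sum_singleton, subClass_top] at hsum
  simp only [hface] at hsum
  rw [hcomp, hsum, map_sum, map_sum, map_sum]
  refine Eq.trans (Finset.sum_congr rfl fun F _ => ?_) (Finset.sum_coe_sort
    (finite_components (σ.face J.1)).toFinset fun F => subClass b p D (𝟙 c.Y) c.f F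
      ((Ms.map MvPolynomial.X).prod * truncEval (natDim c.Y) (fglFace σ.mult J.1)
        fun i => MvPolynomial.X (σ.comp i).bundle))
  rw [← foldr_eq_prod_apply (fun L => chernFree (b := b) (p := redι C.support ≫ c.f ≫ p)
    (D := D) L)]
  exact c.mkQ_faceCycle h σ J.2 ((Set.Finite.mem_toFinset _).1 F.2) g hg hgp Ms _

end IntersectionFormula

end

section

/-! ### Admissible divisors and uniqueness of exponents -/

section AdmissibleDivisors

variable {k : Type u} [Field k] {P Y G : Scheme.{u}} {ι κ : Type*}
  {q : Y ⟶ Spec (CommRingCat.of k)} {r : Y ⟶ P} {D : List (PseudoDivisor P)}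

theorem IsMonomial.of_comp [Fintype ι] [Fintype κ] {x : ι → PseudoDivisor Y}
    {z : κ → PseudoDivisor Y} (l : κ → ι) (h : IsMonomial z r D)
    (hl : ∀ j y, (z j).idealAt y = (x (l j)).idealAt y) : IsMonomial x r D := by
  classical
  refine fun s => (h s).imp id fun ⟨a, ha⟩ => ⟨fun i => ∑ j with l j = i, a j, fun y => ?_⟩
  rw [ha]
  simp_rw [← Finset.prod_pow_eq_pow_sum]
  rw [← Finset.prod_fiberwise (s := Finset.univ) (g := l)]
  refine Finset.prod_congr rfl fun i _ => Finset.prod_congr rfl fun j hj => ?_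
  rw [hl, (Finset.mem_filter.1 hj).2]

theorem face_map_eq {x : ι → PseudoDivisor Y} {z : κ → PseudoDivisor Y} (l : κ → ι)
    (hl : Function.Injective l) (h : ∀ j y, (z j).idealAt y = (x (l j)).idealAt y)
    (J : Finset κ) : face x (J.map ⟨l, hl⟩) = face z J := by
  ext y
  change y ∈ face x _ ↔ y ∈ face z J
  have : ∀ j, (z j).support = (x (l j)).support := fun j =>
    PseudoDivisor.support_eq_of_idealAt (h j)
  simp [mem_face, this]

/-- A divisor supported on a family with simple normal crossings in which the sequence `D` is
monomial is admissible. -/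
theorem SNCFamily.isAdmissibleDivisor [Fintype ι] {x : ι → PseudoDivisor Y} (hx : SNCFamily q x)
    (hirr : ∀ l, IsPreirreducible ((x l).support : Set Y)) (hY : IsSm q) {C : PseudoDivisor Y}
    (hC : IsSNC q C) (hle : ∀ y ∈ C.support, ∃ l, y ∈ (x l).support)
    (hmon : ∀ F : Closeds Y, IsIrreducible (F : Set Y) → F ≤ C.support →
      IsMonomial (fun l => (x l).pullback (redι F)) (redι F ≫ r) D) :
    IsAdmissibleDivisor q r C D := by
  classical
  refine ⟨hY, hC, fun σ J hJ F hF => ?_⟩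
  obtain ⟨l, hl, hlx⟩ := hx.exists_matching hirr σ hle
  have hF' : F ∈ components (face x (J.map ⟨l, hl⟩)) := by
    rw [face_map_eq l hl hlx]
    exact hF
  have himm := hx.isFaceImmersion hF' (redι F) (range_redι F)
  have := (hY.of_isClosedImmersion (redι F) (σ.smooth_face J hJ F hF)).noetherianSpace
  exact ((hmon F hF.1.1 (hF.1.2.trans (σ.face_le hJ))).restrict himm).isAdmissibleIrr
    (himm.restrict hx)

/-- The exponents of a product of members of a family with simple normal crossings are determined
at the points of the members. -/
theorem SNCFamily.exponent_eq [Fintype ι] {x : ι → PseudoDivisor Y} (hx : SNCFamily q x)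
    {a a' : ι → ℕ} {y : Y}
    (h : ∏ l, (x l).idealAt y ^ a l = ∏ l, (x l).idealAt y ^ a' l) {i : ι}
    (hi : y ∈ (x i).support) : a i = a' i := by
  classical
  have hdom := hx.isDomain y
  have key : ∀ {a a' : ι → ℕ}, ∏ l, (x l).idealAt y ^ a l = ∏ l, (x l).idealAt y ^ a' l →
      ¬ a i < a' i := by
    intro a a' h hlt
    have h' : Associated (∏ l, (x l).eqn y ^ a l) (∏ l, (x l).eqn y ^ a' l) := by
      rw [← Ideal.span_singleton_eq_span_singleton]
      simpa only [PseudoDivisor.idealAt, Ideal.span_singleton_pow, Ideal.prod_span_singleton] using h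
    have hdvd := h'.symm.dvd
    rw [← Finset.mul_prod_erase _ _ (Finset.mem_univ i),
      ← Finset.mul_prod_erase _ _ (Finset.mem_univ i)] at hdvd
    have hp := hx.prime_eqn i hi
    -- After cancelling the common power, the equation of `x i` would divide a product of the other
    -- members, hence be associated to one of them.
    have h1 : (x i).eqn y ^ (a i) * (x i).eqn y ∣ (x i).eqn y ^ (a i) *
        ∏ l ∈ Finset.univ.erase i, (x l).eqn y ^ a l := by
      refine dvd_trans ?_ hdvd
      rw [← pow_succ]
      exact (pow_dvd_pow _ hlt).mul_right _
    have h2 := (mul_dvd_mul_iff_left (pow_ne_zero _ hp.ne_zero)).1 h1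
    obtain ⟨l, hl, h3⟩ := (hp.dvd_finsetProd_iff _).1 h2
    have h4 := hp.dvd_of_dvd_pow h3
    have hly : y ∈ (x l).support := by
      by_contra hn
      have hu : IsUnit ((x l).eqn y) := by simpa [PseudoDivisor.mem_support_iff] using hn
      exact hp.not_isUnit (isUnit_of_dvd_unit h4 hu)
    exact (Finset.ne_of_mem_erase hl) (hx.not_associated hi hly
      (hp.associated_of_dvd (hx.prime_eqn l hly) h4)).symm
  exact le_antisymm (not_lt.1 (key h.symm)) (not_lt.1 (key h))

end AdmissibleDivisors

/-! ### Reduced divisors that are images of sections -/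

section Sections

/-- Elements that become independent modulo the kernel of a surjection stay independent after
adjoining an element of the kernel. -/
theorem IndepModSq.option {R S : Type*} [CommRing R] [IsLocalRing R] [CommRing S] [IsLocalRing S]
    {ι : Type*} [Fintype ι] {φ : R →+* S} [IsLocalHom φ] {z : ι → R} {d : R}
    (h : IndepModSq (fun i => φ (z i))) (hd : d ∈ IsLocalRing.maximalIdeal R)
    (hd2 : d ∉ IsLocalRing.maximalIdeal R ^ 2) (hφ : φ d = 0) :
    IndepModSq (fun i : Option ι => i.elim d z) := by
  have hmem : ∀ {a : R}, φ a ∈ IsLocalRing.maximalIdeal S → a ∈ IsLocalRing.maximalIdeal R := by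
    intro a ha
    rw [IsLocalRing.mem_maximalIdeal] at ha ⊢
    exact fun hu => ha (hu.map φ)
  have hle : (IsLocalRing.maximalIdeal R).map φ ≤ IsLocalRing.maximalIdeal S :=
    ((IsLocalRing.local_hom_TFAE φ).out 0 2).1 ‹_›
  have hz : ∀ i, z i ∈ IsLocalRing.maximalIdeal R := fun i => hmem (h.mem i)
  refine ⟨fun i => ?_, fun a ha => ?_⟩
  · cases i with
    | none => exact hd
    | some i => exact hz i
  -- Applying `φ` removes `d`, so the coefficients of the `z i` are not units; what is left then
  -- forces the coefficient of `d` into the maximal ideal.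
  · have h1 : ∀ i, a (some i) ∈ IsLocalRing.maximalIdeal R := by
      intro i
      refine hmem (h.indep (fun i => φ (a (some i))) ?_ i)
      have h2 : φ (∑ i : Option ι, a i * i.elim d z) ∈ IsLocalRing.maximalIdeal S ^ 2 := by
        refine (Ideal.pow_right_mono hle 2) ?_
        rw [← Ideal.map_pow]
        exact Ideal.mem_map_of_mem φ ha
      rw [Fintype.sum_option, map_add, map_sum] at h2
      simpa [hφ] using h2
    intro i
    cases i with
    | some i => exact h1 i
    | none =>
      by_contra hu
      replace hu : IsUnit (a none) := by simpa using hu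
      refine hd2 ((Ideal.unit_mul_mem_iff_mem _ hu).1 ?_)
      rw [Fintype.sum_option] at ha
      refine (Ideal.add_mem_iff_left _ (Ideal.sum_mem _ fun i _ => ?_)).1 ha
      rw [pow_two]
      exact Ideal.mul_mem_mul (h1 i) (hz i)

variable {k : Type u} [Field k] {T W : Scheme.{u}} {t : T ⟶ Spec (CommRingCat.of k)}
  {D : PseudoDivisor T}

/-- A radical ideal is the intersection of the primes over it. Each of these belongs to a point of
the section, where the elements of the kernel vanish. -/
theorem ker_stalkMap_eq_idealAt [IsReduced W] (s : W ⟶ T) [IsClosedImmersion s]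
    (hs : (D.support : Set T) = Set.range s) (hred : ∀ x, (D.idealAt x).IsRadical) (v : W) :
    RingHom.ker (s.stalkMap v).hom = D.idealAt (s v) := by
  refine le_antisymm (fun a ha => ?_) ?_
  · refine hred _ ?_
    rw [Ideal.radical_eq_sInf, Submodule.mem_sInf]
    rintro 𝔭 ⟨hle, h𝔭⟩
    obtain ⟨ζ, hζ, e⟩ := exists_primeOf_eq (s v) 𝔭
    have hζD : ζ ∈ D.support := (D.eqn_mem_primeOf hζ).1 (e.symm ▸ hle
      (Ideal.mem_span_singleton_self _))
    obtain ⟨ζ', rfl⟩ : ζ ∈ Set.range s := hs ▸ hζD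
    rw [← e]
    exact mem_primeOf_of_stalkMap_eq_zero s (s.isClosedEmbedding.isInducing.specializes_iff.1 hζ)
      a ha
  · rw [PseudoDivisor.idealAt, Ideal.span_singleton_le_iff_mem]
    exact eqn_pullback_eq_zero D s (fun g => (hs ▸ Set.mem_range_self g : s g ∈ (D.support : Set T)))
      v

/-- The ideal of `D` is the kernel of a map to a domain, so its equation is prime. It divides the
product of the components of `D`, hence is associated to one of them, and that one is part of a
regular system of parameters. -/
theorem eqn_notMem_sq_of_section [IsReduced W] (s : W ⟶ T) [IsClosedImmersion s]
    (hs : (D.support : Set T) = Set.range s) (hred : ∀ x, (D.idealAt x).IsRadical)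
    (hreg : ∀ y : T, IsRegularLocalRing (T.presheaf.stalk y)) (hD : IsSNC t D) (v : W)
    [IsDomain (W.presheaf.stalk v)] :
    D.eqn (s v) ∉ IsLocalRing.maximalIdeal (T.presheaf.stalk (s v)) ^ 2 := by
  obtain ⟨δ⟩ := hD
  have hδ := δ.family hreg
  have hdom := hδ.isDomain (s v)
  have hprime : (D.idealAt (s v)).IsPrime := by
    rw [← ker_stalkMap_eq_idealAt s hs hred v]
    exact RingHom.ker_isPrime _
  have hassoc : Associated (D.eqn (s v)) (∏ i, (δ.comp i).eqn (s v) ^ δ.mult i) := by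
    rw [← Ideal.span_singleton_eq_span_singleton]
    simpa only [PseudoDivisor.idealAt, Ideal.span_singleton_pow, Ideal.prod_span_singleton]
      using δ.ideal_eq (s v)
  have hne : D.eqn (s v) ≠ 0 := hassoc.ne_zero_iff.2
    (Finset.prod_ne_zero_iff.2 fun i _ => pow_ne_zero _ (hδ.eqn_ne_zero i _))
  have hp : Prime (D.eqn (s v)) := (Ideal.span_singleton_prime hne).1 hprime
  obtain ⟨i, -, hi⟩ := (hp.dvd_finsetProd_iff _).1 hassoc.dvd
  have hi' := hp.dvd_of_dvd_pow hi
  have hy : s v ∈ (δ.comp i).support := by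
    by_contra hn
    have hu : IsUnit ((δ.comp i).eqn (s v)) := by
      simpa [PseudoDivisor.mem_support_iff] using hn
    exact hp.not_isUnit (isUnit_of_dvd_unit hi' hu)
  have hass := hp.associated_of_dvd (hδ.prime_eqn i hy) hi'
  exact fun hmem => hδ.eqn_notMem_sq i hy (Ideal.mem_of_dvd _ hass.dvd hmem)

end Sections

end

/-! ### Components of a divisor near a section -/

section

variable {k : Type u} [Field k] {T W : Scheme.{u}} {t : T ⟶ Spec (CommRingCat.of k)}
  {w : W ⟶ Spec (CommRingCat.of k)}

theorem PseudoDivisor.idealAt_pullback_id (D : PseudoDivisor W) (v : W) :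
    (D.pullback (𝟙 W)).idealAt v = D.idealAt v := by
  rw [PseudoDivisor.idealAt_pullback, Scheme.Hom.stalkMap_id]
  exact Ideal.map_id _

/-- The equation of `D` vanishes at the generic point of `x l`, so it lies in the prime ideal
generated by the equation of `x l`. -/
theorem SNCFamily.eqn_dvd {ι : Type*} {x : ι → PseudoDivisor T} (hx : SNCFamily t x) (l : ι)
    {η : T} (hη : ∀ y ∈ (x l).support, η ⤳ y) {D : PseudoDivisor T} (hD : η ∈ D.support) {y : T}
    (hy : y ∈ (x l).support) : (x l).eqn y ∣ D.eqn y := by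
  have e : face x {l} = (x l).support := face_singleton x l
  obtain ⟨ζ, hζy, h1, hζ, -⟩ := hx.exists_generic (J := {l}) (e ▸ hy)
  have h2 : D.eqn y ∈ primeOf hζy := (D.eqn_mem_primeOf hζy).2
    (mem_closeds_of_specializes (hη ζ (e ▸ hζ)) hD)
  have h3 : faceIdeal x {l} y = Ideal.span {(x l).eqn y} := by
    rw [faceIdeal]
    congr 1
    ext a
    simp [eq_comm]
  rw [h1, h3] at h2
  exact Ideal.mem_span_singleton.1 h2

theorem SNCFamily.eq_of_generic_mem {ι : Type*} {x : ι → PseudoDivisor T} (hx : SNCFamily t x)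
    {l l' : ι} {η : T} (hη : η ∈ (x l).support) (hgen : ∀ y ∈ (x l).support, η ⤳ y)
    (h : η ∈ (x l').support) : l = l' := by
  have := hx.isDomain η
  exact hx.not_associated hη h
    ((hx.prime_eqn l hη).associated_of_dvd (hx.prime_eqn l' h) (hx.eqn_dvd l hgen h hη))

theorem idealAt_pullback_section_le (D : PseudoDivisor W) (D' : PseudoDivisor T) (s : W ⟶ T)
    (f : T ⟶ W) (hs : s ≫ f = 𝟙 W) (v : W) (h : D'.eqn (s v) ∣ (D.pullback f).eqn (s v)) :
    D.idealAt v ≤ (D'.pullback s).idealAt v := by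
  have h1 : ((D.pullback f).pullback s).idealAt v = D.idealAt v := by
    rw [PseudoDivisor.idealAt_pullback_comp, hs, PseudoDivisor.idealAt_pullback_id]
  have h2 : (D.pullback f).idealAt (s v) ≤ D'.idealAt (s v) :=
    Ideal.span_singleton_le_span_singleton.2 h
  rw [← h1, (D.pullback f).idealAt_pullback s v, D'.idealAt_pullback s v]
  exact Ideal.map_mono h2

/-- Over `V` the component of `B` is the whole preimage of one component of `Bbar`. Along the
section its equation divides the prime equation of that component without being a unit, so no
multiplicity can appear and the ideals agree. -/
theorem exists_idealAt_pullback_section_eq {B : PseudoDivisor T} {Bbar : PseudoDivisor W}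
    (σ : SNCDecomposition t B) (σ' : SNCDecomposition w Bbar)
    (hT : ∀ y : T, IsRegularLocalRing (T.presheaf.stalk y))
    (hW : ∀ y : W, IsRegularLocalRing (W.presheaf.stalk y)) (f : T ⟶ W) {V : Scheme.{u}} (ι : V ⟶ T)
    [IsOpenImmersion ι]
    (hopen : IsOpenMap (ι ≫ f)) (hirr : GeometricallyIrreducible (ι ≫ f))
    (hBV : (B.pullback ι).SameDiv (Bbar.pullback (ι ≫ f))) (s : W ⟶ V)
    (hs : s ≫ ι ≫ f = 𝟙 W) (i : Fin σ.m) (hi : ∃ v, (s ≫ ι) v ∈ (σ.comp i).support) :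
    ∃ j, (∀ v, ((σ.comp i).pullback (s ≫ ι)).idealAt v = (σ'.comp j).idealAt v) ∧
      ∀ z, ι z ∈ (σ.comp i).support ↔ (ι ≫ f) z ∈ (σ'.comp j).support := by
  have hσ := σ.family hT
  have hσ' := σ'.family hW
  obtain ⟨v₀, hv₀⟩ := hi
  obtain ⟨η, hη, hηgen⟩ := exists_generic _ (σ.irreducible i)
  have hind : ∀ {a b : V}, ι a ⤳ ι b → a ⤳ b := fun h =>
    ι.isOpenEmbedding.isInducing.specializes_iff.1 h
  obtain ⟨η', rfl⟩ : ∃ η' : V, ι η' = η :=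
    (hηgen _ hv₀).mem_open ι.isOpenEmbedding.isOpen_range ⟨s v₀, rfl⟩
  have hBB : ∀ z : V, ι z ∈ B.support ↔ (ι ≫ f) z ∈ Bbar.support := by
    intro z
    rw [← PseudoDivisor.mem_support_pullback, ← PseudoDivisor.mem_support_pullback,
      PseudoDivisor.support_eq_of_idealAt hBV]
  have hB : ∀ y, y ∈ B.support ↔ ∃ i, y ∈ (σ.comp i).support := fun y => by
    simpa [σ.mult_pos] using mem_support_iff_of_prod (σ.ideal_eq y)
  have hB' : ∀ y, y ∈ Bbar.support ↔ ∃ i, y ∈ (σ'.comp i).support := fun y => by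
    simpa [σ'.mult_pos] using mem_support_iff_of_prod (σ'.ideal_eq y)
  obtain ⟨j, hj⟩ := (hB' _).1 ((hBB η').1 ((hB _).2 ⟨i, hη⟩))
  let K : Closeds V := ((σ'.comp j).pullback (ι ≫ f)).support
  have hK : ∀ z, z ∈ K ↔ (ι ≫ f) z ∈ (σ'.comp j).support := fun z =>
    PseudoDivisor.mem_support_pullback _ _ z
  -- Open maps with geometrically irreducible fibres have irreducible preimages of irreducible sets.
  have hKirr : IsIrreducible (K : Set V) := by
    have := (ι ≫ f).isIrreducible_preimage hopen (σ'.irreducible j)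
    convert this using 1
    ext z
    exact hK z
  obtain ⟨κ, hκ, hκgen⟩ := exists_generic K hKirr
  -- The component of `B` through the generic point of the preimage also contains the generic point
  -- of the given component, so it is that component.
  have hκi : ι κ ∈ (σ.comp i).support := by
    obtain ⟨i', hi'⟩ := (hB _).1 ((hBB κ).2 ((hB' _).2 ⟨j, (hK κ).1 hκ⟩))
    have hηi' : ι η' ∈ (σ.comp i').support := mem_closeds_of_specializes
      ((hκgen η' ((hK η').2 hj)).map ι.continuous) hi'
    obtain rfl := hσ.eq_of_generic_mem hη hηgen hηi'
    exact hi'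
  have hsf : (s ≫ ι) ≫ f = 𝟙 W := by rw [Category.assoc, hs]
  have hsv : ∀ v, (ι ≫ f) (s v) = v := fun v => by
    rw [← Scheme.Hom.comp_apply, hs]
    rfl
  refine ⟨j, fun v => ?_, fun z => ⟨fun hz => (hK z).1
    (mem_closeds_of_specializes (hind (hηgen _ hz)) ((hK η').2 hj)), fun hz =>
    mem_closeds_of_specializes ((hκgen z ((hK z).2 hz)).map ι.continuous) hκi⟩⟩
  have := hσ'.isDomain v
  by_cases hv : v ∈ (σ'.comp j).support
  · have hvi : (s ≫ ι) v ∈ (σ.comp i).support :=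
      mem_closeds_of_specializes ((hκgen (s v) ((hK _).2 (by rwa [hsv]))).map ι.continuous) hκi
    have hdvd := hσ.eqn_dvd i hηgen (D := (σ'.comp j).pullback f)
      ((PseudoDivisor.mem_support_pullback _ _ _).2 hj) hvi
    have hle := idealAt_pullback_section_le (σ'.comp j) (σ.comp i) (s ≫ ι) f hsf v hdvd
    have hdvd' := Ideal.span_singleton_le_span_singleton.1 hle
    refine (PseudoDivisor.idealAt_eq_iff _ _ v).2 ?_
    obtain ⟨a, ha⟩ := hdvd'
    rcases (hσ'.prime_eqn j hv).irreducible.isUnit_or_isUnit ha with hu | hu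
    · have h1 : v ∈ ((σ.comp i).pullback (s ≫ ι)).support :=
        (PseudoDivisor.mem_support_pullback _ _ _).2 hvi
      exact absurd hu ((IsLocalRing.mem_maximalIdeal _).1 h1)
    · exact ⟨hu.unit, ha.symm⟩
  · have hvi : (s ≫ ι) v ∉ (σ.comp i).support := by
      intro hvi
      have h1 := (hK (s v)).1
        (mem_closeds_of_specializes (hind (hηgen _ hvi)) ((hK η').2 hj))
      rw [hsv] at h1
      exact hv h1
    rw [not_not.1 (mt ((σ'.comp j).mem_support_iff_idealAt v).2 hv),
      not_not.1 (mt (((σ.comp i).pullback (s ≫ ι)).mem_support_iff_idealAt v).2 ?_)]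
    rwa [PseudoDivisor.mem_support_pullback]

/-- A reduced divisor that is the image of a section, together with a family of divisors whose
pull-backs along the section have simple normal crossings. -/
theorem SNCFamily.option {ι : Type*} {x : ι → PseudoDivisor T} (hx : SNCFamily t x)
    {D : PseudoDivisor T} (hD : IsSNC t D) [IsReduced W] (s : W ⟶ T) [IsClosedImmersion s]
    (hst : s ≫ t = w) (hs : (D.support : Set T) = Set.range s)
    (hred : ∀ y, (D.idealAt y).IsRadical)
    (hfam : SNCFamily w (fun i : {i // ∃ v, s v ∈ (x i).support} => (x i.1).pullback s)) :
    SNCFamily t (fun o : Option ι => o.elim D x) := by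
  classical
  have hrange : ∀ y, y ∈ D.support ↔ ∃ v, s v = y := fun y => by
    change y ∈ (D.support : Set T) ↔ _
    rw [hs]
    rfl
  refine ⟨hx.regular, fun J y hy => ?_, fun J hJ F hF => ?_⟩
  · rw [mem_face] at hy
    by_cases hn : none ∈ J
    · obtain ⟨v, rfl⟩ := (hrange y).1 (hy none hn)
      let J' : Finset {i // ∃ v, s v ∈ (x i).support} :=
        (Finset.eraseNone J).subtype _
      have hv : v ∈ face (fun i : {i // ∃ v, s v ∈ (x i).support} => (x i.1).pullback s) J' := by
        refine mem_face.2 fun i hi => (PseudoDivisor.mem_support_pullback _ _ _).2 ?_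
        have := hy (some i.1) (by simpa [J'] using hi)
        exact this
      have h1 := hfam.indep J' v hv
      have hdom : IsDomain (W.presheaf.stalk v) := hfam.isDomain v
      have h2 : IndepModSq (fun i : J' => (s.stalkMap v).hom ((x i.1.1).eqn (s v))) := by
        convert h1 using 1
        ext i
        exact (PseudoDivisor.eqn_pullback _ _ _).symm
      -- The equations of the other members are independent already on the section; the equation of
      -- `D` vanishes there and lies outside the square of the maximal ideal.
      have h3 := h2.option (hy none hn)
        (eqn_notMem_sq_of_section s hs hred hx.regular hD v)
        (eqn_pullback_eq_zero D s (fun g => (hrange _).2 ⟨g, rfl⟩) v)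
      have hJ' : ∀ i : ι, some i ∈ J → ∃ h : ∃ v, s v ∈ (x i).support,
          (⟨i, h⟩ : {i // ∃ v, s v ∈ (x i).support}) ∈ J' := fun i hi =>
        ⟨⟨v, hy (some i) hi⟩, by simpa [J'] using hi⟩
      let φ : J → Option J' := fun o => match o with
        | ⟨none, _⟩ => none
        | ⟨some i, hi⟩ => some ⟨⟨i, (hJ' i hi).1⟩, (hJ' i hi).2⟩
      have hφ : Function.Injective φ := by
        rintro ⟨_ | a, ha⟩ ⟨_ | b, hb⟩ h
        · rfl
        · simp [φ] at h
        · simp [φ] at h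
        · simpa [φ] using h
      convert h3.comp φ hφ using 1
      ext ⟨_ | a, ha⟩ <;> rfl
    · have h1 := hx.indep (Finset.eraseNone J) y (mem_face.2 fun i hi =>
        hy (some i) (Finset.mem_eraseNone.1 hi))
      let φ : J → Finset.eraseNone J := fun o => match o with
        | ⟨none, h⟩ => absurd h hn
        | ⟨some i, hi⟩ => ⟨i, Finset.mem_eraseNone.2 hi⟩
      have hφ : Function.Injective φ := by
        rintro ⟨_ | a, ha⟩ ⟨_ | b, hb⟩ h
        · rfl
        · exact absurd ha hn
        · exact absurd hb hn
        · simpa [φ] using h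
      convert h1.comp φ hφ using 1
      ext ⟨_ | a, ha⟩
      · exact absurd ha hn
      · rfl
  · by_cases hn : none ∈ J
    -- Proper faces inside `D` are images of faces of the restricted family; the components of `D`
    -- itself are smooth by its own decomposition.
    · by_cases hJ' : (Finset.eraseNone J).Nonempty
      · have hmem : ∀ y ∈ F, ∀ o ∈ J, y ∈ ((o.elim D x : PseudoDivisor T)).support :=
          fun y hy o ho => mem_face.1 (hF.1.2 hy) o ho
        obtain ⟨y₀, hy₀⟩ := hF.1.1.nonempty
        obtain ⟨G, rfl⟩ := exists_imageClosed_eq s F fun y hy => by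
          rw [← hs]
          exact hmem y hy none hn
        let K : Finset {i // ∃ v, s v ∈ (x i).support} := (Finset.eraseNone J).subtype _
        have hmeets : ∀ i, some i ∈ J → ∃ v, s v ∈ (x i).support := fun i hi => by
          obtain ⟨v, rfl⟩ := (hrange _).1 (hmem y₀ hy₀ none hn)
          exact ⟨v, hmem _ hy₀ (some i) hi⟩
        have hKne : K.Nonempty := by
          obtain ⟨i, hi⟩ := hJ'
          have hi' := Finset.mem_eraseNone.1 hi
          exact ⟨⟨i, hmeets i hi'⟩, by simpa [K] using hi'⟩
        have hfaceK : imageClosed s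
            (face (fun i : {i // ∃ v, s v ∈ (x i).support} => (x i.1).pullback s) K) =
            face (fun o : Option ι => o.elim D x) J := by
          ext y
          change y ∈ imageClosed s _ ↔ y ∈ face _ J
          rw [mem_imageClosed, mem_face]
          constructor
          · rintro ⟨v, hv, rfl⟩ (_ | i) ho
            · exact (hrange _).2 ⟨v, rfl⟩
            · exact (PseudoDivisor.mem_support_pullback _ _ _).1
                (mem_face.1 hv ⟨i, hmeets i ho⟩ (by simpa [K] using ho))
          · intro h
            obtain ⟨v, rfl⟩ := (hrange _).1 (h none hn)
            refine ⟨v, mem_face.2 fun i hi => (PseudoDivisor.mem_support_pullback _ _ _).2 ?_, rfl⟩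
            exact h (some i.1) (by simpa [K] using hi)
        rw [← hfaceK, imageClosed_mem_components] at hF
        have hsm := hfam.smooth_face K hKne G hF
        rw [← hst, ← Category.assoc] at hsm
        have := isIntegral_red G hF.1.1
        exact smooth_of_range_eq (redι (imageClosed s G)) (redι G ≫ s)
          (by rw [range_redι_comp, range_redι]) t hsm
      · have hfaceD : face (fun o : Option ι => o.elim D x) J = D.support := by
          ext y
          change y ∈ face _ J ↔ y ∈ D.support
          rw [mem_face]
          refine ⟨fun h => h none hn, fun h o ho => ?_⟩
          cases o with
          | none => exact h
          | some i => exact absurd ⟨i, Finset.mem_eraseNone.2 ho⟩ hJ'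
        rw [hfaceD] at hF
        obtain ⟨δ⟩ := hD
        have hδ : ∀ y, y ∈ D.support ↔ ∃ i, y ∈ (δ.comp i).support := fun y => by
          simpa [δ.mult_pos] using mem_support_iff_of_prod (δ.ideal_eq y)
        obtain ⟨η, hη, hgen⟩ := RefinedCobordism.exists_generic F hF.1.1
        obtain ⟨i, hi⟩ := (hδ η).1 (hF.1.2 hη)
        have hle : F ≤ (δ.comp i).support := fun y hy => mem_closeds_of_specializes (hgen y hy) hi
        have hFi : F = (δ.comp i).support := le_antisymm hle
          (hF.2 ⟨δ.irreducible i, fun y hy => (hδ y).2 ⟨i, hy⟩⟩ hle)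
        have hsing : face δ.comp {i} = F := (face_singleton _ _).trans hFi.symm
        refine δ.smooth_face {i} (Finset.singleton_nonempty i) F ?_
        change F ∈ components (face δ.comp {i})
        rw [hsing]
        exact ⟨⟨hF.1.1, le_rfl⟩, fun _ h _ => h.2⟩
    · have hfaceJ : face (fun o : Option ι => o.elim D x) J = face x (Finset.eraseNone J) := by
        ext y
        change y ∈ face _ J ↔ y ∈ face x _
        rw [mem_face, mem_face]
        refine ⟨fun h i hi => h (some i) (Finset.mem_eraseNone.1 hi), fun h o ho => ?_⟩
        cases o with
        | none => exact absurd ho hn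
        | some i => exact h i (Finset.mem_eraseNone.2 ho)
      rw [hfaceJ] at hF
      refine hx.smooth_face _ ?_ F hF
      obtain ⟨o, ho⟩ := hJ
      cases o with
      | none => exact absurd ho hn
      | some i => exact ⟨i, Finset.mem_eraseNone.2 ho⟩

end

/-! ### Intersection with a pseudo-divisor as a first Chern class -/

section

variable {k : Type u} [Field k] {P X : Scheme.{u}} {b : P ⟶ Spec (CommRingCat.of k)}
  {p : X ⟶ P} {D : List (PseudoDivisor P)} {d : PseudoDivisor P}

/-- The cycle `c` as a cycle for the sequence `d, D`. -/
def Cycle.addHead (c : Cycle b p D) (h : IsAdmissibleIrr (c.f ≫ p ≫ b) (c.f ≫ p) (d :: D)) :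
    Cycle b p (d :: D) :=
  { c with admissible := h }

/-- A cycle inside the support acquires the bundle by definition. Otherwise the intersection is a
divisor class, and the push-forward formula for divisor classes gives the same operator. -/
theorem Cycle.push_mkQ_intersect (c : Cycle b p D)
    (h : IsAdmissibleIrr (c.f ≫ p ≫ b) (c.f ≫ p) (d :: D)) {κ : Type*} [Fintype κ]
    {x : κ → PseudoDivisor c.Y} (hx : SNCFamily (c.f ≫ p ≫ b) x)
    (hirr : ∀ l, IsPreirreducible ((x l).support : Set c.Y)) (hmon : IsMonomial x (c.f ≫ p) D)
    (hd : ¬ Set.range c.f ⊆ (d.pullback p).support → IsSNC (c.f ≫ p ≫ b)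
      ((d.pullback p).pullback c.f) ∧
      ∀ y ∈ ((d.pullback p).pullback c.f).support, ∃ l, y ∈ (x l).support)
    (Ls : List (LineBundle c.Y)) :
    Omega.push (redι (d.pullback p).support) rfl
      ((relations b (redι (d.pullback p).support ≫ p) D).mkQ
        ((c.addHead h).withBundles Ls).intersect) =
      c.eval ((Ls.map MvPolynomial.X).prod *
        MvPolynomial.X ((d.bundle.pullback p).pullback c.f)) := by
  by_cases hr : Set.range c.f ⊆ (d.pullback p).support
  · have h1 : ((c.addHead h).withBundles Ls).intersect =
        Finsupp.single (((c.addHead h).withBundles Ls).intersectInside hr) 1 := dif_pos hr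
    have h2 : c.eval ((Ls.map MvPolynomial.X).prod *
        MvPolynomial.X ((d.bundle.pullback p).pullback c.f)) =
        c.cls (Ls ++ [(d.bundle.pullback p).pullback c.f]) := by
      rw [← Cycle.eval_prod]
      simp
    rw [h1, h2]
    have h3 : Omega.push (redι (d.pullback p).support) rfl
        ((relations b (redι (d.pullback p).support ≫ p) D).mkQ
          (Finsupp.single (((c.addHead h).withBundles Ls).intersectInside hr) 1)) =
        ((((c.addHead h).withBundles Ls).intersectInside hr).push
          (redι (d.pullback p).support) rfl).cls (Ls ++ [(d.bundle.pullback p).pullback c.f]) :=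
      congrArg (relations b p D).mkQ (pushFree_single _ _ _ _)
    rw [h3]
    refine Cycle.cls_eq_of_iso (c := (((c.addHead h).withBundles Ls).intersectInside hr).push
        (redι (d.pullback p).support) rfl) (d := c) (Iso.refl c.Y) ?_
      (List.forall₂_same.2 fun L _ => (LineBundle.Iso.refl L).pullback_id)
    have h4 := redLift_redι c.f (d.pullback p).support hr
    exact (Category.id_comp _).trans h4.symm
  · obtain ⟨hsnc, hle⟩ := hd hr
    have hadm : IsAdmissibleDivisor (c.f ≫ p ≫ b) (c.f ≫ p) ((d.pullback p).pullback c.f) D :=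
      hx.isAdmissibleDivisor hirr c.sm hsnc hle fun F _ _ => hmon.pullback (redι F)
    have := c.projective.isProper
    have h1 : ((c.addHead h).withBundles Ls).intersect =
        pushFree (restrictSupport (d.pullback p) c.f) (restrictSupport_comp (d.pullback p) c.f p)
          (Ls.foldr
            (fun L => chernFree (L.pullback (redι ((d.pullback p).pullback c.f).support)))
            (divisorCycle (Category.assoc ..) rfl hadm)) :=
      (dif_neg hr).trans (dif_pos hadm)
    rw [h1]
    have hfac := restrictSupport_redι (d.pullback p) c.f
    have hgp : (restrictSupport (d.pullback p) c.f ≫ redι (d.pullback p).support) ≫ p =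
        redι ((d.pullback p).pullback c.f).support ≫ c.f ≫ p := by
      rw [hfac, Category.assoc]
    refine Eq.trans (congrArg (relations b p D).mkQ
      (pushFree_pushFree (redι (d.pullback p).support) rfl _ _ hgp _)) ?_
    exact c.mkQ_pushFree_divisorCycle hx hirr hmon hadm hle _ hfac hgp Ls

theorem Cycle.push_intersection_chernSeries (c : Cycle b p D)
    (h : IsAdmissibleIrr (c.f ≫ p ≫ b) (c.f ≫ p) (d :: D)) {κ : Type*} [Fintype κ]
    {x : κ → PseudoDivisor c.Y} (hx : SNCFamily (c.f ≫ p ≫ b) x)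
    (hirr : ∀ l, IsPreirreducible ((x l).support : Set c.Y)) (hmon : IsMonomial x (c.f ≫ p) D)
    (hd : ¬ Set.range c.f ⊆ (d.pullback p).support → IsSNC (c.f ≫ p ≫ b)
      ((d.pullback p).pullback c.f) ∧
      ∀ y ∈ ((d.pullback p).pullback c.f).support, ∃ l, y ∈ (x l).support)
    {m : ℕ} (φ : MvPowerSeries (Fin m) Lazard) (Ls : Fin m → LineBundle c.Y) :
    Omega.push (redι (d.pullback p).support) rfl
      (intersection b p d D ((c.addHead h).chernSeries φ Ls)) =
      c.eval ((c.bundles.map MvPolynomial.X).prod *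
        (truncEval (natDim c.Y) φ fun i => MvPolynomial.X (Ls i)) *
        MvPolynomial.X ((d.bundle.pullback p).pullback c.f)) := by
  have h0 : (c.addHead h).chernSeries φ Ls = ∑ e : Fin m → Fin (natDim c.Y + 1),
    Finsupp.single
      ((c.addHead h).withBundles (show List (LineBundle c.Y) from c.bundles ++
        (List.finRange m).flatMap fun i => List.replicate (e i) (Ls i)))
      (MvPowerSeries.coeff (Finsupp.equivFunOnFinite.symm fun i => (e i : ℕ)) φ) := rfl
  rw [h0, map_sum, map_sum, truncEval, Finset.mul_sum, Finset.sum_mul, map_sum]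
  refine Finset.sum_congr rfl fun e _ => ?_
  rw [intersection, LinearMap.comp_apply, Finsupp.linearCombination_single, map_smul, map_smul,
    c.push_mkQ_intersect h hx hirr hmon hd, mul_smul_comm, smul_mul_assoc, map_smul,
    ← prod_flatMap_replicate, List.map_append, List.prod_append]

variable {S M : Scheme.{u}} {m : M ⟶ S} {n : M ⟶ X} [Mono m]

theorem subClass_congr {e : Cycle b p D} {F : Closeds S} {i : e.Y ⟶ S} (hi : IsSub m n e F i)
    {Q : MvPolynomial (LineBundle e.Y) Lazard} {Q' : MvPolynomial (LineBundle S) Lazard}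
    (h : e.toChern Q = e.toChern (MvPolynomial.rename (fun L => L.pullback i) Q')) :
    e.eval Q = subClass b p D m n F Q' := by
  rw [subClass_eq hi]
  exact Cycle.eval_eq_of_toChern_eq h

/-- The face series of a family of line bundles and of a subfamily. -/
theorem subClass_fglFace_map {e : Cycle b p D} {F : Closeds S} {i : e.Y ⟶ S}
    (hi : IsSub m n e F i) {N r r' : ℕ} (hN : natDim e.Y ≤ N) (a : Fin r → ℕ) (l : Fin r' → Fin r)
    (hl : Function.Injective l) (J : Finset (Fin r')) (Ls : Fin r → LineBundle S) :
    subClass b p D m n F (truncEval N (fglFace (a ∘ l) J) fun j => MvPolynomial.X (Ls (l j))) =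
      subClass b p D m n F
        (truncEval N (fglFace a (J.map ⟨l, hl⟩)) fun j => MvPolynomial.X (Ls j)) := by
  rw [subClass_eq hi, LinearMap.comp_apply, LinearMap.comp_apply, AlgHom.toLinearMap_apply,
    AlgHom.toLinearMap_apply]
  refine Cycle.eval_eq_of_toChern_eq ?_
  rw [rename_truncEval, rename_truncEval, Cycle.toChern_truncEval hN,
    Cycle.toChern_truncEval hN, nilEval_fglFace_map a l hl J fun j => Cycle.isNilpotent_chern _]
  rfl

end

section

variable {k : Type u} [Field k] {T W : Scheme.{u}} {t : T ⟶ Spec (CommRingCat.of k)}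
  {w : W ⟶ Spec (CommRingCat.of k)} {D₀ D₁ B : PseudoDivisor T} {E : List (PseudoDivisor T)}

/-- The intersection of `D₀` with a power series in first Chern classes on a face. -/
theorem push_intersection_face {ι : Type*} [Fintype ι] [DecidableEq ι] {x : ι → PseudoDivisor T}
    (hx : SNCFamily t x) {J : Finset ι} {F : Closeds T} (hF : F ∈ components (face x J))
    (c : Cycle t (redι B.support) E) (hc : c.bundles = []) (i : c.Y ⟶ T)
    (hi : IsClosedImmersion i) (hrange : Set.range i = F) (hfac : c.f ≫ redι B.support = i)
    (hadm : IsAdmissibleIrr (c.f ≫ redι B.support ≫ t) (c.f ≫ redι B.support) (D₀ :: E))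
    (hE : IsMonomial (fun l => (x l).pullback i) i E)
    (hDE : IsMonomial (fun l => (x l).pullback i) i (D₀ :: E)) {m : ℕ}
    (φ : MvPowerSeries (Fin m) Lazard) (Ls : Fin m → LineBundle T) {N : ℕ}
    (hN : natDim c.Y ≤ N) :
    Omega.push (redι (D₀.pullback (redι B.support)).support) rfl
      (intersection t (redι B.support) D₀ E
        ((c.addHead hadm).chernSeries φ fun j => (Ls j).pullback i)) =
      subClass t (redι B.support) E (redι B.support) (𝟙 _) F
        ((truncEval N φ fun j => MvPolynomial.X (Ls j)) * MvPolynomial.X D₀.bundle) := by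
  have hq : c.f ≫ redι B.support ≫ t = i ≫ t := by rw [← Category.assoc, hfac]
  have := c.sm.noetherianSpace
  have himm := hx.isFaceImmersion hF i hrange
  have hres := himm.restrict hx
  rw [← hq] at hres
  -- Members may become reducible on the face, while the components of a divisor are matched with
  -- irreducible members only.
  obtain ⟨κ, _, z, π, hz, hzirr, hprod⟩ := hres.exists_refinement
  have hEz : IsMonomial z (c.f ≫ redι B.support) E := by
    rw [hfac]
    exact (hE.restrict himm).refine π hprod
  have hC : ∀ y, ((D₀.pullback (redι B.support)).pullback c.f).idealAt y =
      (D₀.pullback i).idealAt y := fun y => by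
    rw [PseudoDivisor.idealAt_pullback_comp, hfac]
  have hsub : IsSub (redι B.support) (𝟙 _) c F i := ⟨hi, hrange, c.f, hfac, Category.comp_id _⟩
  refine Eq.trans (c.push_intersection_chernSeries hadm hz
    (fun l => (hzirr l).isPreirreducible) hEz ?_ φ fun j => (Ls j).pullback i) ?_
  · intro hr
    -- The first intersection is the divisor of `D₀` on the face: either the face lies in `|D₀|`,
    -- which is excluded here, or the divisor is a monomial.
    rcases (hDE.restrict himm).refine π hprod 1 with h0 | ⟨a, ha⟩
    · refine absurd ?_ hr
      rintro _ ⟨y, rfl⟩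
      have h1 := h0 y
      rw [List.take_succ_cons, List.take_zero, interIdealAt_cons] at h1
      have h2 := (le_bot_iff.1 (le_sup_left.trans h1.le) : (D₀.pullback i).idealAt y = ⊥)
      refine (PseudoDivisor.mem_support_pullback _ c.f y).1 ?_
      rw [PseudoDivisor.mem_support_iff_idealAt, hC, h2]
      exact bot_ne_top
    · have ha' : ∀ y, ((D₀.pullback (redι B.support)).pullback c.f).idealAt y =
          ∏ l, (z l).idealAt y ^ a l := by
        intro y
        rw [hC, ← ha, List.take_succ_cons, List.take_zero, interIdealAt_cons]
        simp [interIdealAt]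
      refine ⟨hz.isSNC a ha', fun y hy => ?_⟩
      obtain ⟨l, -, -, hl⟩ := (mem_support_iff_of_prod (ha' y)).1 hy
      exact ⟨l, hl⟩
  · rw [hc, List.map_nil, List.prod_nil, one_mul]
    refine subClass_congr hsub ?_
    rw [map_mul, map_mul, map_mul, rename_truncEval, Cycle.toChern_truncEval le_rfl,
      Cycle.toChern_truncEval hN, MvPolynomial.rename_X]
    congr 1
    refine (Cycle.chern_eq_of_iso ?_).symm
    have := D₀.bundle.iso_pullback_comp (redι B.support) c.f
    rwa [hfac] at this

theorem subClass_mul_X_of_iso {F : Closeds T} {c : Cycle t (redι B.support) E} {i : c.Y ⟶ T}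
    (hi : IsSub (redι B.support) (𝟙 _) c F i) {L L' : LineBundle T} (h : LineBundle.Iso L L')
    (Q : MvPolynomial (LineBundle T) Lazard) :
    subClass t (redι B.support) E (redι B.support) (𝟙 _) F (Q * MvPolynomial.X L) =
      subClass t (redι B.support) E (redι B.support) (𝟙 _) F (MvPolynomial.X L' * Q) := by
  rw [subClass_eq hi, LinearMap.comp_apply, LinearMap.comp_apply, AlgHom.toLinearMap_apply,
    AlgHom.toLinearMap_apply, mul_comm]
  refine Cycle.eval_eq_of_toChern_eq ?_
  rw [map_mul, map_mul, map_mul, map_mul, MvPolynomial.rename_X, MvPolynomial.rename_X]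
  congr 1
  exact Cycle.chern_eq_of_iso (h.pullback i)

/-- The class of a face of the restriction of `B` to `D₁`. -/
theorem mkQ_faceCycle_restriction
    (h : IsAdmissibleDivisor (redι D₁.support ≫ t) (redι D₁.support)
      (B.pullback (redι D₁.support)) E)
    (σ : SNCDecomposition (redι D₁.support ≫ t) (B.pullback (redι D₁.support)))
    (hdom : ∀ y : red D₁.support, IsDomain ((red D₁.support).presheaf.stalk y))
    {J : Finset (Fin σ.m)} (hJ : J.Nonempty) {G : Closeds (red D₁.support)}
    (hG : G ∈ components (σ.face J)) (x : Fin σ.m → PseudoDivisor T)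
    (hx : ∀ j y, (σ.comp j).idealAt y = ((x j).pullback (redι D₁.support)).idealAt y)
    (hx0 : ∀ j y, ((x j).pullback (redι D₁.support)).eqn y ≠ 0)
    (φ : MvPowerSeries (Fin σ.m) Lazard) (hT : IsSm t) :
    ∃ (e : Cycle t (redι B.support) E) (i : e.Y ⟶ T),
      IsSub (redι B.support) (𝟙 _) e (imageClosed (redι D₁.support) G) i ∧
      natDim e.Y ≤ natDim T ∧
      (relations t (redι B.support) E).mkQ
        (pushFree (restrictSupport B (redι D₁.support)) (restrictSupport_redι B (redι D₁.support))
          ((faceCycle rfl rfl h σ J hJ G hG).chernSeries φ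
            fun j => (σ.comp j).bundle.pullback (redι G))) =
        subClass t (redι B.support) E (redι B.support) (𝟙 _) (imageClosed (redι D₁.support) G)
          (truncEval (natDim T) φ fun j => MvPolynomial.X (x j).bundle) := by
  have hint := isIntegral_red G hG.1.1
  have hle : Set.range (redι G) ⊆ (B.pullback (redι D₁.support)).support := by
    rw [range_redι]
    exact hG.1.2.trans (σ.face_le hJ)
  have hcl : IsClosedImmersion (redι G ≫ redι D₁.support) := inferInstance
  have hN : natDim (red G) ≤ natDim T := hT.natDim_le (redι G ≫ redι D₁.support)
  have hfac : (redLift (redι G) (B.pullback (redι D₁.support)).support hle ≫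
      restrictSupport B (redι D₁.support)) ≫ redι B.support = redι G ≫ redι D₁.support := by
    rw [Category.assoc, restrictSupport_redι, ← Category.assoc, redLift_redι]
  let e := faceCycle (r := redι D₁.support) (b := t) rfl rfl h σ J hJ G hG
  have hsub : IsSub (redι B.support) (𝟙 _) (e.push (restrictSupport B (redι D₁.support))
      (restrictSupport_redι B (redι D₁.support))) (imageClosed (redι D₁.support) G)
      (redι G ≫ redι D₁.support) :=
    ⟨hcl, range_redι_comp _ G, redLift (redι G) (B.pullback (redι D₁.support)).support hle ≫
      restrictSupport B (redι D₁.support), hfac, Category.comp_id _⟩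
  refine ⟨_, _, hsub, hN, ?_⟩
  have := mkQ_chernSeries_eq_subClass (restrictSupport B (redι D₁.support))
    (restrictSupport_redι B (redι D₁.support)) e rfl hsub (Ms := []) (Ms' := [])
    List.Forall₂.nil φ (Ls := fun j => (σ.comp j).bundle.pullback (redι G))
    (Ls' := fun j => (x j).bundle) (fun j => ?_) hN
  · simpa using this
  · refine (Cycle.chern_eq_of_iso (c := e)
      ((PseudoDivisor.bundle_iso_of_idealAt_eq hdom (hx j) (hx0 j)).pullback (redι G))).trans
      (Cycle.chern_eq_of_iso (c := e) ?_).symm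
    exact (x j).bundle.iso_pullback_comp (redι D₁.support) (redι G)

end

/-! ### Transversality of the section to the components of `B` -/

section

variable {k : Type u} [Field k] {T W : Scheme.{u}} {t : T ⟶ Spec (CommRingCat.of k)}
  {w : W ⟶ Spec (CommRingCat.of k)} {D₀ D₁ B : PseudoDivisor T} {E : List (PseudoDivisor T)}

theorem isReduced_of_isRegularLocalRing {Y : Scheme.{u}}
    (h : ∀ y : Y, IsRegularLocalRing (Y.presheaf.stalk y)) : IsReduced Y := by
  have : ∀ y : Y, _root_.IsReduced (Y.presheaf.stalk y) := fun y => by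
    have := h y
    infer_instance
  exact isReduced_of_isReduced_stalk Y

theorem isClosedImmersion_of_section (f : T ⟶ W) (s : W ⟶ T) (hs : s ≫ f = 𝟙 W)
    (hcl : IsClosed (Set.range s)) : IsClosedImmersion s := by
  have : IsImmersion (s ≫ f) := by
    rw [hs]
    infer_instance
  have := IsImmersion.of_comp s f
  exact IsClosedImmersion.of_isPreimmersion _ hcl

/-- The components of `B` together with a section of `V ⟶ W` over which `B` comes from `W` are in
normal crossing position, and the components of `B` have irreducible intersection with the
section. -/
theorem SNCDecomposition.option_section {Bbar : PseudoDivisor W} (σ : SNCDecomposition t B)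
    (σ' : SNCDecomposition w Bbar) (hT : ∀ y : T, IsRegularLocalRing (T.presheaf.stalk y))
    (hW : ∀ y : W, IsRegularLocalRing (W.presheaf.stalk y)) (f : T ⟶ W) (hf : f ≫ w = t)
    {V : Scheme.{u}} (ι : V ⟶ T) [IsOpenImmersion ι] (hopen : IsOpenMap (ι ≫ f))
    (hirr : GeometricallyIrreducible (ι ≫ f))
    (hBV : (B.pullback ι).SameDiv (Bbar.pullback (ι ≫ f))) (s : W ⟶ V) (hs : s ≫ ι ≫ f = 𝟙 W)
    (hD₁ : IsSNC t D₁) (hsD₁ : (D₁.support : Set T) = Set.range (s ≫ ι))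
    (hred : ∀ x, (D₁.idealAt x).IsRadical) :
    SNCFamily t (fun o : Option (Fin σ.m) => o.elim D₁ σ.comp) ∧
    ∀ i, IsPreirreducible ((((σ.comp i).pullback (redι D₁.support)).support) :
      Set (red D₁.support)) := by
  have hWred := isReduced_of_isRegularLocalRing hW
  have hsf : (s ≫ ι) ≫ f = 𝟙 W := by rw [Category.assoc, hs]
  have hst : (s ≫ ι) ≫ t = w := by rw [← hf, ← Category.assoc, hsf, Category.id_comp]
  have hcl : IsClosedImmersion (s ≫ ι) :=
    isClosedImmersion_of_section f _ hsf (hsD₁ ▸ D₁.support.isClosed)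
  have hex := exists_idealAt_pullback_section_eq σ σ' hT hW f ι hopen hirr hBV s hs
  constructor
  · refine (σ.family hT).option hD₁ (s ≫ ι) hst hsD₁ hred ?_
    choose j hj hj' using fun i : {i // ∃ v, (s ≫ ι) v ∈ (σ.comp i).support} => hex i.1 i.2
    -- The generic point of a component meeting the section lies in `V`, and over `V` components
    -- with the same image in `W` have the same points.
    have hinj : Function.Injective j := by
      intro i i' hii
      obtain ⟨η, hη, hgen⟩ := exists_generic (σ.comp i.1).support (σ.irreducible i.1)
      obtain ⟨v, hv⟩ := i.2
      have hηv := hgen _ hv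
      obtain ⟨z, rfl⟩ : η ∈ Set.range ι := by
        refine hηv.mem_open ι.opensRange.isOpen ⟨s v, ?_⟩
        simp
      refine Subtype.ext ((σ.family hT).eq_of_generic_mem hη hgen ?_)
      exact (hj' i' z).2 (hii ▸ (hj' i z).1 hη)
    exact ((σ'.family hW).comp j hinj).congr hj
  · intro i
    -- The section maps onto `D₁` and transports irreducibility from the components of `Bbar`.
    let g := redLift (s ≫ ι) D₁.support hsD₁.ge
    have hg : g ≫ redι D₁.support = s ≫ ι := redLift_redι _ _ _
    have hgsurj : Function.Surjective g := by
      intro y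
      have hy : redι D₁.support y ∈ (D₁.support : Set T) := by
        rw [← range_redι]
        exact ⟨y, rfl⟩
      rw [hsD₁] at hy
      obtain ⟨v, hv⟩ := hy
      refine ⟨v, (redι D₁.support).isClosedEmbedding.injective ?_⟩
      rw [← hv, ← hg, Scheme.Hom.comp_apply]
    have himg : ((((σ.comp i).pullback (redι D₁.support)).support) : Set (red D₁.support)) =
        g '' ((σ.comp i).pullback (s ≫ ι)).support := by
      have h1 : ∀ v, g v ∈ ((σ.comp i).pullback (redι D₁.support)).support ↔
          v ∈ ((σ.comp i).pullback (s ≫ ι)).support := fun v => by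
        rw [PseudoDivisor.mem_support_pullback, PseudoDivisor.mem_support_pullback, ← hg,
          Scheme.Hom.comp_apply]
      ext y
      constructor
      · intro hy
        obtain ⟨v, rfl⟩ := hgsurj y
        exact ⟨v, (h1 v).1 hy, rfl⟩
      · rintro ⟨v, hv, rfl⟩
        exact (h1 v).2 hv
    rw [himg]
    refine IsPreirreducible.image ?_ g g.continuous.continuousOn
    by_cases hi : ∃ v, (s ≫ ι) v ∈ (σ.comp i).support
    · obtain ⟨j, hj, -⟩ := hex i hi
      have : ((σ.comp i).pullback (s ≫ ι)).support = (σ'.comp j).support := by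
        refine SetLike.ext fun v => ?_
        rw [PseudoDivisor.mem_support_iff_idealAt, PseudoDivisor.mem_support_iff_idealAt, hj]
      rw [this]
      exact (σ'.irreducible j).isPreirreducible
    · have : (((σ.comp i).pullback (s ≫ ι)).support : Set W) = ∅ := by
        refine Set.eq_empty_of_forall_notMem fun v hv => hi ⟨v, ?_⟩
        exact (PseudoDivisor.mem_support_pullback _ _ v).1 hv
      rw [this]
      exact isPreirreducible_empty

/-- If the identity is admissible for `B, E`, then `E` is monomial on the subvarieties of `B`. -/
theorem SNCDecomposition.isMonomial_of_le (σ : SNCDecomposition t B)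
    (hT : ∀ y : T, IsRegularLocalRing (T.presheaf.stalk y))
    (h : IsAdmissible t (𝟙 T) (B :: E)) {G : Scheme.{u}} [IsReduced G] (i : G ⟶ T) (F : Closeds T)
    (hF : IsIrreducible (F : Set T)) (hi : Set.range i ⊆ F) (hle : F ≤ B.support) :
    IsMonomial (fun l => (σ.comp l).pullback i) i E := by
  have h1 := h.isMonomial (σ.family hT) σ.irreducible (fun y hy => ?_) i F hF hi
  · rw [Category.comp_id] at h1
    -- On a subvariety of `|B|` the leading entry `B` pulls back to everything and can be dropped.
    refine h1.tail (eq_top_iff.2 fun y _ => ?_)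
    exact (PseudoDivisor.mem_support_pullback _ _ y).2 (hle (hi ⟨y, rfl⟩))
  · rw [PseudoDivisor.mem_support_pullback] at hy
    obtain ⟨l, -, -, hl⟩ := (mem_support_iff_of_prod (σ.ideal_eq y)).1 hy
    exact ⟨l, hl⟩

end

/-! ### Comparison of the faces of `B` and of its restriction to `D₁` -/

section

variable {k : Type u} [Field k] {T : Scheme.{u}} {t : T ⟶ Spec (CommRingCat.of k)}
  {D₀ D₁ B : PseudoDivisor T} {E : List (PseudoDivisor T)}

/-- The polynomial in first Chern classes that occurs in the class of the face `J` of `B`. -/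
def SNCDecomposition.facePoly (σ : SNCDecomposition t B) (J : Finset (Fin σ.m)) :
    MvPolynomial (LineBundle T) Lazard :=
  truncEval (natDim T) (fglFace σ.mult J) fun i => MvPolynomial.X (σ.comp i).bundle

/-- A face of `B` is a face of the larger family through `l`. The same subvariety carries a cycle
for `D₀, E` and one for `E`; the Chern class computation takes place on the latter. -/
theorem push_intersection_faceCycle (hT : IsSm t) {ι : Type*} [Fintype ι] [DecidableEq ι]
    {x : ι → PseudoDivisor T} (hx : SNCFamily t x)
    (h : IsAdmissibleDivisor t (𝟙 T) B (D₀ :: E)) (h' : IsAdmissibleDivisor t (𝟙 T) B E)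
    (hE : ∀ F : Closeds T, IsIrreducible (F : Set T) → F ≤ B.support →
      IsMonomial (fun l => (x l).pullback (redι F)) (redι F) E)
    (hDE : ∀ F : Closeds T, IsIrreducible (F : Set T) → F ≤ B.support →
      IsMonomial (fun l => (x l).pullback (redι F)) (redι F) (D₀ :: E))
    (σ : SNCDecomposition t B) (l : Fin σ.m → ι) (hl : Function.Injective l)
    (hσ : ∀ j y, (σ.comp j).idealAt y = (x (l j)).idealAt y)
    {J : Finset (Fin σ.m)} (hJ : J.Nonempty) {F : Closeds T} (hF : F ∈ components (σ.face J)) :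
    Omega.push (redι (D₀.pullback (redι B.support)).support) rfl
      (intersection t (redι B.support) D₀ E
        ((faceCycle (Category.id_comp t) (Category.comp_id (redι B.support)) h σ J hJ F
          hF).chernSeries (fglFace σ.mult J) fun i => (σ.comp i).bundle.pullback (redι F))) =
      subClass t (redι B.support) E (redι B.support) (𝟙 _) F
        (σ.facePoly J * MvPolynomial.X D₀.bundle) := by
  have hint := isIntegral_red F hF.1.1
  have hle : F ≤ B.support := hF.1.2.trans (σ.face_le hJ)
  have hr : Set.range (redι F) ⊆ B.support := by
    rw [range_redι]
    exact hle
  have hcl : IsClosedImmersion (redι F) := inferInstance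
  have hN : natDim (red F) ≤ natDim T := hT.natDim_le (redι F)
  have hF' : F ∈ components (face x (J.map ⟨l, hl⟩)) := by
    rw [face_map_eq l hl hσ]
    exact hF
  exact push_intersection_face hx hF'
    (faceCycle (Category.id_comp t) (Category.comp_id (redι B.support)) h' σ J hJ F hF) rfl
    (redι F) hcl (range_redι F) (redLift_redι (redι F) B.support hr)
    (faceCycle (Category.id_comp t) (Category.comp_id (redι B.support)) h σ J hJ F hF).admissible
    (hE F hF.1.1 hle) (hDE F hF.1.1 hle) (fglFace σ.mult J) (fun i => (σ.comp i).bundle) hN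

/-- Moving `D₀` to the linearly equivalent divisor `D₁` in its intersection with a face of `B`. -/
theorem sum_subClass_facePoly [NoetherianSpace T] (h : IsAdmissibleDivisor t (𝟙 T) B E)
    (σ : SNCDecomposition t B)
    (hρ : SNCFamily t (fun o : Option (Fin σ.m) => o.elim D₁ σ.comp))
    (hE : ∀ F : Closeds T, IsIrreducible (F : Set T) → F ≤ B.support →
      IsMonomial (fun l => (σ.comp l).pullback (redι F)) (redι F) E)
    (hlin : LineBundle.Iso D₀.bundle D₁.bundle) {J : Finset (Fin σ.m)} (hJ : J.Nonempty)
    (Q : MvPolynomial (LineBundle T) Lazard) :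
    ∑ F ∈ (finite_components (σ.face J)).toFinset,
      subClass t (redι B.support) E (redι B.support) (𝟙 _) F (Q * MvPolynomial.X D₀.bundle) =
    ∑ G ∈ (finite_components (face (fun o : Option (Fin σ.m) => o.elim D₁ σ.comp)
        (insert none (J.map ⟨some, Option.some_injective _⟩)))).toFinset,
      subClass t (redι B.support) E (redι B.support) (𝟙 _) G Q := by
  have hface : face (fun o : Option (Fin σ.m) => o.elim D₁ σ.comp) (J.map ⟨some, Option.some_injective _⟩) = σ.face J :=
    face_map_eq (x := fun o : Option (Fin σ.m) => o.elim D₁ σ.comp) (z := σ.comp) some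
      (Option.some_injective _) (fun _ _ => rfl) J
  have hsub : ∀ F (hF : F ∈ components (σ.face J)), IsMonomialSub t
      (fun o : Option (Fin σ.m) => o.elim D₁ σ.comp) (redι B.support) (𝟙 _)
      (faceCycle (Category.id_comp t) (Category.comp_id (redι B.support)) h σ J hJ F hF) F
      (redι F) := by
    intro F hF
    have hint := isIntegral_red F hF.1.1
    have hle : F ≤ B.support := hF.1.2.trans (σ.face_le hJ)
    have hr : Set.range (redι F) ⊆ B.support := by
      rw [range_redι]
      exact hle
    have hfac := redLift_redι (redι F) B.support hr
    have hmon : IsMonomial (fun o : Option (Fin σ.m) => (o.elim D₁ σ.comp).pullback (redι F))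
        (redLift (redι F) B.support hr ≫ redι B.support) E := by
      rw [hfac]
      exact (hE F hF.1.1 hle).of_comp some fun _ _ => rfl
    have hcl : IsClosedImmersion (redι F) := inferInstance
    have hcomp : redι F ≫ t = redLift (redι F) B.support hr ≫ redι B.support ≫ t := by
      rw [← Category.assoc, hfac]
    exact ⟨⟨hcl, range_redι F, redLift (redι F) B.support hr, hfac,
      Category.comp_id _⟩, hcomp, hmon⟩
  have key := (sum_subClass_insert (b := t) (p := redι B.support) (D := E) (m := redι B.support)
    (n := 𝟙 _) hρ (J := J.map ⟨some, Option.some_injective _⟩) (fun F hF => ⟨_, _, hsub F (hface ▸ hF)⟩)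
    (j := none) (by simp)).2 Q
  rw [← key, hface]
  refine Finset.sum_congr rfl fun F hF => ?_
  exact subClass_mul_X_of_iso (hsub F ((Set.Finite.mem_toFinset _).1 hF)).toIsSub hlin Q

theorem PseudoDivisor.idealAt_pullback_prod {Y : Scheme.{u}} {ι : Type*} [Fintype ι]
    {x : ι → PseudoDivisor T} {a : ι → ℕ} {C : PseudoDivisor T} (f : Y ⟶ T) (y : Y)
    (h : C.idealAt (f y) = ∏ i, (x i).idealAt (f y) ^ a i) :
    (C.pullback f).idealAt y = ∏ i, ((x i).pullback f).idealAt y ^ a i := by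
  rw [PseudoDivisor.idealAt_pullback, h, ← Ideal.mapHom_apply, map_prod]
  simp_rw [map_pow, Ideal.mapHom_apply, PseudoDivisor.idealAt_pullback]

/-- The multiplicities of a matching decomposition. -/
theorem SNCFamily.mult_eq_of_matching {Y : Scheme.{u}} {q : Y ⟶ Spec (CommRingCat.of k)}
    {ι : Type*} [Fintype ι] {x : ι → PseudoDivisor Y} (hx : SNCFamily q x) {C : PseudoDivisor Y}
    (σ : SNCDecomposition q C) {a : ι → ℕ} (hC : ∀ y, C.idealAt y = ∏ i, (x i).idealAt y ^ a i)
    {l : Fin σ.m → ι} (hl : Function.Injective l)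
    (hσ : ∀ j y, (σ.comp j).idealAt y = (x (l j)).idealAt y) :
    σ.mult = a ∘ l ∧ ∀ i, 0 < a i → ((x i).support : Set Y).Nonempty → i ∈ Set.range l := by
  -- The given exponents and the multiplicities extended by zero describe the same divisor, so they
  -- agree on every member with a point.
  have h1 : ∀ y, ∏ i, (x i).idealAt y ^ a i =
      ∏ i, (x i).idealAt y ^ Function.extend l σ.mult 0 i := fun y => by
    rw [← hC, σ.ideal_eq]
    refine Fintype.prod_of_injective l hl _ _ (fun i hi => ?_) fun j => ?_
    · rw [Function.extend_apply' _ _ _ hi]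
      simp
    · rw [hl.extend_apply, hσ]
  constructor
  · funext j
    obtain ⟨y, hy⟩ := (σ.irreducible j).nonempty
    have hy' : y ∈ (x (l j)).support := by
      rw [PseudoDivisor.mem_support_iff_idealAt, ← hσ, ← PseudoDivisor.mem_support_iff_idealAt]
      exact hy
    have := hx.exponent_eq (h1 y) hy'
    rw [hl.extend_apply] at this
    exact this.symm
  · rintro i hi ⟨y, hy⟩
    by_contra h
    have := hx.exponent_eq (h1 y) hy
    rw [Function.extend_apply' _ _ _ (by simpa using h)] at this
    exact hi.ne' this

end

section

variable {k : Type u} [Field k] {T : Scheme.{u}} {t : T ⟶ Spec (CommRingCat.of k)}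
  {D₀ D₁ B : PseudoDivisor T} {E : List (PseudoDivisor T)}

theorem sum_components_imageClosed {X Y : Scheme.{u}} [NoetherianSpace X] [NoetherianSpace Y]
    (i : X ⟶ Y) [IsClosedImmersion i] (K : Closeds X) {M : Type*} [AddCommMonoid M]
    (g : Closeds Y → M) :
    ∑ F ∈ (finite_components K).toFinset, g (imageClosed i F) =
      ∑ G ∈ (finite_components (imageClosed i K)).toFinset, g G := by
  refine Finset.sum_nbij (imageClosed i) (fun F hF => ?_) (imageClosed_injective i).injOn
    (fun G hG => ?_) fun _ _ => rfl
  · rw [Set.Finite.mem_toFinset] at hF ⊢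
    exact (imageClosed_mem_components i).2 hF
  · rw [Finset.mem_coe, Set.Finite.mem_toFinset] at hG
    obtain ⟨F, rfl⟩ := exists_imageClosed_eq i G (by
      intro y hy
      obtain ⟨x, -, hx⟩ := hG.1.2 hy
      exact ⟨x, hx⟩)
    refine ⟨F, ?_, rfl⟩
    rw [Finset.mem_coe, Set.Finite.mem_toFinset]
    exact (imageClosed_mem_components i).1 hG

/-- The faces of the restriction of `B` to `D₁`, as faces of `D₁ + B`. -/
theorem imageClosed_face_restriction {ι κ : Type*} [DecidableEq ι] {x : ι → PseudoDivisor T}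
    {z : κ → PseudoDivisor (red D₁.support)} {l : κ → ι} (hl : Function.Injective l)
    (h : ∀ j y, (z j).idealAt y = ((x (l j)).pullback (redι D₁.support)).idealAt y)
    (J : Finset κ) :
    imageClosed (redι D₁.support) (face z J) = face (fun o : Option ι => o.elim D₁ x)
      (insert none ((J.map ⟨l, hl⟩).map ⟨some, Option.some_injective _⟩)) := by
  have h1 : ∀ y, y ∈ face z J ↔ ∀ j ∈ J, redι D₁.support y ∈ (x (l j)).support := fun y => by
    rw [mem_face]
    refine forall₂_congr fun j _ => ?_
    rw [PseudoDivisor.mem_support_iff_idealAt, h, ← PseudoDivisor.mem_support_iff_idealAt,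
      PseudoDivisor.mem_support_pullback]
  refine SetLike.ext fun y => ?_
  rw [mem_imageClosed, mem_face]
  constructor
  · rintro ⟨y, hy, rfl⟩ o ho
    simp only [Finset.mem_insert, Finset.mem_map, Function.Embedding.coeFn_mk] at ho
    obtain rfl | ⟨_, ⟨j, hj, rfl⟩, rfl⟩ := ho
    · have := Set.mem_range_self (f := redι D₁.support) y
      rwa [range_redι] at this
    · exact (h1 y).1 hy j hj
  · intro hy
    have hy0 : y ∈ (D₁.support : Set T) := hy none (Finset.mem_insert_self _ _)
    rw [← range_redι] at hy0
    obtain ⟨y, rfl⟩ := hy0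
    refine ⟨y, (h1 y).2 fun j hj => ?_, rfl⟩
    refine hy (some (l j)) ?_
    simp only [Finset.mem_insert, Finset.mem_map, Function.Embedding.coeFn_mk]
    exact Or.inr ⟨_, ⟨j, hj, rfl⟩, rfl⟩

theorem components_eq_empty {Y : Scheme.{u}} {K : Closeds Y} (h : ∀ y, y ∉ K) :
    components K = ∅ := by
  refine Set.eq_empty_of_forall_notMem fun F hF => ?_
  obtain ⟨y, hy⟩ := hF.1.1.nonempty
  exact h y (hF.1.2 hy)

/-- The class of the restriction of `B` to `D₁`, in terms of the faces of `B`. -/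
theorem push_divisorClass_restriction [NoetherianSpace T] (hT : IsSm t)
    (h : IsAdmissibleDivisor (redι D₁.support ≫ t) (redι D₁.support)
      (B.pullback (redι D₁.support)) E) (σ : SNCDecomposition t B)
    (hσ₁ : SNCFamily (redι D₁.support ≫ t) fun i => (σ.comp i).pullback (redι D₁.support))
    (hirr : ∀ i, IsPreirreducible ((((σ.comp i).pullback (redι D₁.support)).support) :
      Set (red D₁.support))) :
    Omega.push (restrictSupport B (redι D₁.support)) (restrictSupport_redι B (redι D₁.support))
        (divisorClass rfl rfl h) =
      ∑ J : {J : Finset (Fin σ.m) // J.Nonempty},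
        ∑ G ∈ (finite_components (face (fun o : Option (Fin σ.m) => o.elim D₁ σ.comp)
          (insert none (J.1.map ⟨some, Option.some_injective _⟩)))).toFinset,
          subClass t (redι B.support) E (redι B.support) (𝟙 _) G (σ.facePoly J.1) := by
  have hN₁ := h.sm.noetherianSpace
  have hB₁ : ∀ y, (B.pullback (redι D₁.support)).idealAt y =
      ∏ i, ((σ.comp i).pullback (redι D₁.support)).idealAt y ^ σ.mult i := fun y =>
    PseudoDivisor.idealAt_pullback_prod _ y (σ.ideal_eq _)
  let σ' := Classical.choice h.snc
  obtain ⟨l, hl, hlσ⟩ := hσ₁.exists_matching hirr σ' fun y hy => by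
    obtain ⟨i, -, -, hi⟩ := (mem_support_iff_of_prod (hB₁ y)).1 hy
    exact ⟨i, hi⟩
  obtain ⟨hmult, hrange⟩ := hσ₁.mult_eq_of_matching σ' hB₁ hl hlσ
  have hterm : ∀ (J : Finset (Fin σ'.m)) (hJ : J.Nonempty) (G : Closeds (red D₁.support))
      (hG : G ∈ components (σ'.face J)),
      (relations t (redι B.support) E).mkQ
        (pushFree (restrictSupport B (redι D₁.support)) (restrictSupport_redι B (redι D₁.support))
          ((faceCycle rfl rfl h σ' J hJ G hG).chernSeries (fglFace σ'.mult J)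
            fun j => (σ'.comp j).bundle.pullback (redι G))) =
        subClass t (redι B.support) E (redι B.support) (𝟙 _) (imageClosed (redι D₁.support) G)
          (σ.facePoly (J.map ⟨l, hl⟩)) := by
    intro J hJ G hG
    obtain ⟨e, i, hsub, hN, heq⟩ := mkQ_faceCycle_restriction h σ' hσ₁.isDomain hJ hG
      (fun j => σ.comp (l j)) hlσ (fun j => hσ₁.eqn_ne_zero (l j)) (fglFace σ'.mult J) hT
    rw [heq, hmult]
    exact subClass_fglFace_map hsub hN σ.mult l hl J fun i => (σ.comp i).bundle
  have hexp : Omega.push (restrictSupport B (redι D₁.support))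
      (restrictSupport_redι B (redι D₁.support)) (divisorClass rfl rfl h) =
      ∑ J : {J : Finset (Fin σ'.m) // J.Nonempty},
        ∑ G ∈ (finite_components (σ'.face J.1)).toFinset,
          subClass t (redι B.support) E (redι B.support) (𝟙 _) (imageClosed (redι D₁.support) G)
            (σ.facePoly (J.1.map ⟨l, hl⟩)) := by
    refine Eq.trans (b := (relations t (redι B.support) E).mkQ
      (pushFree (restrictSupport B (redι D₁.support)) (restrictSupport_redι B (redι D₁.support))
        (divisorCycle rfl rfl h))) rfl ?_
    rw [divisorCycle, map_sum, map_sum]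
    refine Fintype.sum_congr _ _ fun J => ?_
    rw [map_sum, map_sum]
    refine Eq.trans (Fintype.sum_congr _ _ fun G => ?_)
      (Finset.sum_coe_sort (finite_components (σ'.face J.1)).toFinset fun G =>
        subClass t (redι B.support) E (redι B.support) (𝟙 _) (imageClosed (redι D₁.support) G)
          (σ.facePoly (J.1.map ⟨l, hl⟩)))
    exact hterm J.1 J.2 G.1 ((Set.Finite.mem_toFinset _).1 G.2)
  rw [hexp]
  -- The index sets differ by the faces of `B` involving a component disjoint from `D₁`; these have
  -- no points on `D₁` and contribute empty sums.
  refine Fintype.sum_of_injective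
    (fun J : {J : Finset (Fin σ'.m) // J.Nonempty} =>
      (⟨J.1.map ⟨l, hl⟩, J.2.map⟩ : {J : Finset (Fin σ.m) // J.Nonempty})) ?_ _ _ ?_ ?_
  · intro J J' hJ
    exact Subtype.ext (Finset.map_injective _ (Subtype.ext_iff.1 hJ))
  · rintro ⟨J, hJ⟩ hJr
    have hempty : components (face (fun o : Option (Fin σ.m) => o.elim D₁ σ.comp)
        (insert none (J.map ⟨some, Option.some_injective _⟩))) = ∅ := by
      refine components_eq_empty fun y hy => hJr ?_
      rw [mem_face] at hy
      have hy0 : y ∈ (D₁.support : Set T) := hy none (Finset.mem_insert_self _ _)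
      rw [← range_redι] at hy0
      obtain ⟨y, rfl⟩ := hy0
      have hJl : ∀ i ∈ J, i ∈ Set.range l := fun i hi => by
        refine hrange i (σ.mult_pos i) ⟨y, ?_⟩
        refine (PseudoDivisor.mem_support_pullback _ _ y).2 (hy (some i) ?_)
        exact Finset.mem_insert_of_mem (Finset.mem_map.2 ⟨i, hi, rfl⟩)
      have hJe : (J.preimage l hl.injOn).map ⟨l, hl⟩ = J := by
        rw [Finset.map_eq_image]
        exact (Finset.image_preimage _ _ _).trans (Finset.filter_true_of_mem hJl)
      refine ⟨⟨J.preimage l hl.injOn, ?_⟩, Subtype.ext hJe⟩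
      rwa [← Finset.map_nonempty (f := ⟨l, hl⟩), hJe]
    refine Finset.sum_eq_zero fun G hG => ?_
    rw [Set.Finite.mem_toFinset, hempty] at hG
    exact hG.elim
  · intro J
    have := sum_components_imageClosed (redι D₁.support) (σ'.face J.1)
      (fun G => subClass t (redι B.support) E (redι B.support) (𝟙 _) G
        (σ.facePoly (J.1.map ⟨l, hl⟩)))
    have hface : imageClosed (redι D₁.support) (σ'.face J.1) = _ :=
      imageClosed_face_restriction (x := σ.comp) hl hlσ J.1
    rw [hface] at this
    exact this

end

end RefinedCobordism

end

/-! ### The two intersections of the divisor class -/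

open RefinedCobordism AlgebraicGeometry CategoryTheory in
theorem proposition4p4 {k : Type u} [Field k] [CharZero k] {W T : Scheme.{u}}
    (w : W ⟶ Spec (CommRingCat.of k)) (t : T ⟶ Spec (CommRingCat.of k))
    (hW : IsSm w) (hT : IsSm t) (f : T ⟶ W) (hf : f ≫ w = t)
    (E : List (PseudoDivisor W)) (D₀ D₁ B : PseudoDivisor T)
    (hD₀ : IsSNC t D₀) (hD₁ : IsSNC t D₁) (hB : IsSNC t B)
    (hD₀E : IsAdmissible t (𝟙 T) (D₀ :: E.map fun e => e.pullback f))
    (hBE : IsAdmissible t (𝟙 T) (B :: E.map fun e => e.pullback f))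
    (hD₀B : IsSNC t (D₀ + B))
    (hlin : LineBundle.Iso D₀.bundle D₁.bundle)
    (V : T.Opens) (hV : (D₁.support : Set T) ⊆ V)
    (hsmooth : SmoothOfRelativeDimension 1 (V.ι ≫ f))
    (hirr : GeometricallyIrreducible (V.ι ≫ f))
    (Bbar : PseudoDivisor W) (hBbar : IsAdmissibleDivisor w (𝟙 W) Bbar E)
    (hBV : (B.pullback V.ι).SameDiv (Bbar.pullback (V.ι ≫ f)))
    (s : W ⟶ V) (hs : s ≫ V.ι ≫ f = 𝟙 W)
    (hsD₁ : (D₁.support : Set T) = Set.range (s ≫ V.ι))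
    (hD₁red : ∀ x, (D₁.idealAt x).IsRadical) :
    ∃ (hBadm : IsAdmissibleDivisor t (𝟙 T) B (D₀ :: E.map fun e => e.pullback f))
      (hBD₁adm : IsAdmissibleDivisor (redι D₁.support ≫ t) (redι D₁.support)
        (B.pullback (redι D₁.support)) (E.map fun e => e.pullback f)),
      Omega.push (redι (D₀.pullback (redι B.support)).support) rfl
        (intersection t (redι B.support) D₀ (E.map fun e => e.pullback f)
          (divisorCycle (Category.id_comp t) (Category.comp_id (redι B.support)) hBadm)) =
      Omega.push (restrictSupport B (redι D₁.support)) (restrictSupport_redι B (redι D₁.support))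
        (divisorClass rfl rfl hBD₁adm) := by
  have hsm := hT.smooth
  have hsmW := hW.smooth
  have hTreg : ∀ y : T, IsRegularLocalRing (T.presheaf.stalk y) := isRegularLocalRing_stalk t
  have hWreg : ∀ y : W, IsRegularLocalRing (W.presheaf.stalk y) := isRegularLocalRing_stalk w
  have hWred := isReduced_of_isRegularLocalRing hWreg
  have hnoeth := hT.noetherianSpace
  generalize (E.map fun e => e.pullback f) = E' at hD₀E hBE ⊢
  obtain ⟨τ⟩ := hD₀B
  have hτ := τ.family hTreg
  have hτle : ∀ y, y ∈ D₀.support ∨ y ∈ B.support → ∃ l, y ∈ (τ.comp l).support := by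
    intro y hy
    have h1 : y ∈ (D₀ + B).support := by
      rw [PseudoDivisor.mem_support_iff_idealAt, PseudoDivisor.idealAt_add]
      rw [PseudoDivisor.mem_support_iff_idealAt, PseudoDivisor.mem_support_iff_idealAt] at hy
      intro h
      rcases hy with hy | hy
      · exact hy (eq_top_iff.2 (h.ge.trans Ideal.mul_le_left))
      · exact hy (eq_top_iff.2 (h.ge.trans Ideal.mul_le_right))
    obtain ⟨l, -, -, hl⟩ := (mem_support_iff_of_prod (τ.ideal_eq y)).1 h1
    exact ⟨l, hl⟩
  have hτirr := fun l => (τ.irreducible l).isPreirreducible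
  -- `D₀` heads its sequence and its components are among those of `D₀ + B`, so the sequence is
  -- monomial in the latter.
  have hτDE : ∀ F : Closeds T, IsIrreducible (F : Set T) → F ≤ B.support →
      IsMonomial (fun l => (τ.comp l).pullback (redι F)) (redι F) (D₀ :: E') := by
    intro F hF _
    have hd : ∀ y ∈ (D₀.pullback (𝟙 T)).support, ∃ l, y ∈ (τ.comp l).support := fun y hy =>
      hτle y (Or.inl ((PseudoDivisor.mem_support_pullback D₀ (𝟙 T) y).1 hy))
    have := hD₀E.isMonomial hτ τ.irreducible hd (redι F) F hF (range_redι F).le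
    rwa [Category.comp_id] at this
  have hBadm : IsAdmissibleDivisor t (𝟙 T) B (D₀ :: E') :=
    hτ.isAdmissibleDivisor hτirr hT hB (fun y hy => hτle y (Or.inr hy)) fun F hF hle => by
      rw [Category.comp_id]
      exact hτDE F hF hle
  let σ := Classical.choice hBadm.snc
  have hσ := σ.family hTreg
  have hσle : ∀ y ∈ B.support, ∃ l, y ∈ (σ.comp l).support := fun y hy => by
    obtain ⟨l, -, -, hl⟩ := (mem_support_iff_of_prod (σ.ideal_eq y)).1 hy
    exact ⟨l, hl⟩
  -- On subvarieties of `|B|` the tail alone is monomial in the components of `B`; this is needed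
  -- because the section relations are used relative to the tail.
  have hσE : ∀ F : Closeds T, IsIrreducible (F : Set T) → F ≤ B.support →
      IsMonomial (fun l => (σ.comp l).pullback (redι F)) (redι F) E' := fun F hF hle =>
    σ.isMonomial_of_le hTreg hBE (redι F) F hF (range_redι F).le hle
  have hBE' : IsAdmissibleDivisor t (𝟙 T) B E' :=
    hσ.isAdmissibleDivisor (fun l => (σ.irreducible l).isPreirreducible) hT hB hσle
      fun F hF hle => by
        rw [Category.comp_id]
        exact hσE F hF hle
  obtain ⟨l, hl, hlσ⟩ := hτ.exists_matching hτirr σ fun y hy => hτle y (Or.inr hy)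
  have hτE : ∀ F : Closeds T, IsIrreducible (F : Set T) → F ≤ B.support →
      IsMonomial (fun l => (τ.comp l).pullback (redι F)) (redι F) E' := fun F hF hle =>
    (hσE F hF hle).of_comp l fun j y => by
      rw [PseudoDivisor.idealAt_pullback, PseudoDivisor.idealAt_pullback, hlσ]
  obtain ⟨σbar⟩ := hBbar.snc
  have hopen : IsOpenMap (V.ι ≫ f) := by
    have := SmoothOfRelativeDimension.smooth 1 (V.ι ≫ f)
    exact (V.ι ≫ f).isOpenMap
  obtain ⟨hρ, hirr₁⟩ := σ.option_section σbar hTreg hWreg f hf V.ι hopen hirr hBV s hs hD₁ hsD₁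
    hD₁red
  -- `D₁` is itself a face of the family formed by `D₁` and the components of `B`, so these
  -- components restrict to a normal crossing family on it.
  have himm : IsFaceImmersion (fun o : Option (Fin σ.m) => o.elim D₁ σ.comp) {none}
      (redι D₁.support) := by
    refine isFaceImmersion_of_range_eq_face _ ?_
    rw [range_redι, face_singleton]
    rfl
  have hσ₁ : SNCFamily (redι D₁.support ≫ t)
      fun i => (σ.comp i).pullback (redι D₁.support) :=
    (himm.restrict hρ).comp (fun i : Fin σ.m => ⟨some i, by simp⟩) fun i j h => by simpa using h
  have hsf : (s ≫ V.ι) ≫ f = 𝟙 W := by rw [Category.assoc, hs]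
  have hcl : IsClosedImmersion (s ≫ V.ι) :=
    isClosedImmersion_of_section f _ hsf (hsD₁ ▸ D₁.support.isClosed)
  have hst : (s ≫ V.ι) ≫ t = w := by rw [← hf, ← Category.assoc, hsf, Category.id_comp]
  have hsm₁ : IsSm (redι D₁.support ≫ t) := by
    refine hT.of_isClosedImmersion _ (smooth_of_range_eq _ (s ≫ V.ι) ?_ t ?_)
    · rw [range_redι, hsD₁]
    · rw [hst]
      exact hsmW
  have hnoeth₁ := hsm₁.noetherianSpace
  have hB₁ : ∀ y, (B.pullback (redι D₁.support)).idealAt y =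
      ∏ i, ((σ.comp i).pullback (redι D₁.support)).idealAt y ^ σ.mult i := fun y =>
    PseudoDivisor.idealAt_pullback_prod _ y (σ.ideal_eq _)
  have hBD₁adm : IsAdmissibleDivisor (redι D₁.support ≫ t) (redι D₁.support)
      (B.pullback (redι D₁.support)) E' := by
    refine hσ₁.isAdmissibleDivisor hirr₁ hsm₁ (hσ₁.isSNC σ.mult hB₁) (fun y hy => ?_)
      fun F hF hle => ?_
    · exact hσle _ ((PseudoDivisor.mem_support_pullback _ _ y).1 hy)|>.imp fun l h =>
        (PseudoDivisor.mem_support_pullback _ _ y).2 h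
    · have hle' : imageClosed (redι D₁.support) F ≤ B.support := by
        rintro _ ⟨y, hy, rfl⟩
        exact (PseudoDivisor.mem_support_pullback _ _ y).1 (hle hy)
      refine (σ.isMonomial_of_le hTreg hBE (redι F ≫ redι D₁.support)
        (imageClosed (redι D₁.support) F) ((isIrreducible_imageClosed _).2 hF)
        (range_redι_comp _ F).le hle').congr fun i y => ?_
      rw [PseudoDivisor.idealAt_pullback_comp]
  refine ⟨hBadm, hBD₁adm, ?_⟩
  -- Both sides are now sums over the faces of `B`; on each face `D₁` is traded back for `D₀`
  -- through the isomorphism of their bundles.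
  rw [push_divisorClass_restriction hT hBD₁adm σ hσ₁ hirr₁, divisorCycle, map_sum, map_sum]
  refine Fintype.sum_congr _ _ fun J => ?_
  rw [map_sum, map_sum, ← sum_subClass_facePoly hBE' σ hρ hσE hlin J.2]
  refine Eq.trans (Fintype.sum_congr _ _ fun F => ?_)
    (Finset.sum_coe_sort (finite_components (σ.face J.1)).toFinset fun F =>
      subClass t (redι B.support) E' (redι B.support) (𝟙 _) F
        (σ.facePoly J.1 * MvPolynomial.X D₀.bundle))
  exact push_intersection_faceCycle hT hτ hBadm hBE' hτE hτDE σ l hl hlσ J.2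
    ((Set.Finite.mem_toFinset _).1 F.2)
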